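/- Let $L$ be a front diagram ($xz$-diagram) of a closed Legendrian curve (for example, of a Legendrian knot) in $(\mathbb R^3,\ker(dz-y\,dx))$, cut by vertical lines into inserts, each of which is a left cusp, a right cusp, a crossing, or a set of parallel lines; let zone $m$ be the part between two consecutive inserts, with its $n_m$ strands labelled $1,\dots,n_m$ from top to bottom. Let $\Gamma$ be the $xy$-diagram obtained from $L$ by Ng's resolution (left cusps become roundings, right cusps become crossings followed by roundings, crossings remain crossings, the strand with bigger $z$ going over) and by adding splashes: in each zone every strand $j\ge 2$, one after another from $j=2$ to $j=n_m$, makes a spike to above all the strands $i<j$, which produces crossings $x^-_{m;ij}$ and, to the right of it, $x^+_{m;ij}$ of the strands $i<j$. Let $\mathbf A(\Gamma)$ be the Chekanov–Eliashberg algebra of $\Gamma$: the free associative unital $\mathbb Z_2$-algebra generated by the crossings of $\Gamma$, with the derivation $d$ whose value on a crossing $s$ is the sum, over all immersed disks (up to regular isotopy) with boundary in $\Gamma$, one positive corner at $s$ and all other corners negative, of the product of the other corners in counterclockwise order. Let $\varepsilon\colon\mathbf A(\Gamma)\to\mathbb Z_2$ be an augmentation, that is, a unital ring homomorphism with $\varepsilon\circ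 d=0$. For every $m$ let $\mathcal C_m$ be the $\mathbb Z_2$-vector space with basis $\sigma_1,\dots,\sigma_{n_m}$ and put $\partial\sigma_i=\sum_{j}\varepsilon(x^+_{m;ij})\sigma_j$, where $x^+_{m;ij}=0$ for $i\ge j$. Then: 1. $\partial$ is triangular ($\partial\sigma_i$ is a combination of the $\sigma_j$ with $j>i$), and $(\mathcal C_m,\partial)$ is an acyclic complex: $\operatorname{Ker}\partial=\operatorname{Im}\partial$. 2. There is one and only one fixed point free involution $\tau_m$ of $\{1,\dots,n_m\}$ such that, for some triangular basis change $\sigma_i'=\sigma_i+\sum_{j>i}b_{ij}\sigma_j$, one has $\partial\sigma'_i=\sigma'_{\tau_m(i)}$ if $\tau_m(i)>i$, and $\partial\sigma_i'=0$ if $\tau_m(i)<i$. 3. The involutions $\tau_m$ form a normal ruling of $L$: there is a normal ruling of $L$ such that, for every $m$, strands $i,j$ of zone $m$ belong to the two paths of the ruling joining the same pair of cusps if and only if $\tau_m(i)=j$. Here a ruling consists of a one-to-one correspondence between left and right cusps and, for corresponding cusps, two paths in $L$ with increasing $x$ which join them and are disjoint except at their ends, such that paths joining different pairs of cusps meet at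 crossings only. A switch is a crossing at which the two paths through it exchange the strands. The ruling is normal if for every switch, with $z$ its height and $z_u$, $z_\ell$ the heights, on the vertical line through the switch, of the companions of the upper and of the lower path through it, one has $z_u>z>z_\ell$, or $z_\ell>z_u>z$, or $z>z_\ell>z_u$. 4. Let $\rho\ge 0$ and let the strands of $L$ between cusps have indices in $\mathbb Z/\rho$ such that at each cusp the index of the upper strand is one more than that of the lower strand (for a knot, this is possible if and only if $\rho$ divides twice the rotation number; $\rho=0$ is the integer graded case). If $\varepsilon$ is graded, that is, $\varepsilon(s)\ne0$ only for crossings $s$ of degree $0\in\mathbb Z/\rho$, then the normal ruling in 3 is graded: all its switches have degree $0\in\mathbb Z/\rho$. Here the degree of a crossing of $L$ is the difference of the indices of its two strands (the one above on its left minus the other), and the degree of a crossing of $\Gamma$ is the index of the overcrossing strand minus the index of the undercrossing strand, minus $1$ for the crossings $x^+_{m;ij}$. -/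

import Mathlib

namespace LegendrianFront

/-! ### Planar `xy`-diagrams

An `xy`-diagram without two events on one vertical line is recorded by the list of its events from
left to right.  A vertical line that avoids the events meets the diagram in finitely many points,
numbered `0, 1, 2, …` from top to bottom. Slice `p` is a vertical line between the events number
`p - 1` and `p`. -/

/-- An event of an `xy`-diagram whose crossings carry labels in `S`.

* `left k`: a rounding (vertical tangency) to the right of which there are two new points, with the
  numbers `k` and `k + 1`;
* `right k`: a rounding at which the points `k` and `k + 1` meet and disappear;
* `cross k c s`: a crossing with label `s` of the strands at the positions `k` and `k + 1`.
  If `c = true`, then the overcrossing strand (the one with the bigger `z`) descends from the upper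
  left to the lower right; if `c = false`, then it ascends from the lower left to the upper right.

Approach a crossing along the overcrossing strand: the corners to the right are positive, those to
the left are negative. So for `c = true` the west and the east corner are positive, the north and
the south corner negative; for `c = false` it is the other way round. -/
inductive Event (S : Type) : Type
  | left (k : ℕ) : Event S
  | right (k : ℕ) : Event S
  | cross (k : ℕ) (c : Bool) (s : S) : Event S

/-- The position, on the side of a rounding `k, k + 1` where its two strands are present, of the
strand which has position `i` on the side where they are absent. -/
def skip (k i : ℕ) : ℕ := if i < k then i else i + 2

/-- The two horizontal directions. -/
inductive Dir : Type
  | west : Dir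
  | east : Dir

/-- The opposite direction. -/
def Dir.opp : Dir → Dir
  | .west => .east
  | .east => .west

/-- `Dir.cat σ u v` is `u ++ v` for `σ = east`, and `v ++ u` for `σ = west`. -/
def Dir.cat {S : Type} (σ : Dir) (u v : List S) : List S :=
  match σ with
  | .east => u ++ v
  | .west => v ++ u

/-- `Across Γ σ q e q'`: when one leaves slice `q` in the direction `σ`, the first event is `e`, and
one arrives at slice `q'`. -/
def Across {S : Type} (Γ : List (Event S)) (σ : Dir) (q : ℕ) (e : Event S) (q' : ℕ) : Prop :=
  match σ with
  | .east => Γ[q]? = some e ∧ q' = q + 1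
  | .west => Γ[q']? = some e ∧ q = q' + 1

/-- A rounding at which, going in the direction `σ`, the strands `k` and `k + 1` disappear. -/
def closing (S : Type) (σ : Dir) (k : ℕ) : Event S :=
  match σ with
  | .east => .right k
  | .west => .left k

/-- A rounding at which, going in the direction `σ`, the strands `k` and `k + 1` appear. -/
def opening (S : Type) (σ : Dir) (k : ℕ) : Event S := closing S σ.opp k

/-- The ways in which the upper boundary of a piece of a disk can pass a crossing
`cross k c s`, from position `a` on one side to position `a'` on the other side: it follows its
strand, or it has a convex corner at the crossing, where the disk covers the south corner.  The
latter has to be negative. -/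
inductive TopStep (k : ℕ) (c : Bool) (a a' : ℕ) : Type
  | straight (h : a' = Equiv.swap k (k + 1) a) : TopStep k c a a'
  | corner (hc : c = true) (h : a = k + 1) (h' : a' = k + 1) : TopStep k c a a'

/-- The same for the lower boundary of a piece of a disk, and for the north corner. -/
inductive BotStep (k : ℕ) (c : Bool) (b b' : ℕ) : Type
  | straight (h : b' = Equiv.swap k (k + 1) b) : BotStep k c b b'
  | corner (hc : c = true) (h : b = k) (h' : b' = k) : BotStep k c b b'

/-- The negative corner passed, if there is one. -/
def TopStep.word {S : Type} {k : ℕ} {c : Bool} {a a' : ℕ} (s : S) : TopStep k c a a' → List S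
  | .straight _ => []
  | .corner _ _ _ => [s]

/-- The negative corner passed, if there is one. -/
def BotStep.word {S : Type} {k : ℕ} {c : Bool} {b b' : ℕ} (s : S) : BotStep k c b b' → List S
  | .straight _ => []
  | .corner _ _ _ => [s]

/-! ### Immersed disks

Let `f : P → ℝ²` be an orientation preserving immersion of a convex polygon whose boundary runs in
the diagram, with convex corners at crossings.  The function `x ∘ f` has no critical point
inside `P`. The components of its level sets are intervals, which `f` maps to vertical intervals
between two strands.  Such an interval cuts `P` into two pieces.  A disk, up to regular isotopy, is
the same as the combinatorial record of how these intervals pass, end, split and merge at the events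
of the diagram; as `P` is simply connected, this record is a tree. -/

/-- `Piece Γ σ q a b`: the pieces of immersed disks that are cut off by the vertical interval
on slice `q` between the points number `a` (above) and `b` (below), lie (at first) in the
direction `σ` from this interval, and have negative corners only.

(The points `a, b` always exist: every piece ends at crossings and roundings of the diagram.) -/
inductive Piece {S : Type} (Γ : List (Event S)) : Dir → ℕ → ℕ → ℕ → Type
  /-- The interval passes a crossing. -/
  | pass {σ : Dir} {q q' a a' b b' k : ℕ} {c : Bool} {s : S}
      (h : Across Γ σ q (.cross k c s) q') (hab : a < b)
      (t : TopStep k c a a') (u : BotStep k c b b') (P : Piece Γ σ q' a' b') : Piece Γ σ q a b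
  /-- The interval shrinks to a crossing, in a negative west or east corner. -/
  | tip {σ : Dir} {q q' a b k : ℕ} {s : S}
      (h : Across Γ σ q (.cross k false s) q') (ha : a = k) (hb : b = k + 1) : Piece Γ σ q a b
  /-- The interval shrinks to a rounding, whose inside is filled by the disk. -/
  | cap {σ : Dir} {q q' a b k : ℕ}
      (h : Across Γ σ q (closing S σ k) q') (ha : a = k) (hb : b = k + 1) : Piece Γ σ q a b
  /-- A rounding at which strands disappear lies above, below or inside the disk, away from
  its boundary. -/
  | passClosing {σ : Dir} {q q' a a' b b' k : ℕ}
      (h : Across Γ σ q (closing S σ k) q') (hab : a' < b')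
      (ha : a = skip k a') (hb : b = skip k b') (P : Piece Γ σ q' a' b') : Piece Γ σ q a b
  /-- A rounding at which strands appear lies above, below or inside the disk, away from its
  boundary. -/
  | passOpening {σ : Dir} {q q' a b k : ℕ}
      (h : Across Γ σ q (opening S σ k) q') (hab : a < b)
      (P : Piece Γ σ q' (skip k a) (skip k b)) : Piece Γ σ q a b
  /-- The lower boundary turns around a rounding. There, the interval merges with an interval
  below the rounding, the end of a piece `Q` in the opposite direction. -/
  | turnBelow {σ : Dir} {q q' a b b' k : ℕ}
      (h : Across Γ σ q (closing S σ k) q') (ha : a < k) (hb : b = k) (hb' : k ≤ b')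
      (Q : Piece Γ σ.opp q (k + 1) (b' + 2)) (P : Piece Γ σ q' a b') : Piece Γ σ q a b
  /-- The upper boundary turns around a rounding. There, the interval merges with an interval
  above the rounding, the end of a piece `Q` in the opposite direction. -/
  | turnAbove {σ : Dir} {q q' a a' b b' k : ℕ}
      (h : Across Γ σ q (closing S σ k) q') (ha : a = k + 1) (hb : b = b' + 2) (hb' : k ≤ b')
      (ha' : a' < k)
      (Q : Piece Γ σ.opp q a' k) (P : Piece Γ σ q' a' b') : Piece Γ σ q a b
  /-- The boundary wraps from outside around a rounding, which splits the interval. -/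
  | split {σ : Dir} {q q' a b k : ℕ}
      (h : Across Γ σ q (opening S σ k) q') (ha : a < k) (hb : k ≤ b)
      (P : Piece Γ σ q' a k) (Q : Piece Γ σ q' (k + 1) (b + 2)) : Piece Γ σ q a b

/-- The negative corners of a piece, in the counterclockwise order along its boundary. For pieces in
the direction east the boundary is followed from the lower to the upper end of the interval, for
pieces in the direction west from the upper to the lower end. -/
def Piece.word {S : Type} {Γ : List (Event S)} :
    {σ : Dir} → {q a b : ℕ} → Piece Γ σ q a b → List S
  | σ, _, _, _, .pass (s := s) _ _ t u P => σ.cat (u.word s) (σ.cat P.word (t.word s))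
  | _, _, _, _, .tip (s := s) _ _ _ => [s]
  | _, _, _, _, .cap _ _ _ => []
  | _, _, _, _, .passClosing _ _ _ _ P => P.word
  | _, _, _, _, .passOpening _ _ P => P.word
  | σ, _, _, _, .turnBelow _ _ _ _ Q P => σ.cat Q.word P.word
  | σ, _, _, _, .turnAbove _ _ _ _ _ Q P => σ.cat P.word Q.word
  | σ, _, _, _, .split _ _ _ P Q => σ.cat Q.word P.word

/-- The immersed disks with initial corner at the crossing `s`, where they cover a positive corner,
all of whose further corners are negative. The constructors tell which corner at `s` is covered. -/
inductive Disk {S : Type} (Γ : List (Event S)) (s : S) : Type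
  | east {p k : ℕ} (h : Γ[p]? = some (.cross k true s)) (P : Piece Γ .east (p + 1) k (k + 1)) :
      Disk Γ s
  | west {p k : ℕ} (h : Γ[p]? = some (.cross k true s)) (P : Piece Γ .west p k (k + 1)) :
      Disk Γ s
  | north {p k a : ℕ} (h : Γ[p]? = some (.cross k false s)) (ha : a < k)
      (P : Piece Γ .east (p + 1) a k) (Q : Piece Γ .west p a k) : Disk Γ s
  | south {p k b : ℕ} (h : Γ[p]? = some (.cross k false s)) (hb : k + 1 < b)
      (P : Piece Γ .west p (k + 1) b) (Q : Piece Γ .east (p + 1) (k + 1) b) : Disk Γ s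

/-- The corners of a disk other than the initial one, in counterclockwise order from the initial
one. -/
def Disk.word {S : Type} {Γ : List (Event S)} {s : S} : Disk Γ s → List S
  | .east _ P => P.word
  | .west _ P => P.word
  | .north _ _ P Q => P.word ++ Q.word
  | .south _ _ P Q => P.word ++ Q.word

/-! ### The Chekanov–Eliashberg algebra -/

/-- The crossings of a diagram (in which different crossings have different labels). -/
def Crossing {S : Type} (Γ : List (Event S)) : Type := {s : S // ∃ k c, Event.cross k c s ∈ Γ}

/-- The free associative unital `ℤ/2`-algebra generated by the crossings. -/
abbrev Alg {S : Type} (Γ : List (Event S)) : Type := FreeAlgebra (ZMod 2) (Crossing Γ)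

open Classical in
/-- The generator with label `s` (zero, if there is no crossing with this label). -/
noncomputable def gen {S : Type} (Γ : List (Event S)) (s : S) : Alg Γ :=
  if h : ∃ k c, Event.cross k c s ∈ Γ then FreeAlgebra.ι (ZMod 2) (⟨s, h⟩ : Crossing Γ) else 0

/-- The value of the differential on a crossing: the sum over the disks with initial corner there of
the products of the other corners. (A disk has positive area, which is the height of its initial
corner minus the heights of the other corners, and so the diagram of a Legendrian curve has finitely
many disks.) -/
noncomputable def diskSum {S : Type} (Γ : List (Event S)) (s : Crossing Γ) : Alg Γ :=
  ∑ᶠ D : Disk Γ s.1, (D.word.map (gen Γ)).prod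

/-- The algebra homomorphism `a ↦ a + δ · da` to the dual numbers over the algebra (`δ² = 0`). -/
noncomputable def dualHom {S : Type} (Γ : List (Event S)) :
    Alg Γ →ₐ[ZMod 2] TrivSqZeroExt (Alg Γ) (Alg Γ) :=
  FreeAlgebra.lift (ZMod 2) fun s : Crossing Γ =>
    TrivSqZeroExt.inl (FreeAlgebra.ι (ZMod 2) s) + TrivSqZeroExt.inr (diskSum Γ s)

/-- The differential: the derivation which is the disk sum on the crossings. -/
noncomputable def differential {S : Type} (Γ : List (Event S)) (a : Alg Γ) : Alg Γ :=
  (dualHom Γ a).snd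

theorem fst_dualHom {S : Type} (Γ : List (Event S)) (a : Alg Γ) : (dualHom Γ a).fst = a := by
  have h : (TrivSqZeroExt.fstHom (ZMod 2) (Alg Γ) (Alg Γ)).comp (dualHom Γ) =
      AlgHom.id (ZMod 2) (Alg Γ) := by
    ext s
    simp [dualHom]
  exact DFunLike.congr_fun h a

theorem differential_ι {S : Type} (Γ : List (Event S)) (s : Crossing Γ) :
    differential Γ (FreeAlgebra.ι (ZMod 2) s) = diskSum Γ s := by
  simp [differential, dualHom]

theorem differential_add {S : Type} (Γ : List (Event S)) (a b : Alg Γ) :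
    differential Γ (a + b) = differential Γ a + differential Γ b := by
  simp [differential]

theorem differential_one {S : Type} (Γ : List (Event S)) : differential Γ 1 = 0 := by
  simp [differential]

theorem differential_mul {S : Type} (Γ : List (Event S)) (a b : Alg Γ) :
    differential Γ (a * b) = a * differential Γ b + differential Γ a * b := by
  simp [differential, fst_dualHom]

/-- An augmentation: a unital ring homomorphism to `ℤ/2` that vanishes on the image of `d`. -/
def IsAugmentation {S : Type} (Γ : List (Event S)) (ε : Alg Γ →+* ZMod 2) : Prop :=
  ∀ a, ε (differential Γ a) = 0

/-! ### Front diagrams -/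

/-- The elementary parts of a front diagram (an `xz`-diagram), strands being numbered from top to
bottom (decreasing `z`) from `0`: a left cusp to the right of which the two new strands have the
numbers `k, k + 1`, a right cusp at which the strands `k, k + 1` meet, a crossing of the strands
`k, k + 1`, and parallel lines. -/
inductive FrontInsert : Type
  | leftCusp (k : ℕ) : FrontInsert
  | rightCusp (k : ℕ) : FrontInsert
  | cross (k : ℕ) : FrontInsert
  | parallel : FrontInsert

/-- The number of strands to the right of an insert, given the number `n` to the left of it. -/
def FrontInsert.next (n : ℕ) : FrontInsert → ℕ
  | .leftCusp _ => n + 2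
  | .rightCusp _ => n - 2
  | .cross _ => n
  | .parallel => n

/-- The insert makes sense with `n` strands to the left of it. -/
def FrontInsert.Fits (n : ℕ) : FrontInsert → Prop
  | .leftCusp k => k ≤ n
  | .rightCusp k => k + 1 < n
  | .cross k => k + 1 < n
  | .parallel => True

/-- The number of strands in zone `m`, which lies between the inserts number `m - 1` and `m`
(inserts are numbered from `0`): what is to the left of it is described by the first `m` inserts. -/
def strands (F : List FrontInsert) (m : ℕ) : ℕ := (F.take m).foldl FrontInsert.next 0

/-- `F` is the list of the inserts, from left to right, of a front diagram of a closed Legendrian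
curve. -/
def IsFront (F : List FrontInsert) : Prop :=
  (∀ (q : ℕ) (e : FrontInsert), F[q]? = some e → e.Fits (strands F q)) ∧ strands F F.length = 0

/-! ### The splashed diagram -/

/-- Labels for the crossings of the splashed diagram: in the splashes of zone `m`, for the strands
`i < j` of this zone, `xm m i j` and `xp m i j`; within insert number `q`, the crossing `y q k` if
this insert is a crossing of the strands `k, k + 1`, and `z q` if it is a right cusp. -/
inductive Gen : Type
  | xm (m i j : ℕ) : Gen
  | xp (m i j : ℕ) : Gen
  | y (q k : ℕ) : Gen
  | z (q : ℕ) : Gen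

/-- Ng's resolution of insert number `q`. The strand with the bigger `z`, that is, the one
which is above on the left, overcrosses, and it descends in the `xy`-plane. -/
def resolve (q : ℕ) : FrontInsert → List (Event Gen)
  | .leftCusp k => [.left k]
  | .rightCusp k => [.cross k true (.z q), .right k]
  | .cross k => [.cross k true (.y q k)]
  | .parallel => []

/-- The splash on strand `j` in zone `m`: this strand rises above the strands `j - 1, …, 0`, and
then returns to its place. It is undercrossing all the time, as it has the smaller `z`. -/
def splash (m j : ℕ) : List (Event Gen) :=
  ((List.range j).reverse.map fun i => Event.cross i true (Gen.xm m i j)) ++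
    (List.range j).map fun i => Event.cross i false (Gen.xp m i j)

/-- The splashes in zone `m` with `n` strands, from the second top strand to the bottom strand. -/
def splashes (m n : ℕ) : List (Event Gen) := (List.range n).flatMap (splash m)

/-- The `xy`-diagram obtained from a front diagram by Ng's resolution and the splash construction. -/
def splashed (F : List FrontInsert) : List (Event Gen) :=
  F.zipIdx.flatMap fun x => resolve x.2 x.1 ++ splashes (x.2 + 1) (strands F (x.2 + 1))

/-- The matrix `X⁺` of zone `m`. (If `i ≥ j`, there is no crossing with label `xp m i j`, and the
entry is zero.) -/
noncomputable def Xplus (F : List FrontInsert) (m : ℕ) :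
    Matrix (Fin (strands F m)) (Fin (strands F m)) (Alg (splashed F)) :=
  Matrix.of fun i j => gen (splashed F) (Gen.xp m i j)

/-- The differential `∂ σ_i = ∑ j, ε(x⁺_{m;ij}) σ_j` on the vector space with the basis `σ_i`
labelled by the strands of zone `m`. -/
noncomputable def zoneDifferential (F : List FrontInsert) (ε : Alg (splashed F) →+* ZMod 2) (m : ℕ) :
    (Fin (strands F m) → ZMod 2) →ₗ[ZMod 2] (Fin (strands F m) → ZMod 2) :=
  ((Xplus F m).map ε).vecMulLinear

/-! ### Triangular exact differentials and their involutions -/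

/-- `d e_i` is a linear combination of the `e_j` with `j > i`. -/
def IsTriangular {K : Type} [Field K] {n : ℕ} (d : (Fin n → K) →ₗ[K] (Fin n → K)) : Prop :=
  ∀ i, ∃ a : Fin n → K, d (Pi.single i 1) = ∑ j ∈ Finset.Ioi i, a j • Pi.single j 1

/-- `Ker d = Im d`. -/
def IsExact {K : Type} [Field K] {n : ℕ} (d : (Fin n → K) →ₗ[K] (Fin n → K)) : Prop :=
  LinearMap.ker d = LinearMap.range d

/-- `τ` is a fixed point free involution, and there is a triangular basis change
`e'_i = e_i + ∑_{j > i} b_ij e_j` such that `d e'_i = e'_{τ i}` if `τ i > i`, and `d e'_i = 0`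
if `τ i < i`. -/
def IsCanonicalInvolution {K : Type} [Field K] {n : ℕ} (d : (Fin n → K) →ₗ[K] (Fin n → K))
    (τ : Fin n → Fin n) : Prop :=
  (∀ i, τ (τ i) = i) ∧ (∀ i, τ i ≠ i) ∧
    ∃ (b : Fin n → Fin n → K) (e' : Fin n → Fin n → K),
      (∀ i, e' i = Pi.single i 1 + ∑ j ∈ Finset.Ioi i, b i j • Pi.single j 1) ∧
      ∀ i, (i < τ i → d (e' i) = e' (τ i)) ∧ (τ i < i → d (e' i) = 0)

/-! ### Rulings -/

/-- The numbers of the inserts which are left cusps. -/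
def leftCusps (F : List FrontInsert) : Set ℕ := {q | ∃ k, F[q]? = some (FrontInsert.leftCusp k)}

/-- The numbers of the inserts which are right cusps. -/
def rightCusps (F : List FrontInsert) : Set ℕ := {q | ∃ k, F[q]? = some (FrontInsert.rightCusp k)}

/-- A path within the diagram with increasing `x`, which is not at an end, can go through the insert
from strand `i` on its left to strand `i'` on its right.  At a crossing it may change the strand. -/
def FrontInsert.Step (i i' : ℕ) : FrontInsert → Prop
  | .leftCusp k => i' = skip k i
  | .rightCusp k => i = skip k i'
  | .cross k => if i = k ∨ i = k + 1 then i' = k ∨ i' = k + 1 else i' = i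
  | .parallel => i' = i

/-- A ruling. The left cusp in insert `l` corresponds to the right cusp in insert `rc l`, and they
are joined by the two paths `path l false` and `path l true`, which are in the strand `path l b m`
in zone `m`, for `l < m ≤ rc l`. (The values at other arguments have no meaning.) The path with
`b = false` is the one that starts in the upper strand. -/
structure Ruling (F : List FrontInsert) where
  rc : ℕ → ℕ
  path : ℕ → Bool → ℕ → ℕ
  /-- A correspondence between left and right cusps. -/
  bijOn : Set.BijOn rc (leftCusps F) (rightCusps F)
  lt_rc : ∀ l ∈ leftCusps F, l < rc l
  start : ∀ l k, F[l]? = some (FrontInsert.leftCusp k) →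
    path l false (l + 1) = k ∧ path l true (l + 1) = k + 1
  finish : ∀ l ∈ leftCusps F, ∀ k, F[rc l]? = some (FrontInsert.rightCusp k) →
    ({path l false (rc l), path l true (rc l)} : Set ℕ) = {k, k + 1}
  step : ∀ l ∈ leftCusps F, ∀ b q e, l < q → q < rc l → F[q]? = some e →
    e.Step (path l b q) (path l b (q + 1))
  /-- The two paths that join corresponding cusps do not meet in between, either within a zone … -/
  disjoint : ∀ l ∈ leftCusps F, ∀ m, l < m → m ≤ rc l → path l false m ≠ path l true m
  /-- … or at a crossing. -/
  disjoint_cross : ∀ l ∈ leftCusps F, ∀ q k, l < q → q < rc l → F[q]? = some (FrontInsert.cross k) →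
    ({path l false q, path l true q} : Set ℕ) ≠ {k, k + 1}
  /-- Paths joining different pairs of cusps meet at crossings only. -/
  disjoint_other : ∀ l ∈ leftCusps F, ∀ l' ∈ leftCusps F, l ≠ l' → ∀ b b' m,
    l < m → m ≤ rc l → l' < m → m ≤ rc l' → path l b m ≠ path l' b' m

/-- In zone `m`, the strands `i` and `j` belong to the two paths joining the same pair of cusps.
This is the involution of the strands in zone `m` that belongs to the ruling. -/
def Ruling.Paired {F : List FrontInsert} (R : Ruling F) (m i j : ℕ) : Prop :=
  ∃ l ∈ leftCusps F, l < m ∧ m ≤ R.rc l ∧ ∃ b, R.path l b m = i ∧ R.path l (!b) m = j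

/-- The insert number `q` is a crossing of the strands `k, k + 1`, and it is a switch of the ruling:
the two paths through it exchange the strands, so the upper path stays above. -/
def Ruling.IsSwitch {F : List FrontInsert} (R : Ruling F) (q k : ℕ) : Prop :=
  F[q]? = some (FrontInsert.cross k) ∧ ∃ l ∈ leftCusps F, l < q ∧ q < R.rc l ∧
    ∃ b, R.path l b q = k ∧ R.path l b (q + 1) = k

/-- All switches are normal. Let `u` and `v` be the strands, on the vertical line through a
switch, of the companion paths of the upper and of the lower path through the switch. With
`z_u, z_v, z` the heights of these strands and of the switch, the condition is that
`z_u > z > z_v`, or `z_v > z_u > z`, or `z > z_v > z_u`. -/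
def Ruling.IsNormal {F : List FrontInsert} (R : Ruling F) : Prop :=
  ∀ q k, R.IsSwitch q k → ∀ u v, R.Paired q k u → R.Paired q (k + 1) v →
    (u < k ∧ k + 1 < v) ∨ (v < u ∧ u < k) ∨ (k + 1 < v ∧ v < u)

/-! ### Gradings -/

/-- `μ m i` is the index of strand `i` in zone `m`: at a cusp, the index of the upper strand is one
more than the index of the lower one. For a knot with rotation number `R`, such indices exist if and
only if `ρ` divides `2 R`, and then they are unique up to a common summand. The case of an integral
grading is `ρ = 0`, `R = 0`. -/
def IsIndex (F : List FrontInsert) {ρ : ℕ} (μ : ℕ → ℕ → ZMod ρ) : Prop :=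
  ∀ (q : ℕ) (e : FrontInsert), F[q]? = some e → match e with
    | .leftCusp k => μ (q + 1) k = μ (q + 1) (k + 1) + 1 ∧
        ∀ i < strands F q, μ (q + 1) (skip k i) = μ q i
    | .rightCusp k => μ q k = μ q (k + 1) + 1 ∧
        ∀ i < strands F (q + 1), μ (q + 1) i = μ q (skip k i)
    | .cross k => ∀ i < strands F q, μ (q + 1) (Equiv.swap k (k + 1) i) = μ q i
    | .parallel => ∀ i < strands F q, μ (q + 1) i = μ q i

/-- The degree of the front crossing of the strands `k, k + 1` in insert `q`: the index of the
strand which is above on the left, minus the index of the other strand. -/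
def crossDegree {ρ : ℕ} (μ : ℕ → ℕ → ZMod ρ) (q k : ℕ) : ZMod ρ := μ q k - μ q (k + 1)

/-- The degree `2 r - 1/2` of a crossing of the splashed diagram, where `r` is the number of
rotations of the tangent vector along a path from the overcrossing to the undercrossing. Each
half-turn to the left along the path lowers the index by one; what remains of `2 r - 1/2` is
`0` if the overcrossing descends, and `-1` if it ascends. So the degree is the index of the
overcrossing strand minus the index of the undercrossing strand, minus one for an `xp`. -/
def genDegree {ρ : ℕ} (μ : ℕ → ℕ → ZMod ρ) : Gen → ZMod ρ
  | .xm m i j => μ m i - μ m j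
  | .xp m i j => μ m i - μ m j - 1
  | .y q k => crossDegree μ q k
  | .z _ => 1

/-- The augmentation is non-zero only on crossings of degree zero. -/
def IsGradedAugmentation (F : List FrontInsert) {ρ : ℕ} (μ : ℕ → ℕ → ZMod ρ)
    (ε : Alg (splashed F) →+* ZMod 2) : Prop :=
  ∀ s : Crossing (splashed F), ε (FreeAlgebra.ι (ZMod 2) s) ≠ 0 → genDegree μ s.1 = 0

/-- All switches of the ruling have degree zero. -/
def Ruling.IsGraded {F : List FrontInsert} {ρ : ℕ} (μ : ℕ → ℕ → ZMod ρ) (R : Ruling F) : Prop :=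
  ∀ q k, R.IsSwitch q k → crossDegree μ q k = 0

end LegendrianFront

open LegendrianFront

/-! Only the disks at crossings whose overcrossing strand descends are needed: the `xm` of the
splashes and the `y` and `z` of the inserts. The splashes make these disks short. A piece of a disk
that enters a zone from its left end, going east, has a lower boundary which must climb its own
spike and meets the upper boundary at a positive corner; so there are no such pieces
(`isEmpty_zonePos`). To the west of the right end of a zone, the pieces between strands `i < j` all
end at `xp m i j` (`pieceSum_west_insertPos`). Thus each zone sees only the insert on its left and
the matrix `X⁺` of the preceding zone.

Let `Z i j` be the augmented count of the pieces to the west of the left end of a zone. Applying the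
augmentation to `d xm` gives `X⁺ (1 + X⁻) = (1 + X⁻) Z` (`zone_equation`), so `∂` is conjugate to
`Z` by a unitriangular matrix. The matrix `Z` comes from the preceding `X⁺` as follows. A left cusp
adds an acyclic summand on the two new strands. At a crossing `dy` gives `X⁺ k (k + 1) = 0`, and `Z`
is the conjugate of `X⁺` under a transposition combined with an elementary change. At a right cusp
`dz` gives `X⁺ k (k + 1) = 1`, and `Z` belongs to the quotient by the acyclic subcomplex spanned by
`σ_k + z σ_{k+1}` and its differential. Hence acyclicity passes from left to right.

The involution is that of Barannikov's normal form. It depends only on the filtration by leading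
coordinates: `Reach d i j` says that a vector starting at `i` has a differential starting at `j` or
later, and these relations determine the involution (`reach_iff`). Unitriangular changes do not
affect it. The change at a crossing disturbs one step of the filtration only, so the pairs either
follow the strands or stay in place; in the latter case comparing `Reach` on the two sides leaves
exactly the three normal configurations (`canonicalInvolution_cross`).

The ruling consists of the paths that follow the strands, except at the crossings where the
involutions on both sides coincide; there they stay in place. In the graded case an arrow of the
normal form lowers the index by one. At a switch the companion of the upper path keeps its index, so
the two crossing strands have equal indices. -/

namespace LegendrianFront

/-! ### Canonical involutions of triangular differentials -/

section Canonical

variable {n : ℕ}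

/-- The vectors whose coordinates with numbers less than `j` vanish. -/
def tail (n j : ℕ) : Submodule (ZMod 2) (Fin n → ZMod 2) where
  carrier := {x | ∀ l : Fin n, (l : ℕ) < j → x l = 0}
  add_mem' := fun {x y} hx hy l hl => by simp [hx l hl, hy l hl]
  zero_mem' := fun _ _ => rfl
  smul_mem' := fun c x hx l hl => by simp [hx l hl]

theorem tail_anti {i j : ℕ} (h : i ≤ j) : tail n j ≤ tail n i :=
  fun _ hx l hl => hx l (lt_of_lt_of_le hl h)

theorem eq_zero_of_mem_tail {j : ℕ} (h : n ≤ j) {x : Fin n → ZMod 2} (hx : x ∈ tail n j) :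
    x = 0 := by
  ext l
  exact hx l (lt_of_lt_of_le l.2 h)

theorem mem_tail_succ {i : Fin n} {x : Fin n → ZMod 2} (h : x ∈ tail n i) (hi : x i = 0) :
    x ∈ tail n (i + 1) := by
  intro l hl
  rcases Nat.lt_succ_iff_lt_or_eq.1 hl with h' | h'
  · exact h l h'
  · rw [Fin.ext h']; exact hi

theorem eq_one_of_ne_zero {a : ZMod 2} (h : a ≠ 0) : a = 1 := by
  revert h; revert a; decide

/-- A family of vectors which is obtained from the standard basis by a triangular change. -/
def IsUnitri (e : Fin n → Fin n → ZMod 2) : Prop := ∀ i, e i i = 1 ∧ e i ∈ tail n i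

theorem sum_Ioi_single (i l : Fin n) (b : Fin n → ZMod 2) :
    (∑ j ∈ Finset.Ioi i, b j • (Pi.single j 1 : Fin n → ZMod 2)) l = if i < l then b l else 0 := by
  simp [Finset.sum_apply, Pi.single_apply]

theorem isUnitri_iff (e : Fin n → Fin n → ZMod 2) :
    IsUnitri e ↔ ∃ b : Fin n → Fin n → ZMod 2,
      ∀ i, e i = Pi.single i 1 + ∑ j ∈ Finset.Ioi i, b i j • Pi.single j 1 := by
  constructor
  · intro h
    refine ⟨e, fun i => ?_⟩
    ext l
    rw [Pi.add_apply, sum_Ioi_single]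
    rcases lt_trichotomy l i with hl | hl | hl
    · simp [(h i).2 l hl, hl.ne, hl.not_gt]
    · subst hl; simp [(h l).1]
    · simp [hl, hl.ne']
  · rintro ⟨b, hb⟩ i
    rw [hb i]
    refine ⟨?_, fun l hl => ?_⟩
    · rw [Pi.add_apply, sum_Ioi_single]; simp
    · have hl' : l < i := hl
      rw [Pi.add_apply, sum_Ioi_single]
      simp [hl'.ne, hl'.not_gt]

theorem isCanonicalInvolution_iff (d : (Fin n → ZMod 2) →ₗ[ZMod 2] (Fin n → ZMod 2))
    (τ : Fin n → Fin n) :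
    IsCanonicalInvolution d τ ↔ (∀ i, τ (τ i) = i) ∧ (∀ i, τ i ≠ i) ∧
      ∃ e, IsUnitri e ∧ ∀ i, (i < τ i → d (e i) = e (τ i)) ∧ (τ i < i → d (e i) = 0) := by
  unfold IsCanonicalInvolution
  refine and_congr_right fun _ => and_congr_right fun _ => ?_
  constructor
  · rintro ⟨b, e, hb, h⟩
    exact ⟨e, (isUnitri_iff e).2 ⟨b, hb⟩, h⟩
  · rintro ⟨e, he, h⟩
    obtain ⟨b, hb⟩ := (isUnitri_iff e).1 he
    exact ⟨b, e, hb, h⟩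

/-- Elimination of leading coordinates: subtracting `x i • e i` for `i = j` moves `x` one step down
the filtration, and `tail n n` is zero. -/
theorem IsUnitri.expand {e : Fin n → Fin n → ZMod 2} (he : IsUnitri e) (j : ℕ)
    (x : Fin n → ZMod 2) (hx : x ∈ tail n j) :
    ∃ c : Fin n → ZMod 2, c ∈ tail n j ∧ x = ∑ l, c l • e l := by
  induction h : n - j generalizing j x with
  | zero => exact ⟨0, (tail n j).zero_mem, by simp [eq_zero_of_mem_tail (by omega) hx]⟩
  | succ r ih =>
    have hj : j < n := by omega
    let i : Fin n := ⟨j, hj⟩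
    have h1 : x - x i • e i ∈ tail n (j + 1) := by
      apply mem_tail_succ (i := i) (Submodule.sub_mem _ hx (Submodule.smul_mem _ _ (he i).2))
      simp [(he i).1]
    obtain ⟨c, hc, hxc⟩ := ih (j + 1) _ h1 (by omega)
    refine ⟨c + x i • Pi.single i 1, ?_, ?_⟩
    · refine Submodule.add_mem _ (tail_anti (Nat.le_succ j) hc) (Submodule.smul_mem _ _ ?_)
      intro l hl
      have : l ≠ i := fun h => by subst h; simp [i] at hl
      simp [this]
    · simp only [Pi.add_apply, add_smul, Finset.sum_add_distrib, ← hxc]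
      simp [Pi.single_apply]

/-- Earlier members of the family have zero coefficients and later ones vanish at `j`. So the
leading coordinate can be read off from the coefficients. -/
theorem IsUnitri.sum_apply {e : Fin n → Fin n → ZMod 2} (he : IsUnitri e) {c : Fin n → ZMod 2}
    (j : Fin n) (hc : c ∈ tail n j) : (∑ l, c l • e l) j = c j := by
  rw [Finset.sum_apply, Finset.sum_eq_single j]
  · simp [(he j).1]
  · intro l _ hl
    rcases lt_or_gt_of_ne hl with h | h
    · simp [hc l h]
    · simp [(he l).2 j h]
  · simp

theorem IsUnitri.mem_tail_iff {e : Fin n → Fin n → ZMod 2} (he : IsUnitri e) {c : Fin n → ZMod 2}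
    (j : ℕ) : ∑ l, c l • e l ∈ tail n j ↔ c ∈ tail n j := by
  constructor
  · intro h l
    induction l using WellFoundedLT.induction with
    | ind l ih =>
      intro hl
      rw [← he.sum_apply l (fun i hi => ih i hi (lt_trans hi hl))]
      exact h l hl
  · intro h
    refine Submodule.sum_mem _ fun l _ => ?_
    by_cases hl : (l : ℕ) < j
    · simp [h l hl]
    · exact Submodule.smul_mem _ _ (tail_anti (not_lt.1 hl) (he l).2)

/-- There is a vector with the leading coordinate `i` whose differential lies in `tail n j`. -/
def Reach (d : (Fin n → ZMod 2) →ₗ[ZMod 2] (Fin n → ZMod 2)) (i : Fin n) (j : ℕ) : Prop :=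
  ∃ x ∈ tail n i, x i = 1 ∧ d x ∈ tail n j

section

variable {d : (Fin n → ZMod 2) →ₗ[ZMod 2] (Fin n → ZMod 2)} {τ : Fin n → Fin n}

theorem lt_or_lt_of_fixedPointFree (h2 : ∀ i, τ i ≠ i) (i : Fin n) : i < τ i ∨ τ i < i :=
  (lt_or_gt_of_ne (h2 i)).symm

/-- Call `l` a source if `l < τ l` and a target otherwise. In a normal basis `d` moves the
coefficient of each source to its target and forgets the coefficients of the targets. -/
theorem map_sum_unitri {e : Fin n → Fin n → ZMod 2} (h1 : ∀ i, τ (τ i) = i) (h2 : ∀ i, τ i ≠ i)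
    (he : ∀ i, (i < τ i → d (e i) = e (τ i)) ∧ (τ i < i → d (e i) = 0)) (c : Fin n → ZMod 2) :
    d (∑ l, c l • e l) = ∑ l, (if τ l < l then c (τ l) else 0) • e l := by
  have hinv : Function.Involutive τ := h1
  rw [map_sum, ← Equiv.sum_comp hinv.toPerm]
  refine Finset.sum_congr rfl fun l _ => ?_
  simp only [Function.Involutive.coe_toPerm, map_smul]
  rcases lt_or_lt_of_fixedPointFree h2 l with h | h
  · rw [if_neg h.not_gt, (he (τ l)).2 (by rwa [h1])]
    simp
  · rw [if_pos h, (he (τ l)).1 (by rwa [h1]), h1]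

/-- This describes `τ` without reference to a basis. A target leads a cycle, so it reaches
everything. For a source, the coefficient one at `i` reappears at `τ i` in the differential, where
no other source can cancel it. -/
theorem reach_iff (h : IsCanonicalInvolution d τ) (i : Fin n) (j : ℕ) :
    Reach d i j ↔ τ i < i ∨ j ≤ τ i := by
  obtain ⟨h1, h2, e, hu, he⟩ := (isCanonicalInvolution_iff d τ).1 h
  constructor
  · rintro ⟨x, hx, hxi, hd⟩
    rw [or_iff_not_imp_left]
    intro hi
    have hi : i < τ i := (lt_or_lt_of_fixedPointFree h2 i).resolve_right hi
    obtain ⟨c, hc, rfl⟩ := hu.expand _ _ hx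
    rw [map_sum_unitri h1 h2 he, hu.mem_tail_iff] at hd
    rw [hu.sum_apply i hc] at hxi
    by_contra hlt
    have := hd (τ i) (not_le.1 hlt)
    simp [h1, hi, hxi] at this
  · rintro (h | h)
    · exact ⟨e i, (hu i).2, (hu i).1, by rw [(he i).2 h]; exact Submodule.zero_mem _⟩
    · rcases lt_or_lt_of_fixedPointFree h2 i with h' | h'
      · exact ⟨e i, (hu i).2, (hu i).1, by rw [(he i).1 h']; exact tail_anti h (hu _).2⟩
      · exact ⟨e i, (hu i).2, (hu i).1, by rw [(he i).2 h']; exact Submodule.zero_mem _⟩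

/-- The leading coefficient of `d x` is the coefficient of `x` at the source of `j`, so that source
cannot come before the start of `x`. -/
theorem le_of_apply_ne_zero (h : IsCanonicalInvolution d τ) {i : ℕ} {j : Fin n}
    {x : Fin n → ZMod 2} (hx : x ∈ tail n i) (hd : d x ∈ tail n j) (hj : d x j ≠ 0) :
    τ j < j ∧ i ≤ τ j := by
  obtain ⟨h1, h2, e, hu, he⟩ := (isCanonicalInvolution_iff d τ).1 h
  obtain ⟨c, hc, rfl⟩ := hu.expand _ _ hx
  rw [map_sum_unitri h1 h2 he] at hd hj
  rw [hu.mem_tail_iff] at hd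
  rw [hu.sum_apply j hd] at hj
  by_cases hlt : τ j < j
  · refine ⟨hlt, ?_⟩
    by_contra hi
    simp [hlt, hc (τ j) (not_le.1 hi)] at hj
  · simp [hlt] at hj

/-- Since `tail n n` is zero, `Reach d i n` means that `i` leads a cycle. -/
theorem IsCanonicalInvolution.lt_iff_reach (h : IsCanonicalInvolution d τ) (i : Fin n) :
    τ i < i ↔ Reach d i n := by
  rw [reach_iff h, or_iff_left (not_le.2 (τ i).2)]

/-- `Reach` tells the targets from the sources, and the furthest step reached by a source is its
target. -/
theorem IsCanonicalInvolution.unique {τ' : Fin n → Fin n} (h : IsCanonicalInvolution d τ)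
    (h' : IsCanonicalInvolution d τ') : τ' = τ := by
  have hlow : ∀ i, τ' i < i ↔ τ i < i := fun i => by rw [h.lt_iff_reach, h'.lt_iff_reach]
  have hup : ∀ i, i < τ i → τ' i = τ i := by
    intro i hi
    have h1 := fun j => (reach_iff h i j).symm.trans (reach_iff h' i j)
    have h2 : ¬ τ' i < i := by rw [hlow]; exact hi.not_gt
    simp only [hi.not_gt, h2, false_or] at h1
    exact Fin.ext (le_antisymm ((h1 _).2 le_rfl) ((h1 _).1 le_rfl))
  funext i
  rcases lt_or_lt_of_fixedPointFree h.2.1 i with hi | hi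
  · exact hup i hi
  · have := hup (τ i) (by rwa [h.1])
    rw [h.1] at this
    rw [← h'.1 (τ i), this]

/-- In a normal basis a cycle has no coefficients at sources; moving its coefficients from the
targets back to the sources gives a preimage. -/
theorem IsCanonicalInvolution.isExact (h : IsCanonicalInvolution d τ) : IsExact d := by
  obtain ⟨h1, h2, e, hu, he⟩ := (isCanonicalInvolution_iff d τ).1 h
  apply le_antisymm
  · intro x hx
    rw [LinearMap.mem_ker] at hx
    obtain ⟨c, hc, rfl⟩ := hu.expand 0 x (fun l hl => absurd hl (Nat.not_lt_zero _))
    rw [map_sum_unitri h1 h2 he] at hx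
    have hc0 : ∀ l, τ l < l → c (τ l) = 0 := by
      have h0 : (fun l => if τ l < l then c (τ l) else 0) ∈ tail n n := by
        rw [← hu.mem_tail_iff, hx]; exact Submodule.zero_mem _
      intro l hl
      simpa [hl] using h0 l l.2
    refine ⟨∑ l, c (τ l) • e l, ?_⟩
    rw [map_sum_unitri h1 h2 he]
    refine Finset.sum_congr rfl fun l _ => ?_
    rw [h1]
    rcases lt_or_lt_of_fixedPointFree h2 l with hl | hl
    · have := hc0 (τ l) (by rwa [h1])
      rw [h1] at this
      simp [this]
    · simp [hl]
  · rintro _ ⟨x, rfl⟩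
    rw [LinearMap.mem_ker]
    obtain ⟨c, hc, rfl⟩ := hu.expand 0 x (fun l hl => absurd hl (Nat.not_lt_zero _))
    rw [map_sum_unitri h1 h2 he, map_sum_unitri h1 h2 he]
    refine Finset.sum_eq_zero fun l _ => ?_
    split_ifs with h3 h4
    · rw [h1] at h4; exact absurd h4 h3.not_gt
    · simp
    · simp

theorem exists_reach_max (i : Fin n) (d : (Fin n → ZMod 2) →ₗ[ZMod 2] (Fin n → ZMod 2)) :
    ∃ m ≤ n, Reach d i m ∧ ∀ j ≤ n, Reach d i j → j ≤ m := by
  classical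
  have h0 : Reach d i 0 :=
    ⟨Pi.single i 1, fun l hl => by simp [(show l < i from hl).ne], by simp,
      fun l hl => absurd hl (Nat.not_lt_zero _)⟩
  exact ⟨Nat.findGreatest (Reach d i) n, Nat.findGreatest_le n,
    Nat.findGreatest_spec (Nat.zero_le n) h0, fun j hj h => Nat.le_findGreatest hj h⟩

theorem isTriangular_tail (hT : IsTriangular d) {j : ℕ} {x : Fin n → ZMod 2} (hx : x ∈ tail n j) :
    d x ∈ tail n (j + 1) := by
  have hs : x = ∑ i, x i • (Pi.single i 1 : Fin n → ZMod 2) := by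
    ext l; simp [Finset.sum_apply, Pi.single_apply]
  rw [hs, map_sum]
  refine Submodule.sum_mem _ fun i _ => ?_
  rw [map_smul]
  by_cases hi : (i : ℕ) < j
  · simp [hx i hi]
  · refine Submodule.smul_mem _ _ fun l hl => ?_
    obtain ⟨a, ha⟩ := hT i
    rw [ha, sum_Ioi_single, if_neg]
    intro h
    have : (i : ℕ) < l := h
    omega

/-- A triangular exact differential over `ℤ/2` has a canonical involution. -/
theorem exists_canonicalInvolution (hT : IsTriangular d) (hE : IsExact d) :
    ∃ τ, IsCanonicalInvolution d τ := by
  classical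
  -- `m i` is the furthest step reached from `i`, attained by `x i`. It will be the partner of a
  -- source; the value `n` marks the targets.
  choose m hmn hm hmax using fun i => exists_reach_max i d
  choose x hx hxi hdx using hm
  have hdd : ∀ v, d (d v) = 0 := fun v => by
    have : d v ∈ LinearMap.ker d := by rw [hE]; exact ⟨v, rfl⟩
    exact this
  have hlt : ∀ i : Fin n, (i : ℕ) < m i := by
    intro i
    have h1 : Reach d i (i + 1) := by
      refine ⟨Pi.single i 1, ?_, by simp, ?_⟩
      · intro l hl; simp [(show l < i from hl).ne]
      · exact isTriangular_tail hT fun l hl => by simp [(show l < i from hl).ne]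
    have := hmax i _ i.2 h1
    omega
  have hlead : ∀ i (h : m i < n), d (x i) ⟨m i, h⟩ = 1 := by
    intro i h
    apply eq_one_of_ne_zero
    intro h0
    have := hmax i (m i + 1) h ⟨x i, hx i, hxi i, mem_tail_succ (i := ⟨m i, h⟩) (hdx i) h0⟩
    omega
  have hzero : ∀ i, m i = n → d (x i) = 0 := fun i h =>
    eq_zero_of_mem_tail (j := m i) h.ge (hdx i)
  -- `d (x i)` is itself a cycle with the leading coordinate `m i`.
  have hlow : ∀ i (h : m i < n), m ⟨m i, h⟩ = n := by
    intro i h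
    refine le_antisymm (hmn _) (hmax _ _ le_rfl ⟨d (x i), hdx i, hlead i h, ?_⟩)
    rw [hdd]; exact Submodule.zero_mem _
  -- If two sources had the same target, their difference would keep the earlier leading coordinate
  -- and reach further.
  have hinj' : ∀ i i' : Fin n, i < i' → m i < n → m i = m i' → False := by
    intro i i' hii h heq
    have h' : m i' < n := heq ▸ h
    have := hmax i (m i + 1) h ⟨x i - x i', ?_, ?_, ?_⟩
    · omega
    · exact Submodule.sub_mem _ (hx i) (tail_anti hii.le (hx i'))
    · rw [Pi.sub_apply, hxi, hx i' i hii, sub_zero]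
    · rw [map_sub]
      refine mem_tail_succ (i := ⟨m i, h⟩)
        (Submodule.sub_mem _ (hdx i) (by simpa [heq] using hdx i')) ?_
      have h1 := hlead i' h'
      have e : (⟨m i', h'⟩ : Fin n) = ⟨m i, h⟩ := Fin.ext heq.symm
      rw [e] at h1
      rw [Pi.sub_apply, hlead i h, h1, sub_self]
  have hinj : ∀ i i' : Fin n, m i < n → m i = m i' → i = i' := by
    intro i i' h heq
    rcases lt_trichotomy i i' with hl | hl | hl
    · exact (hinj' i i' hl h heq).elim
    · exact hl
    · exact (hinj' i' i hl (heq ▸ h) heq.symm).elim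
  -- By exactness the cycle `x l` is a boundary. Among the vectors whose differential leads at `l`,
  -- take one that starts as late as possible, at `i`. If `i` could reach beyond `l`, then
  -- subtracting `x i` would give a later start.
  have hsurj : ∀ l : Fin n, m l = n → ∃ i, m i = l := by
    intro l hl
    have hker : x l ∈ LinearMap.range d := by rw [← hE]; exact hzero l hl
    obtain ⟨y, hy⟩ := hker
    let p : ℕ → Prop := fun i => ∃ y ∈ tail n i, d y ∈ tail n l ∧ d y l = 1
    have hp0 : p 0 := ⟨y, fun _ h => absurd h (Nat.not_lt_zero _), by rw [hy]; exact hx l,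
      by rw [hy]; exact hxi l⟩
    obtain ⟨y, hyt, hyd, hyl⟩ := Nat.findGreatest_spec (P := p) (Nat.zero_le n) hp0
    set r := Nat.findGreatest p n
    have hrn : r < n := by
      by_contra hr
      rw [eq_zero_of_mem_tail (not_lt.1 hr) hyt] at hyl
      simp at hyl
    let i : Fin n := ⟨r, hrn⟩
    have hyi : y i = 1 := by
      apply eq_one_of_ne_zero
      intro h0
      have h1 : r + 1 ≤ r := Nat.le_findGreatest (P := p) hrn
        ⟨y, mem_tail_succ (i := i) hyt h0, hyd, hyl⟩
      omega
    refine ⟨i, le_antisymm ?_ (hmax i _ l.2.le ⟨y, hyt, hyi, hyd⟩)⟩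
    by_contra hgt
    rw [not_le] at hgt
    have h0 : d (x i) l = 0 := hdx i l hgt
    have h1 : r + 1 ≤ r := Nat.le_findGreatest (P := p) hrn ⟨y - x i, ?_, ?_, ?_⟩
    · omega
    · exact mem_tail_succ (i := i) (Submodule.sub_mem _ hyt (hx i)) (by simp [hyi, hxi])
    · rw [map_sub]; exact Submodule.sub_mem _ hyd (tail_anti hgt.le (hdx i))
    · rw [map_sub, Pi.sub_apply, hyl, h0, sub_zero]
  choose! g hg using hsurj
  -- The normal basis will consist of `x i` for the sources and `d (x (g i))` for the targets.
  let τ : Fin n → Fin n := fun i => if h : m i < n then ⟨m i, h⟩ else g i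
  have hτu : ∀ i (h : m i < n), τ i = ⟨m i, h⟩ := fun i h => dif_pos h
  have hτl : ∀ i, m i = n → τ i = g i := fun i h => dif_neg (by omega)
  have hgi : ∀ l, m l = n → m (g l) < n := fun l h => by rw [hg l h]; exact l.2
  have hcases : ∀ i, m i < n ∨ m i = n := fun i => lt_or_eq_of_le (hmn i)
  have hgm : ∀ i (h : m i < n), g ⟨m i, h⟩ = i := fun i h =>
    hinj _ _ (hgi _ (hlow i h)) (hg _ (hlow i h))
  have hup : ∀ i, i < τ i ↔ m i < n := by
    intro i
    rcases hcases i with h | h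
    · rw [hτu i h]; exact ⟨fun _ => h, fun _ => hlt i⟩
    · rw [hτl i h]
      have h1 : (g i : ℕ) < i := by have := hlt (g i); rwa [hg i h] at this
      exact ⟨fun h2 => absurd (lt_trans (show (i : ℕ) < g i from h2) h1) (lt_irrefl _),
        fun h2 => absurd h2 (by omega)⟩
  have hττ : ∀ i, τ (τ i) = i := by
    intro i
    rcases hcases i with h | h
    · rw [hτu i h, hτl _ (hlow i h), hgm i h]
    · rw [hτl i h, hτu _ (hgi i h)]
      exact Fin.ext (hg i h)
  have hne : ∀ i, τ i ≠ i := by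
    intro i
    rcases hcases i with h | h
    · exact ((hup i).2 h).ne'
    · rw [hτl i h]
      intro he
      have := hgi i h
      rw [he] at this
      omega
  refine ⟨τ, (isCanonicalInvolution_iff d τ).2 ⟨hττ, hne,
    fun i => if m i < n then x i else d (x (g i)), ?_, ?_⟩⟩
  · intro i
    rcases hcases i with h | h
    · simp only [h, if_true]; exact ⟨hxi i, hx i⟩
    · simp only [h, lt_irrefl, if_false]
      have h1 := hlead (g i) (hgi i h)
      have h2 := hdx (g i)
      have h3 : (⟨m (g i), hgi i h⟩ : Fin n) = i := Fin.ext (hg i h)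
      rw [hg i h] at h2
      rw [h3] at h1
      exact ⟨h1, h2⟩
  · intro i
    constructor
    · intro hi
      have h := (hup i).1 hi
      have h1 : m (τ i) = n := by rw [hτu i h]; exact hlow i h
      simp only [h, h1, lt_irrefl, if_true, if_false]
      rw [hτu i h, hgm i h]
    · intro hi
      have h : ¬ m i < n := fun h => hi.not_gt ((hup i).2 h)
      simp only [h, if_false]
      exact hdd _

end

end Canonical

/-! ### Changes of coordinates and canonical involutions -/

section Transport

variable {n : ℕ}

/-- The differential with the matrix `E`. -/
def natDiff (n : ℕ) (E : ℕ → ℕ → ZMod 2) : (Fin n → ZMod 2) →ₗ[ZMod 2] (Fin n → ZMod 2) :=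
  (Matrix.of fun i j : Fin n => E i j).vecMulLinear

theorem natDiff_apply (E : ℕ → ℕ → ZMod 2) (x : Fin n → ZMod 2) (j : Fin n) :
    natDiff n E x j = ∑ i, x i * E i j := by
  simp [natDiff, Matrix.vecMul, dotProduct]

theorem natDiff_single (E : ℕ → ℕ → ZMod 2) (i j : Fin n) :
    natDiff n E (Pi.single i 1) j = E i j := by
  simp [natDiff_apply, Pi.single_apply]

theorem isTriangular_natDiff {E : ℕ → ℕ → ZMod 2} (h : ∀ i j, j ≤ i → E i j = 0) :
    IsTriangular (natDiff n E) := by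
  intro i
  refine ⟨fun j => E i j, ?_⟩
  ext j
  rw [natDiff_single, sum_Ioi_single]
  split_ifs with hij
  · rfl
  · exact h _ _ (not_lt.1 hij)

/-- If all matrix entries have degree one, then so have the arrows of the canonical involution. -/
theorem IsCanonicalInvolution.degree {E : ℕ → ℕ → ZMod 2} {τ : Fin n → Fin n}
    (h : IsCanonicalInvolution (natDiff n E) τ) {ρ : ℕ} (μ : ℕ → ZMod ρ)
    (hμ : ∀ i < n, ∀ j < n, E i j ≠ 0 → μ i = μ j + 1) (i : Fin n) (hi : i < τ i) :
    μ i = μ (τ i) + 1 := by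
  classical
  obtain ⟨x, hx, hxi, hd⟩ := (reach_iff h i (τ i)).2 (Or.inr le_rfl)
  -- The part of `x` in the index of `i`. As the matrix lowers the index by one, `d x'` is the part
  -- of `d x` in the index one lower.
  let x' : Fin n → ZMod 2 := fun l => if μ l = μ i then x l else 0
  have hd' : ∀ j, natDiff n E x' j = if μ j + 1 = μ i then natDiff n E x j else 0 := by
    intro j
    rw [natDiff_apply, natDiff_apply]
    split_ifs with hj
    · refine Finset.sum_congr rfl fun l _ => ?_
      by_cases hE : E l j = 0
      · simp [hE]
      · simp [x', hμ l l.2 j j.2 hE, hj]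
    · refine Finset.sum_eq_zero fun l _ => ?_
      by_cases hE : E l j = 0
      · simp [hE]
      · simp [x', hμ l l.2 j j.2 hE, hj]
  by_contra hne
  -- If the index of `τ i` were different, the truncation would remove the coordinate `τ i` of the
  -- differential, and `i` would reach beyond its target.
  have hr : Reach (natDiff n E) i (τ i + 1) := by
    refine ⟨x', fun l hl => by simp [x', hx l hl], by simp [x', hxi], mem_tail_succ ?_ ?_⟩
    · intro l hl; rw [hd', hd l hl, ite_self]
    · rw [hd', if_neg fun h' => hne h'.symm]
  rcases (reach_iff h i _).1 hr with h' | h'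
  · exact h'.not_gt hi
  · omega

/-- Canonical involutions are invariant under triangular changes of the basis. -/
theorem IsCanonicalInvolution.of_conj {d d' ψ : (Fin n → ZMod 2) →ₗ[ZMod 2] (Fin n → ZMod 2)}
    {τ : Fin n → Fin n} (h : IsCanonicalInvolution d' τ)
    (hψ : ∀ i : Fin n, ∀ x ∈ tail n i, ψ x i = x i) (hc : ∀ x, ψ (d x) = d' (ψ x)) :
    IsCanonicalInvolution d τ := by
  obtain ⟨h1, h2, e, hu, he⟩ := (isCanonicalInvolution_iff d' τ).1 h
  -- `ψ` preserves leading coordinates, so it reflects the filtration. Hence it is injective, and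
  -- bijective by dimension; the normal basis can be pulled back.
  have htail : ∀ j x, ψ x ∈ tail n j → x ∈ tail n j := by
    intro j x hx l
    induction l using WellFoundedLT.induction with
    | ind l ih =>
      intro hl
      rw [← hψ l x fun i hi => ih i hi (lt_trans hi hl)]
      exact hx l hl
  have hinj : Function.Injective ψ := by
    rw [← LinearMap.ker_eq_bot, LinearMap.ker_eq_bot']
    intro x hx
    exact eq_zero_of_mem_tail le_rfl (htail n x (by rw [hx]; exact Submodule.zero_mem _))
  choose e' he' using fun i => LinearMap.injective_iff_surjective.1 hinj (e i)
  refine (isCanonicalInvolution_iff d τ).2 ⟨h1, h2, e', fun i => ?_, fun i => ⟨fun hi => ?_,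
    fun hi => ?_⟩⟩
  · have ht : e' i ∈ tail n i := htail i _ (by rw [he']; exact (hu i).2)
    exact ⟨by rw [← hψ i _ ht, he', (hu i).1], ht⟩
  · apply hinj
    rw [hc, he', he', (he i).1 hi]
  · apply hinj
    rw [hc, he', (he i).2 hi, map_zero]

/-- Acyclicity needs no triangularity of the isomorphism. It is what survives the passage of a
crossing, where the change of coordinates does not preserve the filtration. -/
theorem IsExact.of_conj {m : ℕ} {d : (Fin n → ZMod 2) →ₗ[ZMod 2] (Fin n → ZMod 2)}
    {d' : (Fin m → ZMod 2) →ₗ[ZMod 2] (Fin m → ZMod 2)}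
    (φ : (Fin n → ZMod 2) ≃ₗ[ZMod 2] (Fin m → ZMod 2)) (hc : ∀ x, φ (d x) = d' (φ x))
    (h : IsExact d) : IsExact d' := by
  ext y
  obtain ⟨x, rfl⟩ := φ.surjective y
  rw [LinearMap.mem_ker, ← hc, LinearEquiv.map_eq_zero_iff, ← LinearMap.mem_ker, h]
  constructor
  · rintro ⟨z, rfl⟩
    exact ⟨φ z, (hc z).symm⟩
  · rintro ⟨z, hz⟩
    refine ⟨φ.symm z, φ.injective ?_⟩
    rw [hc, LinearEquiv.apply_symm_apply, hz]

/-- The change of coordinates at a crossing of the strands `κ` and `κ'`. -/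
def crossEquiv (y : ZMod 2) (κ κ' : Fin n) (hκ : κ ≠ κ') :
    (Fin n → ZMod 2) ≃ₗ[ZMod 2] (Fin n → ZMod 2) where
  toFun v := fun i => if i = κ then v κ' + y * v κ else if i = κ' then v κ else v i
  invFun w := fun i => if i = κ then w κ' else if i = κ' then w κ + y * w κ' else w i
  map_add' v w := by ext i; simp only [Pi.add_apply]; split_ifs <;> ring
  map_smul' c v := by
    ext i; simp only [Pi.smul_apply, smul_eq_mul, RingHom.id_apply]; split_ifs <;> ring
  left_inv v := by
    ext i
    have h2 : y * v κ + y * v κ = 0 := CharTwo.add_self_eq_zero _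
    simp only [if_true, hκ.symm, if_false]
    split_ifs with h h'
    · rw [h]
    · rw [h', add_assoc, h2, add_zero]
    · rfl
  right_inv v := by
    ext i
    have h2 : y * v κ' + y * v κ' = 0 := CharTwo.add_self_eq_zero _
    simp only [if_true, hκ.symm, if_false]
    split_ifs with h h'
    · rw [h, add_assoc, h2, add_zero]
    · rw [h']
    · rfl

theorem crossEquiv_apply (y : ZMod 2) (κ κ' : Fin n) (hκ : κ ≠ κ') (v : Fin n → ZMod 2)
    (i : Fin n) : crossEquiv y κ κ' hκ v i =
      if i = κ then v κ' + y * v κ else if i = κ' then v κ else v i := rfl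

/-- How the canonical involution changes at a crossing: the pairs follow the strands, or the
crossing is a normal switch. -/
theorem canonicalInvolution_cross {d d' : (Fin n → ZMod 2) →ₗ[ZMod 2] (Fin n → ZMod 2)}
    {τ τ' : Fin n → Fin n} (h : IsCanonicalInvolution d τ) (h' : IsCanonicalInvolution d' τ')
    {κ κ' : Fin n} (hκ : (κ' : ℕ) = κ + 1) (hne : κ ≠ κ') (y : ZMod 2)
    (hc : ∀ x, crossEquiv y κ κ' hne (d x) = d' (crossEquiv y κ κ' hne x))
    (hτ : τ κ ≠ κ') (hτ' : τ' κ ≠ κ') :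
    (∀ i, τ' (Equiv.swap κ κ' i) = Equiv.swap κ κ' (τ i)) ∨
    (τ' = τ ∧ ((τ κ < κ ∧ κ' < τ κ') ∨ (τ κ' < τ κ ∧ τ κ < κ) ∨ (κ' < τ κ' ∧ τ κ' < τ κ))) := by
  set φ := crossEquiv y κ κ' hne with hφ
  have φ0 : ∀ v, φ v κ = v κ' + y * v κ := fun v => by rw [hφ, crossEquiv_apply, if_pos rfl]
  have φ1 : ∀ v, φ v κ' = v κ := fun v => by
    rw [hφ, crossEquiv_apply, if_neg hne.symm, if_pos rfl]
  have φ2 : ∀ v i, i ≠ κ → i ≠ κ' → φ v i = v i := fun v i h1 h2 => by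
    rw [hφ, crossEquiv_apply, if_neg h1, if_neg h2]
  -- `φ` mixes the coordinates `κ` and `κ'` only, so it preserves every step of the filtration that
  -- does not separate them. The one step that does is `tail n κ'`.
  have htail : ∀ (j : ℕ), j ≠ κ' → ∀ v, φ v ∈ tail n j ↔ v ∈ tail n j := by
    intro j hj v
    have key : ∀ l : Fin n, (l : ℕ) < j → l = κ ∨ l = κ' → (κ : ℕ) < j ∧ (κ' : ℕ) < j := by
      rintro l hl (rfl | rfl) <;> constructor <;> omega
    constructor
    · intro hv l hl
      by_cases h1 : l = κ ∨ l = κ'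
      · obtain ⟨k1, k2⟩ := key l hl h1
        have e1 := hv κ k1
        have e2 := hv κ' k2
        rw [φ1] at e2
        rw [φ0, e2, mul_zero, add_zero] at e1
        rcases h1 with rfl | rfl
        · exact e2
        · exact e1
      · rw [not_or] at h1
        rw [← φ2 v l h1.1 h1.2]; exact hv l hl
    · intro hv l hl
      by_cases h1 : l = κ ∨ l = κ'
      · obtain ⟨k1, k2⟩ := key l hl h1
        rcases h1 with rfl | rfl
        · rw [φ0, hv _ k1, hv _ k2, mul_zero, add_zero]
        · rw [φ1, hv _ k1]
      · rw [not_or] at h1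
        rw [φ2 v l h1.1 h1.2]; exact hv l hl
  have hval : ∀ {i : Fin n}, i ≠ κ' → (i : ℕ) ≠ κ' := fun h e => h (Fin.ext e)
  have hreach : ∀ i, i ≠ κ → i ≠ κ' → ∀ j : ℕ, j ≠ κ' → (Reach d i j ↔ Reach d' i j) := by
    intro i hi hi' j hj
    constructor
    · rintro ⟨x, hx, hxi, hd⟩
      exact ⟨φ x, (htail _ (hval hi') _).2 hx, by rw [φ2 _ _ hi hi', hxi],
        by rw [← hc]; exact (htail _ hj _).2 hd⟩
    · rintro ⟨x, hx, hxi, hd⟩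
      obtain ⟨x, rfl⟩ := φ.surjective x
      rw [← hc] at hd
      exact ⟨x, (htail _ (hval hi') _).1 hx, by rw [← φ2 x i hi hi', hxi], (htail _ hj _).1 hd⟩
  have hn : n ≠ (κ' : ℕ) := κ'.2.ne'
  have hlow : ∀ i, i ≠ κ → i ≠ κ' → (τ i < i ↔ τ' i < i) := fun i h1 h2 => by
    rw [h.lt_iff_reach, h'.lt_iff_reach, hreach i h1 h2 n hn]
  -- `Reach` is known to agree for all thresholds except `κ'`, so targets are determined up to
  -- confusing `κ` with `κ'`.
  have hup : ∀ i, i ≠ κ → i ≠ κ' → i < τ i →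
      τ' i = τ i ∨ ((τ i = κ ∨ τ i = κ') ∧ (τ' i = κ ∨ τ' i = κ')) := by
    intro i h1 h2 hi
    have hnl : ¬ τ i < i := hi.not_gt
    have hnl' : ¬ τ' i < i := by rwa [← hlow i h1 h2]
    have h3 : ∀ j : ℕ, j ≠ κ' → (j ≤ τ i ↔ j ≤ τ' i) := by
      intro j hj
      have := hreach i h1 h2 j hj
      rw [reach_iff h, reach_iff h'] at this
      simpa [hnl, hnl'] using this
    simp only [Fin.ext_iff] at *
    by_cases h4 : (τ i : ℕ) = κ'
    · have h5 := (h3 κ (by omega)).1 (by omega)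
      by_cases h6 : (τ' i : ℕ) = κ'
      · left; omega
      · have := (h3 _ h6).2 le_rfl
        right; omega
    · have h5 := (h3 _ h4).1 le_rfl
      by_cases h6 : (τ' i : ℕ) = κ'
      · have h7 := mt (h3 (κ' + 1) (by omega)).2
        have h8 := (h3 κ (by omega)).2 (by omega)
        right; omega
      · have := (h3 _ h6).2 le_rfl
        left; omega
  have hu1 : τ κ ≠ κ := h.2.1 κ
  have hv1 : τ κ' ≠ κ' := h.2.1 κ'
  have hv0 : τ κ' ≠ κ := fun e => hτ (by rw [← e, h.1])
  have hv0' : τ' κ' ≠ κ := fun e => hτ' (by rw [← e, h'.1])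
  have hoff : ∀ i, i ≠ κ → i ≠ κ' → i ≠ τ κ → i ≠ τ κ' → τ' i = τ i := by
    intro i h1 h2 h3 h4
    have h5 : τ i ≠ κ := fun e => h3 (by rw [← e, h.1])
    have h6 : τ i ≠ κ' := fun e => h4 (by rw [← e, h.1])
    rcases lt_or_lt_of_fixedPointFree h.2.1 i with hi | hi
    · rcases hup i h1 h2 hi with h7 | ⟨h7 | h7, -⟩
      · exact h7
      · exact absurd h7 h5
      · exact absurd h7 h6
    · rcases hup (τ i) h5 h6 (by rwa [h.1]) with h7 | ⟨h7 | h7, -⟩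
      · rw [h.1] at h7; rw [← h'.1 (τ i), h7]
      · rw [h.1] at h7; exact absurd h7 h1
      · rw [h.1] at h7; exact absurd h7 h2
  have hoff' : ∀ z, (z = κ ∨ z = κ') → τ' z = τ κ ∨ τ' z = τ κ' := by
    intro z hz
    by_contra hcon
    rw [not_or] at hcon
    have h1 : τ' z ≠ κ := by
      rcases hz with rfl | rfl
      · exact h'.2.1 _
      · exact hv0'
    have h2 : τ' z ≠ κ' := by
      rcases hz with rfl | rfl
      · exact hτ'
      · exact h'.2.1 _
    have h3 := hoff _ h1 h2 hcon.1 hcon.2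
    rw [h'.1] at h3
    rcases hz with rfl | rfl
    · exact hcon.1 (by have := congrArg τ h3; rw [h.1] at this; exact this.symm)
    · exact hcon.2 (by have := congrArg τ h3; rw [h.1] at this; exact this.symm)
  have hinj : τ κ ≠ τ κ' := fun e => hne (by rw [← h.1 κ, e, h.1])
  have hinj' : τ' κ ≠ τ' κ' := fun e => hne (by rw [← h'.1 κ, e, h'.1])
  -- The partners of `κ` and `κ'` are the old ones, either in place, which is the case of a switch,
  -- or exchanged, in which case the pairs follow the strands.
  rcases hoff' κ (Or.inl rfl) with h0 | h0
  · right
    have h1 : τ' κ' = τ κ' := (hoff' κ' (Or.inr rfl)).resolve_left fun e => hinj' (h0.trans e.symm)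
    have heq : τ' = τ := by
      funext i
      by_cases e1 : i = κ
      · rw [e1, h0]
      by_cases e2 : i = κ'
      · rw [e2, h1]
      by_cases e3 : i = τ κ
      · rw [e3, h.1, ← h0, h'.1]
      by_cases e4 : i = τ κ'
      · rw [e4, h.1, ← h1, h'.1]
      exact hoff i e1 e2 e3 e4
    refine ⟨heq, ?_⟩
    subst heq
    have d0 : (τ' κ : ℕ) ≠ κ := fun e => hu1 (Fin.ext e)
    have d1 : (τ' κ : ℕ) ≠ κ' := fun e => hτ (Fin.ext e)
    have d2 : (τ' κ' : ℕ) ≠ κ := fun e => hv0 (Fin.ext e)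
    have d3 : (τ' κ' : ℕ) ≠ κ' := fun e => hv1 (Fin.ext e)
    have d4 : (τ' κ : ℕ) ≠ τ' κ' := fun e => hinj (Fin.ext e)
    -- A vector whose leading coordinate is `κ'` after the crossing has it at `κ` before.
    have hlead : ∀ x, φ x ∈ tail n κ' → x ∈ tail n κ ∧ x κ = φ x κ' := fun x hx =>
      ⟨(htail κ (by omega) x).1 (tail_anti (by omega) hx), (φ1 x).symm⟩
    -- Behind the crossing `κ'` leads a cycle, so in front of it `κ` leads one, although it would be
    -- a source.
    have c3 : ¬ (τ' κ' < κ ∧ κ' < τ' κ) := by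
      rintro ⟨hv, hu⟩
      have hr : Reach d' κ' n := (h'.lt_iff_reach _).1 (lt_trans hv (Fin.lt_def.2 (by omega)))
      obtain ⟨x, hx, hxi, hd⟩ := hr
      obtain ⟨x, rfl⟩ := φ.surjective x
      rw [← hc, htail n hn] at hd
      have := (h.lt_iff_reach κ).2 ⟨x, (hlead x hx).1, by rw [(hlead x hx).2, hxi], hd⟩
      simp only [Fin.lt_def] at *
      omega
    -- Behind the crossing `κ'` reaches its target; then in front of it `κ` would reach equally far,
    -- beyond its own target.
    have c2 : ¬ (κ' < τ' κ ∧ τ' κ < τ' κ') := by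
      rintro ⟨hu, huv⟩
      obtain ⟨x, hx, hxi, hd⟩ := (reach_iff h' κ' (τ' κ')).2 (Or.inr le_rfl)
      obtain ⟨x, rfl⟩ := φ.surjective x
      rw [← hc, htail _ d3] at hd
      have := (reach_iff h κ (τ' κ')).1 ⟨x, (hlead x hx).1, by rw [(hlead x hx).2, hxi], hd⟩
      simp only [Fin.lt_def] at *
      omega
    -- Both `κ` and `κ'` are targets. Take vectors that realize the arrow from `v` to `κ'` in front
    -- of the crossing (`w`) and behind it (pulled back to `x`). Their difference starts later than
    -- `v`, and its differential leads at `κ`; so the source of `κ` would come after `v`.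
    have c1 : ¬ (τ' κ < τ' κ' ∧ τ' κ' < κ) := by
      rintro ⟨huv, hv⟩
      set v := τ' κ' with hv'
      have hτv : τ' v = κ' := h.1 κ'
      obtain ⟨x, hx, hxi, hd⟩ := (reach_iff h' v κ').2 (by rw [hτv]; exact Or.inr le_rfl)
      obtain ⟨x, rfl⟩ := φ.surjective x
      obtain ⟨w, hw, hwi, hwd⟩ := (reach_iff h v κ').2 (by rw [hτv]; exact Or.inr le_rfl)
      rw [htail _ d3] at hx
      rw [φ2 _ _ hv0 hv1] at hxi
      rw [← hc] at hd
      have hdx := hlead _ hd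
      have hne0 : φ (d x) κ' ≠ 0 := by
        intro h0
        have hr : Reach d' v (κ' + 1) := by
          refine ⟨φ x, (htail _ d3 x).2 hx, by rw [φ2 _ _ hv0 hv1, hxi], ?_⟩
          rw [← hc]; exact mem_tail_succ hd h0
        have := (reach_iff h' v _).1 hr
        rw [hτv] at this
        simp only [Fin.lt_def] at *
        omega
      have hb := le_of_apply_ne_zero h (i := v + 1) (j := κ) (x := x - w)
        (mem_tail_succ (Submodule.sub_mem _ hx hw) (by simp [hxi, hwi]))
        (by rw [map_sub]; exact Submodule.sub_mem _ hdx.1 (tail_anti (by omega) hwd))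
        (by rw [map_sub, Pi.sub_apply, hwd κ (by omega), sub_zero, hdx.2]; exact hne0)
      simp only [Fin.lt_def] at *
      omega
    simp only [Fin.lt_def] at *
    omega
  · left
    have h1 : τ' κ' = τ κ := (hoff' κ' (Or.inr rfl)).resolve_right fun e => hinj' (h0.trans e.symm)
    intro i
    by_cases e1 : i = κ
    · rw [e1, Equiv.swap_apply_left, h1, Equiv.swap_apply_of_ne_of_ne hu1 hτ]
    by_cases e2 : i = κ'
    · rw [e2, Equiv.swap_apply_right, h0, Equiv.swap_apply_of_ne_of_ne hv0 hv1]
    rw [Equiv.swap_apply_of_ne_of_ne e1 e2]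
    by_cases e3 : i = τ κ
    · rw [e3, h.1, Equiv.swap_apply_left, ← h1, h'.1]
    by_cases e4 : i = τ κ'
    · rw [e4, h.1, Equiv.swap_apply_right, ← h0, h'.1]
    rw [hoff i e1 e2 e3 e4, Equiv.swap_apply_of_ne_of_ne]
    · exact fun e => e3 (by rw [← e, h.1])
    · exact fun e => e4 (by rw [← e, h.1])

end Transport

/-! ### The effect of the inserts on canonical involutions -/

theorem skip_ne (k i : ℕ) : skip k i ≠ k ∧ skip k i ≠ k + 1 := by
  unfold skip; split_ifs <;> omega

theorem skip_strictMono (k : ℕ) : StrictMono (skip k) := by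
  intro i j h; unfold skip; split_ifs <;> omega

/-- The inverse of `skip k`. -/
def unskip (k i : ℕ) : ℕ := if i < k then i else i - 2

theorem unskip_skip (k i : ℕ) : unskip k (skip k i) = i := by
  unfold unskip skip; split_ifs <;> omega

theorem skip_unskip {k i : ℕ} (h : i ≠ k) (h' : i ≠ k + 1) : skip k (unskip k i) = i := by
  unfold unskip skip; split_ifs <;> omega

theorem skip_lt {k i n : ℕ} (hi : i < n) : skip k i < n + 2 := by
  unfold skip; split_ifs <;> omega

theorem unskip_lt {k i n : ℕ} (h : i ≠ k) (h' : i ≠ k + 1) (hk : k ≤ n) (hi : i < n + 2) :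
    unskip k i < n := by
  unfold unskip; split_ifs <;> omega

section

variable {n : ℕ}

/-- `skip k` as a map of the strands on the two sides of a cusp. -/
def skipFin (k n : ℕ) (a : Fin n) : Fin (n + 2) := ⟨skip k a, skip_lt a.2⟩

theorem skipFin_strictMono (k n : ℕ) : StrictMono (skipFin k n) :=
  fun _ _ h => skip_strictMono k h

theorem skipFin_ne {k n : ℕ} (a : Fin n) {κ : Fin (n + 2)} (h : (κ : ℕ) = k ∨ (κ : ℕ) = k + 1) :
    skipFin k n a ≠ κ := by
  rintro rfl
  rcases h with h | h
  · exact (skip_ne k a).1 h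
  · exact (skip_ne k a).2 h

theorem skipFin_cover {k n : ℕ} (hk : k ≤ n) (i : Fin (n + 2)) :
    (i : ℕ) = k ∨ (i : ℕ) = k + 1 ∨ ∃ a, skipFin k n a = i := by
  by_cases h : (i : ℕ) = k
  · exact Or.inl h
  by_cases h' : (i : ℕ) = k + 1
  · exact Or.inr (Or.inl h')
  exact Or.inr (Or.inr ⟨⟨unskip k i, unskip_lt h h' hk i.2⟩, Fin.ext (skip_unskip h h')⟩)

theorem sum_skipFin {M : Type*} [AddCommMonoid M] {k n : ℕ} (hk : k ≤ n) (g : Fin (n + 2) → M) :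
    ∑ i, g i = g ⟨k, by omega⟩ + (g ⟨k + 1, by omega⟩ + ∑ a, g (skipFin k n a)) := by
  classical
  have hu : (Finset.univ : Finset (Fin (n + 2))) =
      insert ⟨k, by omega⟩ (insert ⟨k + 1, by omega⟩ (Finset.univ.image (skipFin k n))) := by
    ext i
    have := skipFin_cover hk i
    simpa [Fin.ext_iff] using this
  rw [hu, Finset.sum_insert, Finset.sum_insert, Finset.sum_image]
  · exact fun a _ b _ h => (skipFin_strictMono k n).injective h
  · simp only [Finset.mem_image, Finset.mem_univ, true_and, not_exists]
    exact fun a => skipFin_ne a (Or.inr rfl)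
  · simp only [Finset.mem_insert, Finset.mem_image, Finset.mem_univ, true_and, not_or, not_exists]
    exact ⟨by simp [Fin.ext_iff], fun a => skipFin_ne a (Or.inl rfl)⟩

/-- The matrix behind a left cusp. -/
def cuspMatrix (k : ℕ) (E : ℕ → ℕ → ZMod 2) (a b : ℕ) : ZMod 2 :=
  if a = k then (if b = k + 1 then 1 else 0)
  else if a = k + 1 ∨ b = k ∨ b = k + 1 then 0 else E (unskip k a) (unskip k b)

theorem cuspMatrix_skip (k : ℕ) (E : ℕ → ℕ → ZMod 2) (a b : ℕ) :
    cuspMatrix k E (skip k a) (skip k b) = E a b := by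
  simp [cuspMatrix, skip_ne, unskip_skip]

/-- The complex is the direct sum of the old one, extended by zero, and an acyclic complex on the
two new strands. As `skip k` is monotone, the extended normal basis, completed by two standard
vectors, is again unitriangular. -/
theorem canonicalInvolution_leftCusp {E : ℕ → ℕ → ZMod 2} {τ : Fin n → Fin n} {k : ℕ} (hk : k ≤ n)
    (h : IsCanonicalInvolution (natDiff n E) τ) :
    ∃ τ', IsCanonicalInvolution (natDiff (n + 2) (cuspMatrix k E)) τ' ∧
      (∀ a, τ' (skipFin k n a) = skipFin k n (τ a)) ∧
      τ' ⟨k, by omega⟩ = ⟨k + 1, by omega⟩ := by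
  classical
  obtain ⟨h1, h2, e, hu, he⟩ := (isCanonicalInvolution_iff _ τ).1 h
  set s := skipFin k n with hs
  have hinj : Function.Injective s := (skipFin_strictMono k n).injective
  set κ : Fin (n + 2) := ⟨k, by omega⟩ with hκ
  set κ' : Fin (n + 2) := ⟨k + 1, by omega⟩ with hκ'
  have hne : κ ≠ κ' := by simp [hκ, hκ', Fin.ext_iff]
  have n0 : ¬ ∃ a, s a = κ := fun ⟨a, ha⟩ => skipFin_ne (k := k) a (Or.inl rfl) ha
  have n1 : ¬ ∃ a, s a = κ' := fun ⟨a, ha⟩ => skipFin_ne (k := k) a (Or.inr rfl) ha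
  have cover : ∀ i, i = κ ∨ i = κ' ∨ ∃ a, s a = i := fun i => by
    simpa [Fin.ext_iff, hκ, hκ'] using skipFin_cover hk i
  let ι : (Fin n → ZMod 2) → (Fin (n + 2) → ZMod 2) := fun v => Function.extend s v 0
  have ιs : ∀ v a, ι v (s a) = v a := fun v a => hinj.extend_apply _ _ _
  have ι0 : ∀ v, ι v κ = 0 := fun v => Function.extend_apply' _ _ _ n0
  have ι1 : ∀ v, ι v κ' = 0 := fun v => Function.extend_apply' _ _ _ n1
  have hd : ∀ v, natDiff (n + 2) (cuspMatrix k E) (ι v) = ι (natDiff n E v) := by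
    intro v
    ext j
    rw [natDiff_apply, sum_skipFin hk, ← hκ, ← hκ', ← hs, ι0, ι1, zero_mul, zero_mul, zero_add,
      zero_add]
    rcases cover j with rfl | rfl | ⟨b, rfl⟩
    · rw [ι0]
      refine Finset.sum_eq_zero fun a _ => ?_
      simp [hκ, hs, skipFin, cuspMatrix, skip_ne]
    · rw [ι1]
      refine Finset.sum_eq_zero fun a _ => ?_
      simp [hκ', hs, skipFin, cuspMatrix, skip_ne]
    · rw [ιs, natDiff_apply]
      refine Finset.sum_congr rfl fun a _ => ?_
      rw [ιs]
      simp only [hs, skipFin, cuspMatrix_skip]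
  have hd0 : natDiff (n + 2) (cuspMatrix k E) (Pi.single κ 1) = Pi.single κ' 1 := by
    ext j
    rw [natDiff_single]
    simp [cuspMatrix, hκ, hκ', Pi.single_apply, Fin.ext_iff]
  have hd1 : natDiff (n + 2) (cuspMatrix k E) (Pi.single κ' 1) = 0 := by
    ext j
    rw [natDiff_single]
    simp [cuspMatrix, hκ']
  let τ' : Fin (n + 2) → Fin (n + 2) := Function.extend s (s ∘ τ) (Equiv.swap κ κ')
  have τs : ∀ a, τ' (s a) = s (τ a) := fun a => hinj.extend_apply _ _ _
  have τ0 : τ' κ = κ' := (Function.extend_apply' _ _ _ n0).trans (Equiv.swap_apply_left _ _)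
  have τ1 : τ' κ' = κ := (Function.extend_apply' _ _ _ n1).trans (Equiv.swap_apply_right _ _)
  let e' : Fin (n + 2) → Fin (n + 2) → ZMod 2 :=
    Function.extend s (fun a => ι (e a)) fun i => Pi.single i 1
  have es : ∀ a, e' (s a) = ι (e a) := fun a => hinj.extend_apply _ _ _
  have e0 : e' κ = Pi.single κ 1 := Function.extend_apply' _ _ _ n0
  have e1 : e' κ' = Pi.single κ' 1 := Function.extend_apply' _ _ _ n1
  refine ⟨τ', (isCanonicalInvolution_iff _ τ').2 ⟨?_, ?_, e', ?_, ?_⟩, τs, τ0⟩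
  · intro i
    rcases cover i with rfl | rfl | ⟨a, rfl⟩
    · rw [τ0, τ1]
    · rw [τ1, τ0]
    · rw [τs, τs, h1]
  · intro i
    rcases cover i with rfl | rfl | ⟨a, rfl⟩
    · rw [τ0]; exact hne.symm
    · rw [τ1]; exact hne
    · rw [τs]; exact fun h => h2 a (hinj h)
  · have hsing : ∀ i : Fin (n + 2), (Pi.single i 1 : Fin (n + 2) → ZMod 2) i = 1 ∧
        (Pi.single i 1 : Fin (n + 2) → ZMod 2) ∈ tail (n + 2) i := fun i =>
      ⟨by simp, fun l hl => by simp [(show l < i from hl).ne]⟩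
    intro i
    rcases cover i with rfl | rfl | ⟨a, rfl⟩
    · rw [e0]; exact hsing _
    · rw [e1]; exact hsing _
    · rw [es]
      refine ⟨by rw [ιs, (hu a).1], fun l hl => ?_⟩
      rcases cover l with rfl | rfl | ⟨b, rfl⟩
      · exact ι0 _
      · exact ι1 _
      · rw [ιs]
        exact (hu a).2 b ((skipFin_strictMono k n).lt_iff_lt.1 hl)
  · intro i
    rcases cover i with rfl | rfl | ⟨a, rfl⟩
    · rw [τ0, e0, e1, hd0]
      refine ⟨fun _ => rfl, fun h => ?_⟩
      simp [hκ, hκ', Fin.lt_def] at h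
    · rw [τ1, e0, e1, hd1]
      refine ⟨fun h => ?_, fun _ => rfl⟩
      simp [hκ, hκ', Fin.lt_def] at h
    · rw [τs, es, es, hd]
      refine ⟨fun h => ?_, fun h => ?_⟩
      · rw [(he a).1 ((skipFin_strictMono k n).lt_iff_lt.1 h)]
      · rw [(he a).2 ((skipFin_strictMono k n).lt_iff_lt.1 h)]
        ext j
        rcases cover j with rfl | rfl | ⟨b, rfl⟩
        · exact ι0 _
        · exact ι1 _
        · exact ιs _ _

/-- The matrix behind a right cusp. -/
def rightCuspMatrix (z : ZMod 2) (k : ℕ) (E : ℕ → ℕ → ZMod 2) (a b : ℕ) : ZMod 2 :=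
  E (skip k a) (skip k b) +
    (E (skip k a) (k + 1) + z * E (skip k a) k) * (E k (skip k b) + z * E (k + 1) (skip k b))

/-- Cancellation of the acyclic subcomplex spanned by `σ_k + z σ_{k+1}` and its differential. The
quotient map keeps the leading coordinates of the other strands, so it carries the rest of a normal
basis to a normal basis. -/
theorem canonicalInvolution_rightCusp {E : ℕ → ℕ → ZMod 2} (hE : ∀ i j, j ≤ i → E i j = 0)
    (z : ZMod 2) {k : ℕ} (hk : k ≤ n) (hE1 : E k (k + 1) = 1) {τ : Fin (n + 2) → Fin (n + 2)}
    (h : IsCanonicalInvolution (natDiff (n + 2) E) τ) :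
    ∃ τ', IsCanonicalInvolution (natDiff n (rightCuspMatrix z k E)) τ' ∧
      (∀ a, τ (skipFin k n a) = skipFin k n (τ' a)) ∧
      τ ⟨k, by omega⟩ = ⟨k + 1, by omega⟩ := by
  classical
  obtain ⟨h1, h2, e, hu, he⟩ := (isCanonicalInvolution_iff _ τ).1 h
  have hex := h.isExact
  set d := natDiff (n + 2) E with hd
  have hdd : ∀ v, d (d v) = 0 := fun v => by
    have : d v ∈ LinearMap.ker d := by rw [hex]; exact ⟨v, rfl⟩
    exact this
  set s := skipFin k n with hs
  have smono : StrictMono s := skipFin_strictMono k n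
  set κ : Fin (n + 2) := ⟨k, by omega⟩ with hκ
  set κ' : Fin (n + 2) := ⟨k + 1, by omega⟩ with hκ'
  have hlt : κ < κ' := Fin.lt_def.2 (by simp [hκ, hκ'])
  have cover : ∀ i, i = κ ∨ i = κ' ∨ ∃ a, s a = i := fun i => by
    simpa [Fin.ext_iff, hκ, hκ'] using skipFin_cover hk i
  -- `d (e κ)` leads at `κ'`, the next coordinate after `κ`, which leaves no source for `κ'` other
  -- than `κ`.
  have τ0 : τ κ = κ' := by
    have hdc : d (e κ) κ' = 1 := by
      rw [hd, natDiff_apply, sum_skipFin hk, ← hκ, ← hκ', ← hs, (hu κ).1, one_mul]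
      have z1 : E (κ' : ℕ) κ' = 0 := hE _ _ le_rfl
      have z2 : ∑ a, e κ (s a) * E (s a) κ' = 0 := by
        refine Finset.sum_eq_zero fun a _ => ?_
        by_cases ha : s a < κ
        · rw [(hu κ).2 _ ha, zero_mul]
        · rw [hE, mul_zero]
          have h3 := skip_ne k a
          have h4 : ¬ skip k a < k := ha
          change k + 1 ≤ skip k a
          omega
      rw [z1, z2, mul_zero, add_zero, add_zero]
      exact hE1
    have htl : d (e κ) ∈ tail (n + 2) κ' :=
      isTriangular_tail (isTriangular_natDiff hE) (hu κ).2
    have h3 := le_of_apply_ne_zero h (hu κ).2 htl (by rw [hdc]; exact one_ne_zero)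
    have h4 : τ κ' = κ := by
      apply Fin.ext
      have := h3.1
      have := h3.2
      simp only [Fin.lt_def, hκ, hκ'] at *
      omega
    rw [← h4, h1]
  have τ1 : τ κ' = κ := by rw [← τ0, h1]
  -- The coordinates on the remaining strands of the differential of `σ_κ + z σ_κ'`; its coordinates
  -- at `κ` and `κ'` are zero and one. The map `π` below kills this differential and `σ_κ + z σ_κ'`
  -- itself.
  let r : Fin n → ZMod 2 := fun b => E k (s b) + z * E (k + 1) (s b)
  let π : (Fin (n + 2) → ZMod 2) →ₗ[ZMod 2] (Fin n → ZMod 2) :=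
    { toFun := fun v b => v (s b) + (v κ' + z * v κ) * r b
      map_add' := fun v w => by ext b; simp only [Pi.add_apply]; ring
      map_smul' := fun c v => by
        ext b; simp only [Pi.smul_apply, smul_eq_mul, RingHom.id_apply]; ring }
  have hπ : ∀ v b, π v b = v (s b) + (v κ' + z * v κ) * r b := fun _ _ => rfl
  set d' := natDiff n (rightCuspMatrix z k E) with hd'
  have hZ : ∀ a b : Fin n, rightCuspMatrix z k E a b =
      E (s a) (s b) + (E (s a) κ' + z * E (s a) κ) * r b := fun _ _ => rfl
  have πs : ∀ a : Fin n, π (Pi.single (s a) 1) = Pi.single a 1 := by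
    intro a
    ext b
    have m0 : κ ≠ s a := (skipFin_ne a (Or.inl rfl)).symm
    have m1 : κ' ≠ s a := (skipFin_ne a (Or.inr rfl)).symm
    simp [hπ, Pi.single_apply, smono.injective.eq_iff, m0, m1]
  have sκ : ∀ b, s b ≠ κ := fun b => skipFin_ne b (Or.inl rfl)
  have sκ' : ∀ b, s b ≠ κ' := fun b => skipFin_ne b (Or.inr rfl)
  have π1 : π (Pi.single κ' 1) = r := by
    ext b
    simp [hπ, sκ', hlt.ne]
  have π0 : π (Pi.single κ 1) = z • r := by
    ext b
    simp [hπ, sκ, hlt.ne']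
  -- A coordinate of `d (d (σ_κ + z σ_κ')) = 0`.
  have key : ∀ j : Fin (n + 2), E (k + 1) j + ∑ a, r a * E (s a) j = 0 := by
    intro j
    have h3 := congrFun (hdd (Pi.single κ 1 + z • Pi.single κ' 1)) j
    rw [hd, natDiff_apply, sum_skipFin hk, ← hκ, ← hκ', ← hs] at h3
    simp only [map_add, map_smul, Pi.add_apply, Pi.smul_apply, natDiff_single, smul_eq_mul,
      Pi.zero_apply] at h3
    have z1 : E (κ : ℕ) κ = 0 := hE _ _ le_rfl
    have z2 : E (κ' : ℕ) κ = 0 := hE _ _ (by simp [hκ, hκ'])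
    have z3 : E (κ' : ℕ) κ' = 0 := hE _ _ le_rfl
    have z4 : E (κ : ℕ) κ' = 1 := hE1
    rw [z1, z2, z3, z4] at h3
    simpa using h3
  have hc1 : π (d (Pi.single κ' 1)) = d' r := by
    ext b
    have e1 := key (s b)
    have e2 := key κ'
    have e3 := key κ
    rw [hπ, hd, natDiff_single, natDiff_single, natDiff_single, hd', natDiff_apply]
    have z2 : E (κ' : ℕ) κ = 0 := hE _ _ (by simp [hκ, hκ'])
    have z3 : E (κ' : ℕ) κ' = 0 := hE _ _ le_rfl
    have z2' : E (k + 1) κ = 0 := z2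
    have z3' : E (k + 1) κ' = 0 := z3
    rw [z2', zero_add] at e3
    rw [z3', zero_add] at e2
    rw [z2, z3]
    have : ∑ a, r a * rightCuspMatrix z k E a b =
        ∑ a, r a * E (s a) (s b) + (∑ a, r a * E (s a) κ' + z * ∑ a, r a * E (s a) κ) * r b := by
      rw [Finset.mul_sum, ← Finset.sum_add_distrib, Finset.sum_mul, ← Finset.sum_add_distrib]
      refine Finset.sum_congr rfl fun a _ => ?_
      rw [hZ]; ring
    rw [this, e2, e3, ← CharTwo.add_eq_zero]
    simpa using e1
  have hc : ∀ v, π (d v) = d' (π v) := by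
    have : π ∘ₗ d = d' ∘ₗ π := by
      refine LinearMap.pi_ext' fun i => LinearMap.ext_ring ?_
      simp only [LinearMap.comp_apply, LinearMap.single_apply]
      rcases cover i with rfl | rfl | ⟨a, rfl⟩
      · rw [π0, map_smul, ← hc1]
        ext b
        rw [Pi.smul_apply, hπ, hπ, hd, natDiff_single, natDiff_single, natDiff_single,
          natDiff_single, natDiff_single, natDiff_single]
        have z1 : E (κ : ℕ) κ = 0 := hE _ _ le_rfl
        have z2 : E (κ' : ℕ) κ = 0 := hE _ _ (by simp [hκ, hκ'])
        have z3 : E (κ' : ℕ) κ' = 0 := hE _ _ le_rfl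
        have z4 : E (κ : ℕ) κ' = 1 := hE1
        rw [z1, z2, z3, z4]
        have h5 : E (κ : ℕ) (s b) + E (κ : ℕ) (s b) = 0 := CharTwo.add_self_eq_zero _
        have h6 : r b = E (κ : ℕ) (s b) + z * E (κ' : ℕ) (s b) := rfl
        rw [h6, smul_eq_mul]
        linear_combination h5
      · rw [π1, hc1]
      · rw [πs]
        ext b
        rw [hπ, hd, natDiff_single, natDiff_single, natDiff_single, hd', natDiff_single, hZ]
    intro v
    exact LinearMap.congr_fun this v
  -- Above the cusp `r` vanishes by triangularity; below it the two cancelled coordinates of `v`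
  -- vanish.
  have hlead : ∀ b : Fin n, ∀ v ∈ tail (n + 2) (s b), π v b = v (s b) := by
    intro b v hv
    rw [hπ]
    by_cases hb : s b < κ
    · have h3 : (s b : ℕ) < k := hb
      have : r b = 0 := by
        show E k (s b) + z * E (k + 1) (s b) = 0
        rw [hE _ _ (by omega), hE _ _ (by omega)]; simp
      rw [this, mul_zero, add_zero]
    · have h3 := skip_ne k b
      have h4 : ¬ skip k b < k := hb
      have h5 : (s b : ℕ) = skip k b := rfl
      rw [hv κ (by change k < s b; omega), hv κ' (by change k + 1 < s b; omega)]; simp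
  have hr : ∀ a, ∃ b, s b = τ (s a) := by
    intro a
    rcases cover (τ (s a)) with h3 | h3 | h3
    · exact absurd (by rw [← τ0, ← h3, h1]) (sκ' a)
    · exact absurd (by rw [← τ1, ← h3, h1]) (sκ a)
    · exact h3
  choose τ' hτ' using hr
  have τ'lt : ∀ a b, τ' a < b ↔ τ (s a) < s b := fun a b => by
    rw [← hτ', smono.lt_iff_lt]
  refine ⟨τ', (isCanonicalInvolution_iff _ τ').2 ⟨?_, ?_, fun a => π (e (s a)), ?_, ?_⟩,
    fun a => (hτ' a).symm, τ0⟩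
  · intro a
    apply smono.injective
    rw [hτ', hτ', h1]
  · intro a ha
    have := hτ' a
    rw [ha] at this
    exact h2 _ this.symm
  · intro a
    refine ⟨(hlead _ _ (hu _).2).trans (hu _).1, fun l hl => ?_⟩
    have hl' : s l < s a := smono hl
    change π (e (s a)) l = 0
    rw [hlead _ _ (tail_anti (show (s l : ℕ) ≤ s a from hl'.le) (hu _).2)]
    exact (hu _).2 _ hl'
  · intro a
    simp only [← hc]
    refine ⟨fun h3 => ?_, fun h3 => ?_⟩
    · rw [(he (s a)).1 (by rw [← hτ']; exact smono h3), hτ']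
    · rw [(he (s a)).2 ((τ'lt _ _).1 h3), map_zero]

/-- The matrix behind a crossing. -/
def crossMatrix (y : ZMod 2) (k : ℕ) (E : ℕ → ℕ → ZMod 2) (a b : ℕ) : ZMod 2 :=
  let C : ℕ → ZMod 2 := fun a =>
    if b = k then E a (k + 1) + y * E a k else if b = k + 1 then E a k else E a b
  if a = k then C (k + 1) else if a = k + 1 then C k + y * C (k + 1) else C a

/-- `crossMatrix` is the conjugate matrix: `C` changes the columns, and the outer case distinction
changes the rows by the inverse. The identity is checked on basis vectors. -/
theorem crossEquiv_natDiff {E : ℕ → ℕ → ZMod 2} (y : ZMod 2) {κ κ' : Fin n}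
    (hκ : (κ' : ℕ) = κ + 1) (hne : κ ≠ κ') (x : Fin n → ZMod 2) :
    crossEquiv y κ κ' hne (natDiff n E x) =
      natDiff n (crossMatrix y κ E) (crossEquiv y κ κ' hne x) := by
  set φ := crossEquiv y κ κ' hne with hφ
  set d' := natDiff n (crossMatrix y κ E) with hd'
  have φs : ∀ i, i ≠ κ → i ≠ κ' → φ (Pi.single i 1) = Pi.single i 1 := by
    intro i h h'
    ext j
    rw [hφ, crossEquiv_apply]
    simp only [Pi.single_apply, h.symm, h'.symm, if_false]
    split_ifs with a b c
    all_goals simp_all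
  have φ1 : φ (Pi.single κ' 1) = Pi.single κ 1 := by
    ext j
    rw [hφ, crossEquiv_apply]
    simp only [Pi.single_apply, hne, if_false]
    split_ifs <;> simp_all
  have φ0 : φ (Pi.single κ 1) = Pi.single κ' 1 + y • Pi.single κ 1 := by
    ext j
    rw [hφ, crossEquiv_apply]
    simp only [Pi.add_apply, Pi.smul_apply, Pi.single_apply, hne.symm, if_false]
    split_ifs <;> simp_all
  have hv : ∀ i j : Fin n, φ (natDiff n E (Pi.single i 1)) j =
      if j = κ then E i κ' + y * E i κ else if j = κ' then E i κ else E i j := by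
    intro i j
    rw [hφ, crossEquiv_apply]
    simp only [natDiff_single]
  have : φ.toLinearMap ∘ₗ natDiff n E = d' ∘ₗ φ.toLinearMap := by
    refine LinearMap.pi_ext' fun i => LinearMap.ext_ring ?_
    simp only [LinearMap.comp_apply, LinearMap.single_apply, LinearEquiv.coe_coe]
    ext j
    rw [hv]
    have hj : (j : ℕ) = κ ↔ j = κ := Fin.ext_iff.symm
    have hj' : (j : ℕ) = κ + 1 ↔ j = κ' := by rw [← hκ]; exact Fin.ext_iff.symm
    have hs : ∀ l : Fin n, d' (Pi.single l 1) j = crossMatrix y κ E l j := fun l => by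
      rw [hd', natDiff_single]
    by_cases h0 : i = κ
    · subst h0
      rw [φ0, map_add, map_smul, Pi.add_apply, Pi.smul_apply, hs, hs, smul_eq_mul]
      simp only [crossMatrix, hκ, hj, hj', if_true, Nat.succ_ne_self, if_false]
      generalize (if j = i then E (i + 1) (i + 1) + y * E (i + 1) i
        else if j = κ' then E (i + 1) i else E (i + 1) j) = t
      have := CharTwo.add_self_eq_zero (y * t)
      linear_combination -this
    by_cases h1 : i = κ'
    · subst h1
      rw [φ1, hs]
      simp only [crossMatrix, hκ, hj, hj', if_true]
    · rw [φs i h0 h1, hs]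
      have g0 : (i : ℕ) ≠ κ := fun h => h0 (Fin.ext h)
      have g1 : (i : ℕ) ≠ κ + 1 := fun h => h1 (Fin.ext (by omega))
      simp only [crossMatrix, hκ, hj, hj', g0, g1, if_false]
  exact LinearMap.congr_fun this x

end

/-! ### Sums over pieces of disks -/

section Pieces

variable {S : Type} {Γ : List (Event S)}

/-- A slice has one neighbouring event in each direction. This discards, in each case analysis
below, the constructors of pieces that belong to other kinds of events. -/
theorem Across.unique {σ : Dir} {q q' q'' : ℕ} {e e' : Event S} (h : Across Γ σ q e q')
    (h' : Across Γ σ q e' q'') : e = e' ∧ q' = q'' := by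
  cases σ
  · obtain ⟨h1, h2⟩ := h
    obtain ⟨h3, h4⟩ := h'
    have : q' = q'' := by omega
    subst this
    exact ⟨Option.some.inj (h1.symm.trans h3), rfl⟩
  · obtain ⟨h1, h2⟩ := h
    obtain ⟨h3, h4⟩ := h'
    exact ⟨Option.some.inj (h1.symm.trans h3), h2.trans h4.symm⟩

theorem closing_ne_cross {σ : Dir} {j k : ℕ} {c : Bool} {s : S} :
    Event.cross k c s ≠ closing S σ j := by
  cases σ <;> simp [closing]

theorem opening_ne_cross {σ : Dir} {j k : ℕ} {c : Bool} {s : S} :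
    Event.cross k c s ≠ opening S σ j := closing_ne_cross

theorem opening_ne_closing {σ : Dir} {j k : ℕ} : opening S σ j ≠ closing S σ k := by
  cases σ <;> simp [closing, opening, Dir.opp]

theorem closing_injective {σ : Dir} {j k : ℕ} (h : closing S σ j = closing S σ k) : j = k := by
  cases σ <;> simpa [closing] using h

theorem opening_injective {σ : Dir} {j k : ℕ} (h : opening S σ j = opening S σ k) : j = k :=
  closing_injective h

theorem Piece.lt {σ : Dir} {q a b : ℕ} (P : Piece Γ σ q a b) : a < b := by
  cases P with
  | pass _ h => exact h
  | tip _ ha hb => omega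
  | cap _ ha hb => omega
  | @passClosing _ _ _ a' b' _ _ k h hab ha hb P =>
    rw [ha, hb]; exact skip_strictMono _ hab
  | passOpening _ h => exact h
  | turnBelow _ ha hb => omega
  | turnAbove => omega
  | split => omega

theorem isEmpty_piece_of_le {σ : Dir} {q a b : ℕ} (h : b ≤ a) : IsEmpty (Piece Γ σ q a b) :=
  ⟨fun P => absurd P.lt (not_lt.2 h)⟩

/-- A piece that starts at a crossing. -/
theorem isEmpty_cross {σ : Dir} {q q' a b k : ℕ} {c : Bool} {s : S}
    (h : Across Γ σ q (.cross k c s) q') (hk : c = true ∨ ¬ (a = k ∧ b = k + 1))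
    (H : ∀ a' b', TopStep k c a a' → BotStep k c b b' → a < b → IsEmpty (Piece Γ σ q' a' b')) :
    IsEmpty (Piece Γ σ q a b) := by
  refine ⟨fun P => ?_⟩
  cases P with
  | pass h' hab t u P =>
    obtain ⟨he, rfl⟩ := h.unique h'
    cases he
    exact (H _ _ t u hab).false P
  | tip h' ha hb =>
    obtain ⟨he, -⟩ := h.unique h'
    cases he
    simp at hk
    omega
  | cap h' => exact closing_ne_cross (h.unique h').1
  | passClosing h' => exact closing_ne_cross (h.unique h').1
  | passOpening h' => exact opening_ne_cross (h.unique h').1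
  | turnBelow h' => exact closing_ne_cross (h.unique h').1
  | turnAbove h' => exact closing_ne_cross (h.unique h').1
  | split h' => exact opening_ne_cross (h.unique h').1

/-- A piece that starts at a rounding where strands appear. -/
theorem isEmpty_opening {σ : Dir} {q q' a b k : ℕ} (h : Across Γ σ q (opening S σ k) q')
    (H : ∀ a' b', IsEmpty (Piece Γ σ q' a' b')) : IsEmpty (Piece Γ σ q a b) := by
  refine ⟨fun P => ?_⟩
  cases P with
  | pass h' => exact opening_ne_cross (h.unique h').1.symm
  | tip h' => exact opening_ne_cross (h.unique h').1.symm
  | cap h' => exact opening_ne_closing (h.unique h').1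
  | passClosing h' => exact opening_ne_closing (h.unique h').1
  | passOpening h' _ P => obtain ⟨-, rfl⟩ := h.unique h'; exact (H _ _).false P
  | turnBelow h' => exact opening_ne_closing (h.unique h').1
  | turnAbove h' => exact opening_ne_closing (h.unique h').1
  | split h' _ _ P => obtain ⟨-, rfl⟩ := h.unique h'; exact (H _ _).false P

/-- A piece that starts at a rounding where strands disappear. -/
theorem isEmpty_closing {σ : Dir} {q q' a b k : ℕ} (h : Across Γ σ q (closing S σ k) q')
    (hk : ¬ (a = k ∧ b = k + 1)) (H : ∀ a' b', IsEmpty (Piece Γ σ q' a' b')) :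
    IsEmpty (Piece Γ σ q a b) := by
  refine ⟨fun P => ?_⟩
  cases P with
  | pass h' => exact closing_ne_cross (h.unique h').1.symm
  | tip h' => exact closing_ne_cross (h.unique h').1.symm
  | cap h' ha hb => exact hk (closing_injective (h.unique h').1 ▸ ⟨ha, hb⟩)
  | passClosing h' _ _ _ P => obtain ⟨-, rfl⟩ := h.unique h'; exact (H _ _).false P
  | passOpening h' => exact opening_ne_closing (h.unique h').1.symm
  | turnBelow h' _ _ _ _ P => obtain ⟨-, rfl⟩ := h.unique h'; exact (H _ _).false P
  | turnAbove h' _ _ _ _ _ P => obtain ⟨-, rfl⟩ := h.unique h'; exact (H _ _).false P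
  | split h' => exact opening_ne_closing (h.unique h').1.symm

/-- A piece with an end on a strand that turns around at a rounding. -/
theorem isEmpty_closing_of_opp {σ : Dir} {q q' a b k : ℕ} (h : Across Γ σ q (closing S σ k) q')
    (hk : ¬ (a = k ∧ b = k + 1)) (hend : a = k ∨ a = k + 1 ∨ b = k ∨ b = k + 1)
    (H : ∀ a' b', IsEmpty (Piece Γ σ.opp q a' b')) : IsEmpty (Piece Γ σ q a b) := by
  refine ⟨fun P => ?_⟩
  cases P with
  | pass h' => exact closing_ne_cross (h.unique h').1.symm
  | tip h' => exact closing_ne_cross (h.unique h').1.symm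
  | cap h' ha hb => exact hk (closing_injective (h.unique h').1 ▸ ⟨ha, hb⟩)
  | @passClosing _ _ _ _ a' _ b' j h' _ ha hb P =>
    obtain rfl := closing_injective (h.unique h').1
    have := skip_ne k a'
    have := skip_ne k b'
    omega
  | passOpening h' => exact opening_ne_closing (h.unique h').1.symm
  | turnBelow h' _ _ _ Q => exact (H _ _).false Q
  | turnAbove h' _ _ _ _ Q => exact (H _ _).false Q
  | split h' => exact opening_ne_closing (h.unique h').1.symm

theorem isEmpty_end {q a b : ℕ} (h : Γ[q]? = none) : IsEmpty (Piece Γ .east q a b) := by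
  have key : ∀ {e q'}, ¬ Across Γ .east q e q' := fun h' => by
    have := h'.1
    rw [h] at this
    cases this
  refine ⟨fun P => ?_⟩
  cases P with
  | pass h' => exact key h'
  | tip h' => exact key h'
  | cap h' => exact key h'
  | passClosing h' => exact key h'
  | passOpening h' => exact key h'
  | turnBelow h' => exact key h'
  | turnAbove h' => exact key h'
  | split h' => exact key h'

variable {R : Type*} [CommSemiring R] (f : S → R)

/-- There are finitely many pieces, and the sum of the products of the values of `f` on their
negative corners is `r`. -/
def PieceSum (Γ : List (Event S)) (σ : Dir) (q a b : ℕ) (r : R) : Prop :=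
  ∃ _ : Fintype (Piece Γ σ q a b), ∑ P : Piece Γ σ q a b, (P.word.map f).prod = r

variable {f}

/-- The values are commutative, so the order of the corners plays no role in the sums. -/
theorem Dir.prod_cat (σ : Dir) (u v : List S) :
    ((σ.cat u v).map f).prod = (u.map f).prod * (v.map f).prod := by
  cases σ
  · simp [Dir.cat, mul_comm]
  · simp [Dir.cat]

theorem pieceSum_of_isEmpty {σ : Dir} {q a b : ℕ} (h : IsEmpty (Piece Γ σ q a b)) :
    PieceSum f Γ σ q a b 0 :=
  ⟨Fintype.ofIsEmpty, by simp⟩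

theorem PieceSum.of_eq {σ : Dir} {q a b : ℕ} {r r' : R} (h : PieceSum f Γ σ q a b r)
    (hr : r = r') : PieceSum f Γ σ q a b r' := hr ▸ h

theorem pieceSum_of_bijective {α : Type} [Fintype α] {σ : Dir} {q a b : ℕ}
    (g : α → Piece Γ σ q a b) (hg : Function.Bijective g) :
    PieceSum f Γ σ q a b (∑ x, ((g x).word.map f).prod) := by
  let _ := Fintype.ofBijective g hg
  exact ⟨inferInstance, (Fintype.sum_bijective g hg _ _ fun _ => rfl).symm⟩

/-- The hypotheses exclude the tip and both corners, so the passage is forced. -/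
theorem pieceSum_straight {σ : Dir} {q q' a b k : ℕ} {c : Bool} {s : S} {r : R}
    (h : Across Γ σ q (.cross k c s) q') (hab : a < b) (hk : ¬ (a = k ∧ b = k + 1))
    (ha : c = true → a ≠ k + 1) (hb : c = true → b ≠ k)
    (H : PieceSum f Γ σ q' (Equiv.swap k (k + 1) a) (Equiv.swap k (k + 1) b) r) :
    PieceSum f Γ σ q a b r := by
  obtain ⟨hF, rfl⟩ := H
  refine (pieceSum_of_bijective
    (fun P => Piece.pass h hab (.straight rfl) (.straight rfl) P) ⟨?_, ?_⟩).of_eq ?_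
  · intro P P' e
    cases e; rfl
  · intro P
    cases P with
    | pass h' hab' t u P =>
      obtain ⟨he, rfl⟩ := h.unique h'
      cases he
      cases t with
      | corner hc h1 => exact absurd h1 (ha hc)
      | straight h1 =>
        cases u with
        | corner hc h2 => exact absurd h2 (hb hc)
        | straight h2 =>
          have h1' := h1
          have h2' := h2
          subst h1' h2'
          exact ⟨P, rfl⟩
    | tip h' ha' hb' =>
      obtain ⟨he, -⟩ := h.unique h'
      cases he
      exact absurd ⟨ha', hb'⟩ hk
    | cap h' => exact absurd (h.unique h').1 closing_ne_cross
    | passClosing h' => exact absurd (h.unique h').1 closing_ne_cross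
    | passOpening h' => exact absurd (h.unique h').1 opening_ne_cross
    | turnBelow h' => exact absurd (h.unique h').1 closing_ne_cross
    | turnAbove h' => exact absurd (h.unique h').1 closing_ne_cross
    | split h' => exact absurd (h.unique h').1 opening_ne_cross
  · refine Finset.sum_congr rfl fun P _ => ?_
    simp [Piece.word, TopStep.word, BotStep.word, Dir.prod_cat]

/-- Following both strands would turn the interval upside down, and here the south and north corners
are positive; only the tip remains. -/
theorem pieceSum_tip {σ : Dir} {q q' k : ℕ} {s : S} (h : Across Γ σ q (.cross k false s) q') :
    PieceSum f Γ σ q k (k + 1) (f s) := by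
  refine (pieceSum_of_bijective (fun _ : Unit => Piece.tip h rfl rfl) ⟨?_, ?_⟩).of_eq ?_
  · exact fun _ _ _ => rfl
  · intro P
    cases P with
    | pass h' hab' t u P =>
      obtain ⟨he, rfl⟩ := h.unique h'
      cases he
      cases t with
      | corner hc h1 => cases hc
      | straight h1 =>
        cases u with
        | corner hc h2 => cases hc
        | straight h2 =>
          have := P.lt
          rw [h1, h2, Equiv.swap_apply_left, Equiv.swap_apply_right] at this
          omega
    | tip h' ha hb =>
      obtain ⟨he, rfl⟩ := h.unique h'
      cases he
      exact ⟨(), rfl⟩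
    | cap h' => exact absurd (h.unique h').1 closing_ne_cross
    | passClosing h' => exact absurd (h.unique h').1 closing_ne_cross
    | passOpening h' => exact absurd (h.unique h').1 opening_ne_cross
    | turnBelow h' => exact absurd (h.unique h').1 closing_ne_cross
    | turnAbove h' => exact absurd (h.unique h').1 closing_ne_cross
    | split h' => exact absurd (h.unique h').1 opening_ne_cross
  · simp [Piece.word]

/-- Here the west and east corners are positive, so there is no tip. A boundary can turn only if it
arrives at `k + 1` from above the crossing's south corner or at `k` for the north corner, which is
not so for this pair; and going straight on inverts the interval. -/
theorem isEmpty_cross_pair {σ : Dir} {q q' k : ℕ} {s : S}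
    (h : Across Γ σ q (.cross k true s) q') : IsEmpty (Piece Γ σ q k (k + 1)) := by
  refine isEmpty_cross h (Or.inl rfl) fun a' b' t u _ => isEmpty_piece_of_le ?_
  cases t with
  | corner hc h1 => omega
  | straight h1 =>
    cases u with
    | corner hc h2 => omega
    | straight h2 => rw [h1, h2, Equiv.swap_apply_left, Equiv.swap_apply_right]; omega

/-- The upper boundary has two choices: to follow its strand to `k`, or to turn at the negative
south corner and remain at `k + 1`, which contributes the factor `f s`. -/
theorem pieceSum_topCorner {σ : Dir} {q q' b k : ℕ} {s : S} {r r' : R}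
    (h : Across Γ σ q (.cross k true s) q') (hb : k + 1 < b)
    (H : PieceSum f Γ σ q' k b r) (H' : PieceSum f Γ σ q' (k + 1) b r') :
    PieceSum f Γ σ q (k + 1) b (r + f s * r') := by
  obtain ⟨hF, rfl⟩ := H
  obtain ⟨hF', rfl⟩ := H'
  have hs : Equiv.swap k (k + 1) b = b := Equiv.swap_apply_of_ne_of_ne (by omega) (by omega)
  refine (pieceSum_of_bijective (Sum.elim
    (fun P => Piece.pass h hb (.straight (Equiv.swap_apply_right _ _).symm) (.straight hs.symm) P)
    (fun P => Piece.pass h hb (.corner rfl rfl rfl) (.straight hs.symm) P)) ⟨?_, ?_⟩).of_eq ?_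
  · rintro (P | P) (P' | P') e <;> simp only [Sum.elim_inl, Sum.elim_inr] at e
    · cases e; rfl
    · simp at e
    · simp at e
    · cases e; rfl
  · intro P
    cases P with
    | pass h' hab' t u P =>
      obtain ⟨he, rfl⟩ := h.unique h'
      cases he
      cases u with
      | corner hc h2 => omega
      | straight h2 =>
        rw [hs] at h2
        subst h2
        cases t with
        | corner hc h1 h3 =>
          have h3' := h3
          subst h3'
          exact ⟨Sum.inr P, rfl⟩
        | straight h1 =>
          rw [Equiv.swap_apply_right] at h1
          subst h1; exact ⟨Sum.inl P, rfl⟩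
    | tip h' ha hb =>
      obtain ⟨he, -⟩ := h.unique h'
      cases he
    | cap h' => exact absurd (h.unique h').1 closing_ne_cross
    | passClosing h' => exact absurd (h.unique h').1 closing_ne_cross
    | passOpening h' => exact absurd (h.unique h').1 opening_ne_cross
    | turnBelow h' => exact absurd (h.unique h').1 closing_ne_cross
    | turnAbove h' => exact absurd (h.unique h').1 closing_ne_cross
    | split h' => exact absurd (h.unique h').1 opening_ne_cross
  · rw [Fintype.sum_sum_type, Finset.mul_sum]
    congr 1
    · refine Finset.sum_congr rfl fun P _ => ?_
      simp [Piece.word, TopStep.word, BotStep.word, Dir.prod_cat]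
    · refine Finset.sum_congr rfl fun P _ => ?_
      simp [Piece.word, TopStep.word, BotStep.word, Dir.prod_cat, mul_comm]

theorem pieceSum_botCorner {σ : Dir} {q q' a k : ℕ} {s : S} {r r' : R}
    (h : Across Γ σ q (.cross k true s) q') (ha : a < k)
    (H : PieceSum f Γ σ q' a (k + 1) r) (H' : PieceSum f Γ σ q' a k r') :
    PieceSum f Γ σ q a k (r + f s * r') := by
  obtain ⟨hF, rfl⟩ := H
  obtain ⟨hF', rfl⟩ := H'
  have hs : Equiv.swap k (k + 1) a = a := Equiv.swap_apply_of_ne_of_ne (by omega) (by omega)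
  refine (pieceSum_of_bijective (Sum.elim
    (fun P => Piece.pass h ha (.straight hs.symm) (.straight (Equiv.swap_apply_left _ _).symm) P)
    (fun P => Piece.pass h ha (.straight hs.symm) (.corner rfl rfl rfl) P)) ⟨?_, ?_⟩).of_eq ?_
  · rintro (P | P) (P' | P') e <;> simp only [Sum.elim_inl, Sum.elim_inr] at e
    · cases e; rfl
    · simp at e
    · simp at e
    · cases e; rfl
  · intro P
    cases P with
    | pass h' hab' t u P =>
      obtain ⟨he, rfl⟩ := h.unique h'
      cases he
      cases t with
      | corner hc h2 => omega
      | straight h2 =>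
        rw [hs] at h2
        subst h2
        cases u with
        | corner hc h1 h3 =>
          have h3' := h3
          subst h3'
          exact ⟨Sum.inr P, rfl⟩
        | straight h1 =>
          rw [Equiv.swap_apply_left] at h1
          subst h1; exact ⟨Sum.inl P, rfl⟩
    | tip h' ha hb =>
      obtain ⟨he, -⟩ := h.unique h'
      cases he
    | cap h' => exact absurd (h.unique h').1 closing_ne_cross
    | passClosing h' => exact absurd (h.unique h').1 closing_ne_cross
    | passOpening h' => exact absurd (h.unique h').1 opening_ne_cross
    | turnBelow h' => exact absurd (h.unique h').1 closing_ne_cross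
    | turnAbove h' => exact absurd (h.unique h').1 closing_ne_cross
    | split h' => exact absurd (h.unique h').1 opening_ne_cross
  · rw [Fintype.sum_sum_type, Finset.mul_sum]
    congr 1
    · refine Finset.sum_congr rfl fun P _ => ?_
      simp [Piece.word, TopStep.word, BotStep.word, Dir.prod_cat]
    · refine Finset.sum_congr rfl fun P _ => ?_
      simp [Piece.word, TopStep.word, BotStep.word, Dir.prod_cat]

theorem pieceSum_cap {σ : Dir} {q q' k : ℕ} (h : Across Γ σ q (closing S σ k) q') :
    PieceSum f Γ σ q k (k + 1) 1 := by
  refine (pieceSum_of_bijective (fun _ : Unit => Piece.cap h rfl rfl) ⟨?_, ?_⟩).of_eq ?_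
  · exact fun _ _ _ => rfl
  · intro P
    cases P with
    | pass h' => exact absurd (h.unique h').1.symm closing_ne_cross
    | tip h' => exact absurd (h.unique h').1.symm closing_ne_cross
    | cap h' ha hb =>
      obtain ⟨he, rfl⟩ := h.unique h'
      obtain rfl := closing_injective he
      exact ⟨(), rfl⟩
    | @passClosing _ _ _ _ a' _ b' j h' _ ha hb P =>
      obtain rfl := closing_injective (h.unique h').1
      exact absurd ha.symm (skip_ne k a').1
    | passOpening h' => exact absurd (h.unique h').1.symm opening_ne_closing
    | turnBelow h' ha hb =>
      obtain rfl := closing_injective (h.unique h').1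
      omega
    | turnAbove h' ha hb =>
      obtain rfl := closing_injective (h.unique h').1
      omega
    | split h' => exact absurd (h.unique h').1.symm opening_ne_closing
  · simp [Piece.word]

theorem pieceSum_closing {σ : Dir} {q q' a b k : ℕ} {r : R}
    (h : Across Γ σ q (closing S σ k) q') (hab : a < b) (H : PieceSum f Γ σ q' a b r) :
    PieceSum f Γ σ q (skip k a) (skip k b) r := by
  obtain ⟨hF, rfl⟩ := H
  refine (pieceSum_of_bijective (fun P => Piece.passClosing h hab rfl rfl P) ⟨?_, ?_⟩).of_eq ?_
  · intro P P' e
    cases e; rfl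
  · have hsa := skip_ne k a
    have hsb := skip_ne k b
    intro P
    cases P with
    | pass h' => exact absurd (h.unique h').1.symm closing_ne_cross
    | tip h' => exact absurd (h.unique h').1.symm closing_ne_cross
    | cap h' ha hb =>
      obtain rfl := closing_injective (h.unique h').1
      exact absurd ha hsa.1
    | @passClosing _ _ _ _ a' _ b' j h' _ ha hb P =>
      obtain ⟨he, rfl⟩ := h.unique h'
      obtain rfl := closing_injective he
      obtain rfl := (skip_strictMono k).injective ha
      obtain rfl := (skip_strictMono k).injective hb
      exact ⟨P, rfl⟩
    | passOpening h' => exact absurd (h.unique h').1.symm opening_ne_closing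
    | turnBelow h' ha hb =>
      obtain rfl := closing_injective (h.unique h').1
      exact absurd hb hsb.1
    | turnAbove h' ha hb =>
      obtain rfl := closing_injective (h.unique h').1
      exact absurd ha hsa.2
    | split h' => exact absurd (h.unique h').1.symm opening_ne_closing
  · refine Finset.sum_congr rfl fun P _ => ?_
    simp [Piece.word]

/-- `hk` keeps the rounding out of the interval and thereby excludes a split. -/
theorem pieceSum_opening {σ : Dir} {q q' a b k : ℕ} {r : R}
    (h : Across Γ σ q (opening S σ k) q') (hab : a < b) (hk : k ≤ a ∨ b < k)
    (H : PieceSum f Γ σ q' (skip k a) (skip k b) r) : PieceSum f Γ σ q a b r := by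
  obtain ⟨hF, rfl⟩ := H
  refine (pieceSum_of_bijective (fun P => Piece.passOpening h hab P) ⟨?_, ?_⟩).of_eq ?_
  · intro P P' e
    cases e; rfl
  · intro P
    cases P with
    | pass h' => exact absurd (h.unique h').1.symm opening_ne_cross
    | tip h' => exact absurd (h.unique h').1.symm opening_ne_cross
    | cap h' => exact absurd (h.unique h').1 opening_ne_closing
    | passClosing h' => exact absurd (h.unique h').1 opening_ne_closing
    | passOpening h' hab P =>
      obtain ⟨he, rfl⟩ := h.unique h'
      obtain rfl := opening_injective he
      exact ⟨P, rfl⟩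
    | turnBelow h' => exact absurd (h.unique h').1 opening_ne_closing
    | turnAbove h' => exact absurd (h.unique h').1 opening_ne_closing
    | split h' ha hb =>
      obtain rfl := opening_injective (h.unique h').1
      omega
  · refine Finset.sum_congr rfl fun P _ => ?_
    simp [Piece.word]

/-- The rounding lies inside the interval. Either the disk covers it, or the boundary wraps around
it and two independent pieces go on, which gives the product. -/
theorem pieceSum_split {σ : Dir} {q q' a b k : ℕ} {r r₁ r₂ : R}
    (h : Across Γ σ q (opening S σ k) q') (ha : a < k) (hb : k ≤ b)
    (H : PieceSum f Γ σ q' (skip k a) (skip k b) r) (H₁ : PieceSum f Γ σ q' a k r₁)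
    (H₂ : PieceSum f Γ σ q' (k + 1) (b + 2) r₂) : PieceSum f Γ σ q a b (r + r₁ * r₂) := by
  obtain ⟨hF, rfl⟩ := H
  obtain ⟨hF₁, rfl⟩ := H₁
  obtain ⟨hF₂, rfl⟩ := H₂
  refine (pieceSum_of_bijective (Sum.elim
    (fun P => Piece.passOpening h (ha.trans_le hb) P)
    (fun P : _ × _ => Piece.split h ha hb P.1 P.2)) ⟨?_, ?_⟩).of_eq ?_
  · rintro (P | P) (P' | P') e <;> simp only [Sum.elim_inl, Sum.elim_inr] at e
    · cases e; rfl
    · cases e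
    · cases e
    · obtain ⟨P, Q⟩ := P
      obtain ⟨P', Q'⟩ := P'
      cases e; rfl
  · intro P
    cases P with
    | pass h' => exact absurd (h.unique h').1.symm opening_ne_cross
    | tip h' => exact absurd (h.unique h').1.symm opening_ne_cross
    | cap h' => exact absurd (h.unique h').1 opening_ne_closing
    | passClosing h' => exact absurd (h.unique h').1 opening_ne_closing
    | passOpening h' hab P =>
      obtain ⟨he, rfl⟩ := h.unique h'
      obtain rfl := opening_injective he
      exact ⟨Sum.inl P, rfl⟩
    | turnBelow h' => exact absurd (h.unique h').1 opening_ne_closing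
    | turnAbove h' => exact absurd (h.unique h').1 opening_ne_closing
    | split h' ha hb P Q =>
      obtain ⟨he, rfl⟩ := h.unique h'
      obtain rfl := opening_injective he
      exact ⟨Sum.inr (P, Q), rfl⟩
  · rw [Fintype.sum_sum_type, Finset.sum_mul_sum, ← Finset.univ_product_univ,
      Finset.sum_product]
    congr 1
    refine Finset.sum_congr rfl fun P _ => Finset.sum_congr rfl fun Q _ => ?_
    simp [Piece.word, Dir.prod_cat, mul_comm]

/-- The sum over the disks at a crossing whose overcrossing strand descends. -/
theorem diskSum_eq {R : Type*} [CommRing R] {f : S → R} {s : S} {p k : ℕ}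
    (hp : Γ[p]? = some (.cross k true s))
    (hu : ∀ p' k' c, Γ[p']? = some (.cross k' c s) → p' = p) {r r' : R}
    (H : PieceSum f Γ .east (p + 1) k (k + 1) r) (H' : PieceSum f Γ .west p k (k + 1) r')
    (ε : Alg Γ →+* R) (hf : ∀ s, f s = ε (gen Γ s)) (hs : ∃ k c, Event.cross k c s ∈ Γ) :
    ε (diskSum Γ ⟨s, hs⟩) = r + r' := by
  obtain ⟨hF, rfl⟩ := H
  obtain ⟨hF', rfl⟩ := H'
  -- As the overcrossing descends, the covered positive corner is the east or the west one; `hu`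
  -- fixes the place of the crossing.
  let g : Piece Γ .east (p + 1) k (k + 1) ⊕ Piece Γ .west p k (k + 1) → Disk Γ s :=
    Sum.elim (fun P => Disk.east hp P) (fun P => Disk.west hp P)
  have hg : Function.Bijective g := by
    constructor
    · rintro (P | P) (P' | P') e <;> simp only [g, Sum.elim_inl, Sum.elim_inr] at e
      · cases e; rfl
      · cases e
      · cases e
      · cases e; rfl
    · intro D
      cases D with
      | east h P =>
        obtain rfl := hu _ _ _ h
        have := hp.symm.trans h
        cases this
        exact ⟨Sum.inl P, rfl⟩
      | west h P =>
        obtain rfl := hu _ _ _ h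
        have := hp.symm.trans h
        cases this
        exact ⟨Sum.inr P, rfl⟩
      | north h =>
        obtain rfl := hu _ _ _ h
        have := hp.symm.trans h
        cases this
      | south h =>
        obtain rfl := hu _ _ _ h
        have := hp.symm.trans h
        cases this
  -- Finiteness is needed to evaluate the `finsum`, which would be zero by convention if infinitely
  -- many terms were non-zero.
  let _ := Fintype.ofBijective g hg
  have hw : ∀ w : List S, ε ((w.map (gen Γ)).prod) = (w.map f).prod := by
    intro w
    rw [map_list_prod, List.map_map]
    congr 1
    exact List.map_congr_left fun s _ => (hf s).symm
  unfold diskSum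
  rw [finsum_eq_sum_of_fintype, map_sum, ← Fintype.sum_bijective g hg
    (fun x => ((g x).word.map f).prod) _ fun x => (hw _).symm, Fintype.sum_sum_type]
  rfl

end Pieces

/-! ### Pieces of disks within a splash -/

section Splash

/-- The position of strand `l` on a vertical line on which the spike of strand `j` has the
position `i ≤ j`. -/
def spikePos (j i l : ℕ) : ℕ := if l = j then i else if l < i ∨ j < l then l else l + 1

/-- Each crossing of a splash moves the spike by one position past one strand. Thus `spikePos`
describes every slice of the splash, and passages become arithmetic of positions. -/
theorem swap_spikePos {i j : ℕ} (h : i < j) (l : ℕ) :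
    Equiv.swap i (i + 1) (spikePos j (i + 1) l) = spikePos j i l := by
  unfold spikePos; rw [Equiv.swap_apply_def]; split_ifs <;> omega

theorem swap_spikePos' {i j : ℕ} (h : i < j) (l : ℕ) :
    Equiv.swap i (i + 1) (spikePos j i l) = spikePos j (i + 1) l := by
  unfold spikePos; rw [Equiv.swap_apply_def]; split_ifs <;> omega

theorem spikePos_self (j l : ℕ) : spikePos j j l = l := by
  unfold spikePos; split_ifs <;> omega

/-- The splash on strand `j` in zone `m` starts at slice `p`. -/
structure HasSplash (Γ : List (Event Gen)) (m p j : ℕ) : Prop where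
  minus : ∀ i < j, Γ[p + (j - (i + 1))]? = some (.cross i true (.xm m i j))
  plus : ∀ i < j, Γ[p + j + i]? = some (.cross i false (.xp m i j))

variable {Γ : List (Event Gen)} {m p j : ℕ}

theorem HasSplash.westMinus (h : HasSplash Γ m p j) {i : ℕ} (hi : i < j) :
    Across Γ .west (p + (j - i)) (.cross i true (.xm m i j)) (p + (j - (i + 1))) :=
  ⟨h.minus i hi, by omega⟩

theorem HasSplash.eastMinus (h : HasSplash Γ m p j) {i : ℕ} (hi : i < j) :
    Across Γ .east (p + (j - (i + 1))) (.cross i true (.xm m i j)) (p + (j - i)) :=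
  ⟨h.minus i hi, by omega⟩

theorem HasSplash.westPlus (h : HasSplash Γ m p j) {i : ℕ} (hi : i < j) :
    Across Γ .west (p + j + (i + 1)) (.cross i false (.xp m i j)) (p + j + i) :=
  ⟨h.plus i hi, by omega⟩

theorem HasSplash.eastPlus (h : HasSplash Γ m p j) {i : ℕ} (hi : i < j) :
    Across Γ .east (p + j + i) (.cross i false (.xp m i j)) (p + j + (i + 1)) :=
  ⟨h.plus i hi, by omega⟩

variable {R : Type*} [CommSemiring R] {f : Gen → R} {r : R}

/-- The four `run` lemmas are forced passages over a part of one side of the spike, in one of the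
two directions. The conditions exclude, crossing by crossing, an inverted interval, the two corners,
and the pair of strands that meets there. On the `xp` side there are no corners to exclude. -/
theorem HasSplash.runWestMinus (h : HasSplash Γ m p j) {u v i₀ i₁ : ℕ} (h01 : i₀ ≤ i₁)
    (h1j : i₁ ≤ j)
    (hc : ∀ i, i₀ ≤ i → i < i₁ → spikePos j i u < spikePos j i v ∧ u ≠ i ∧ v ≠ j ∧
      ¬ (u = j ∧ v = i))
    (H : PieceSum f Γ .west (p + (j - i₁)) (spikePos j i₁ u) (spikePos j i₁ v) r) :
    PieceSum f Γ .west (p + (j - i₀)) (spikePos j i₀ u) (spikePos j i₀ v) r := by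
  induction i₁, h01 using Nat.le_induction with
  | base => exact H
  | succ i hi ih =>
    refine ih (by omega) (fun i' h1 h2 => hc i' h1 (by omega)) ?_
    obtain ⟨c1, c2, c3, c4⟩ := hc i hi (Nat.lt_succ_self i)
    refine pieceSum_straight (h.westMinus (by omega)) c1 ?_ (fun _ => ?_) (fun _ => ?_) ?_
    · unfold spikePos; split_ifs <;> omega
    · unfold spikePos; split_ifs <;> omega
    · unfold spikePos; split_ifs <;> omega
    · rwa [swap_spikePos' (by omega), swap_spikePos' (by omega)]

theorem HasSplash.runEastMinus (h : HasSplash Γ m p j) {u v i₀ i₁ : ℕ} (h01 : i₀ ≤ i₁)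
    (h1j : i₁ ≤ j)
    (hc : ∀ i, i₀ ≤ i → i < i₁ → spikePos j (i + 1) u < spikePos j (i + 1) v ∧ u ≠ j ∧ v ≠ i ∧
      ¬ (u = i ∧ v = j))
    (H : PieceSum f Γ .east (p + (j - i₀)) (spikePos j i₀ u) (spikePos j i₀ v) r) :
    PieceSum f Γ .east (p + (j - i₁)) (spikePos j i₁ u) (spikePos j i₁ v) r := by
  induction i₁, h01 using Nat.le_induction with
  | base => exact H
  | succ i hi ih =>
    have ih := ih (by omega) (fun i' h1 h2 => hc i' h1 (by omega))
    obtain ⟨c1, c2, c3, c4⟩ := hc i hi (Nat.lt_succ_self i)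
    refine pieceSum_straight (h.eastMinus (by omega)) c1 ?_ (fun _ => ?_) (fun _ => ?_) ?_
    · unfold spikePos; split_ifs <;> omega
    · unfold spikePos; split_ifs <;> omega
    · unfold spikePos; split_ifs <;> omega
    · rwa [swap_spikePos (by omega), swap_spikePos (by omega)]

theorem HasSplash.runWestPlus (h : HasSplash Γ m p j) {u v i₀ i₁ : ℕ} (h01 : i₀ ≤ i₁)
    (h1j : i₁ ≤ j)
    (hc : ∀ i, i₀ ≤ i → i < i₁ → spikePos j (i + 1) u < spikePos j (i + 1) v ∧ ¬ (u = i ∧ v = j))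
    (H : PieceSum f Γ .west (p + j + i₀) (spikePos j i₀ u) (spikePos j i₀ v) r) :
    PieceSum f Γ .west (p + j + i₁) (spikePos j i₁ u) (spikePos j i₁ v) r := by
  induction i₁, h01 using Nat.le_induction with
  | base => exact H
  | succ i hi ih =>
    have ih := ih (by omega) (fun i' h1 h2 => hc i' h1 (by omega))
    obtain ⟨c1, c2⟩ := hc i hi (Nat.lt_succ_self i)
    refine pieceSum_straight (h.westPlus (by omega)) c1 ?_ (by simp) (by simp) ?_
    · unfold spikePos; split_ifs <;> omega
    · rwa [swap_spikePos (by omega), swap_spikePos (by omega)]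

theorem HasSplash.runEastPlus (h : HasSplash Γ m p j) {u v i₀ i₁ : ℕ} (h01 : i₀ ≤ i₁)
    (h1j : i₁ ≤ j)
    (hc : ∀ i, i₀ ≤ i → i < i₁ → spikePos j i u < spikePos j i v ∧ ¬ (u = j ∧ v = i))
    (H : PieceSum f Γ .east (p + j + i₁) (spikePos j i₁ u) (spikePos j i₁ v) r) :
    PieceSum f Γ .east (p + j + i₀) (spikePos j i₀ u) (spikePos j i₀ v) r := by
  induction i₁, h01 using Nat.le_induction with
  | base => exact H
  | succ i hi ih =>
    refine ih (by omega) (fun i' h1 h2 => hc i' h1 (by omega)) ?_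
    obtain ⟨c1, c2⟩ := hc i hi (Nat.lt_succ_self i)
    refine pieceSum_straight (h.eastPlus (by omega)) c1 ?_ (by simp) (by simp) ?_
    · unfold spikePos; split_ifs <;> omega
    · rwa [swap_spikePos' (by omega), swap_spikePos' (by omega)]

/-! #### Going west -/

/-- Going west, the lower boundary climbs its own spike until it meets strand `u`; there the
interval shrinks to the negative corner of `xp m u j`. -/
theorem HasSplash.west_tip (h : HasSplash Γ m p j) {u : ℕ} (hu : u < j) :
    PieceSum f Γ .west (p + 2 * j) u j (f (.xp m u j)) := by
  have h1 : PieceSum f Γ .west (p + j + (u + 1)) (spikePos j (u + 1) u) (spikePos j (u + 1) j)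
      (f (.xp m u j)) := by
    have e1 : spikePos j (u + 1) u = u := by unfold spikePos; split_ifs <;> omega
    have e2 : spikePos j (u + 1) j = u + 1 := by simp [spikePos]
    rw [e1, e2]
    exact pieceSum_tip (h.westPlus hu)
  have h2 := h.runWestPlus (i₁ := j) hu le_rfl (fun i hi hij => by
    refine ⟨?_, by omega⟩
    unfold spikePos; split_ifs <;> omega) h1
  rw [spikePos_self, spikePos_self] at h2
  rwa [two_mul, ← add_assoc]

/-- The first half of the passage of a splash by an interval that is not bounded below by its
strand. -/
theorem HasSplash.west_half (h : HasSplash Γ m p j) {u v : ℕ} (huv : u < v) (hv : v ≠ j)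
    (hu : u ≠ j ∨ j < v)
    (H : PieceSum f Γ .west (p + (j - 0)) (spikePos j 0 u) (spikePos j 0 v) r) :
    PieceSum f Γ .west (p + 2 * j) u v r := by
  have h2 := h.runWestPlus (i₀ := 0) (i₁ := j) (Nat.zero_le _) le_rfl (fun i hi hij => by
    refine ⟨?_, by omega⟩
    unfold spikePos; split_ifs <;> omega) H
  rw [spikePos_self, spikePos_self] at h2
  rwa [two_mul, ← add_assoc]

/-- The spike stays above the interval or is its upper boundary, and on the way west the latter is
offered no negative corner. -/
theorem HasSplash.west_above (h : HasSplash Γ m p j) {u v : ℕ} (hu : j ≤ u) (huv : u < v)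
    (H : PieceSum f Γ .west p u v r) : PieceSum f Γ .west (p + 2 * j) u v r := by
  refine h.west_half huv (by omega) (by omega)
    (h.runWestMinus (i₁ := j) (Nat.zero_le _) le_rfl (fun i hi hij => ?_) ?_)
  · refine ⟨?_, by omega, by omega, by omega⟩
    unfold spikePos; split_ifs <;> omega
  · rw [spikePos_self, spikePos_self, Nat.sub_self, add_zero]
    exact H

/-- The upper boundary of the interval may have a corner where it meets the spike. -/
theorem HasSplash.west_corner (h : HasSplash Γ m p j) {u v : ℕ} (hu : u < j) (huv : u < v)
    (hv : v ≠ j) {r' : R} (H : PieceSum f Γ .west p u v r)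
    (H' : PieceSum f Γ .west (p + (j - (u + 1))) (u + 1) (spikePos j (u + 1) v) r') :
    PieceSum f Γ .west (p + 2 * j) u v (r + f (.xm m u j) * r') := by
  refine h.west_half huv hv (by omega)
    (h.runWestMinus (i₁ := u) (Nat.zero_le _) hu.le (fun i hi hij => ?_) ?_)
  · refine ⟨?_, by omega, by omega, by omega⟩
    unfold spikePos; split_ifs <;> omega
  · have e1 : spikePos j u u = u + 1 := by unfold spikePos; split_ifs <;> omega
    have e2 : spikePos j u v = spikePos j (u + 1) v := by unfold spikePos; split_ifs <;> omega
    rw [e1]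
    refine pieceSum_topCorner (h.westMinus hu) ?_ ?_ (by rw [e2]; exact H')
    · unfold spikePos; split_ifs <;> omega
    · have e3 : u = spikePos j (u + 1) u := by unfold spikePos; split_ifs <;> omega
      rw [e2]
      nth_rw 2 [e3]
      refine h.runWestMinus (i₁ := j) hu le_rfl (fun i hi hij => ?_) ?_
      · refine ⟨?_, by omega, by omega, by omega⟩
        unfold spikePos; split_ifs <;> omega
      · rw [spikePos_self, spikePos_self, Nat.sub_self, add_zero]
        exact H

/-- The upper boundary goes straight on, or it turns at `xm m u j` onto the spike and descends along
it to strand `j`. -/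
theorem HasSplash.west_inside (h : HasSplash Γ m p j) {u v : ℕ} (hu : u < j) (hv : j < v) {r' : R}
    (H : PieceSum f Γ .west p u v r) (H' : PieceSum f Γ .west p j v r') :
    PieceSum f Γ .west (p + 2 * j) u v (r + f (.xm m u j) * r') := by
  refine h.west_corner hu (by omega) (by omega) H ?_
  have e1 : u + 1 = spikePos j (u + 1) j := by simp [spikePos]
  nth_rw 2 [e1]
  refine h.runWestMinus (i₁ := j) hu le_rfl (fun i hi hij => ?_) ?_
  · refine ⟨?_, by omega, by omega, by omega⟩
    unfold spikePos; split_ifs <;> omega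
  · rw [spikePos_self, spikePos_self, Nat.sub_self, add_zero]
    exact H'

/-- Turning onto the spike is of no use: on the way down it meets the lower boundary `v` in a
positive corner. -/
theorem HasSplash.west_below (h : HasSplash Γ m p j) {u v : ℕ} (huv : u < v) (hv : v < j)
    (H : PieceSum f Γ .west p u v r) : PieceSum f Γ .west (p + 2 * j) u v r := by
  have := h.west_corner (f := f) (r' := 0) (huv.trans hv) huv hv.ne H ?_
  · simpa using this
  have e1 : u + 1 = spikePos j (u + 1) j := by simp [spikePos]
  nth_rw 2 [e1]
  refine h.runWestMinus (i₁ := v) huv hv.le (fun i hi hij => ?_) ?_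
  · refine ⟨?_, by omega, by omega, by omega⟩
    unfold spikePos; split_ifs <;> omega
  · have e1 : spikePos j v j = v := by simp [spikePos]
    have e2 : spikePos j v v = v + 1 := by unfold spikePos; split_ifs <;> omega
    rw [e1, e2]
    exact pieceSum_of_isEmpty (isEmpty_cross_pair (h.westMinus hv))

/-- The disks that leave the crossing `xm m i j` to the west. -/
theorem HasSplash.west_disk (h : HasSplash Γ m p j) {u : ℕ} (hu : u < j) {g : ℕ → R}
    (H : PieceSum f Γ .west p u j r)
    (Hg : ∀ l, u < l → l < j → PieceSum f Γ .west p u l (g l)) :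
    PieceSum f Γ .west (p + (j - (u + 1))) u (u + 1)
      (r + ∑ l ∈ Finset.Ioo u j, f (.xm m l j) * g l) := by
  -- On slice `p + (j - t)` the lower boundary is the spike at position `t`. It can leave the spike
  -- for any strand `l` between `u` and `j` by a corner at `xm m l j`; the interval between `u` and
  -- `l` then passes the rest of the splash unchanged.
  have key : ∀ n t, t + n = j → u < t →
      PieceSum f Γ .west (p + (j - t)) u t (r + ∑ l ∈ Finset.Ico t j, f (.xm m l j) * g l) := by
    intro n
    induction n with
    | zero =>
      intro t ht hut
      obtain rfl : t = j := ht
      simpa using H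
    | succ n ih =>
      intro t ht hut
      have h1 := ih (t + 1) (by omega) (by omega)
      have h2 : PieceSum f Γ .west (p + (j - (t + 1))) u t (g t) := by
        have e1 : spikePos j (t + 1) u = u := by unfold spikePos; split_ifs <;> omega
        have e2 : spikePos j (t + 1) t = t := by unfold spikePos; split_ifs <;> omega
        have := h.runWestMinus (f := f) (r := g t) (u := u) (v := t) (i₀ := t + 1) (i₁ := j)
          (by omega) le_rfl (fun i hi hij => ?_) ?_
        · rwa [e1, e2] at this
        · refine ⟨?_, by omega, by omega, by omega⟩
          unfold spikePos; split_ifs <;> omega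
        · rw [spikePos_self, spikePos_self, Nat.sub_self, add_zero]
          exact Hg t hut (by omega)
      refine (pieceSum_botCorner (h.westMinus (by omega)) hut h1 h2).of_eq ?_
      rw [Finset.sum_eq_sum_Ico_succ_bot (a := t) (b := j) (by omega)]
      ring
  have := key (j - (u + 1)) (u + 1) (by omega) (Nat.lt_succ_self u)
  have hI : Finset.Ico (u + 1) j = Finset.Ioo u j := by
    ext l; simp
  rwa [hI] at this

/-! #### Going east -/

theorem HasSplash.east_half (h : HasSplash Γ m p j) {u v : ℕ} (huv : u < v) (hv : v ≠ j)
    (H : PieceSum f Γ .east (p + 2 * j) u v r) :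
    PieceSum f Γ .east (p + (j - 0)) (spikePos j 0 u) (spikePos j 0 v) r := by
  refine h.runEastPlus (i₀ := 0) (i₁ := j) (Nat.zero_le _) le_rfl (fun i hi hij => ?_) ?_
  · refine ⟨?_, by omega⟩
    unfold spikePos; split_ifs <;> omega
  · rw [spikePos_self, spikePos_self]
    rwa [two_mul, ← add_assoc] at H

/-- An interval bounded below by the rising spike cannot go on. -/
theorem HasSplash.east_rise (h : HasSplash Γ m p j) {u i : ℕ} (hu : u < i) (hi : i ≤ j) :
    PieceSum f Γ .east (p + (j - i)) u i 0 := by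
  have e1 : u = spikePos j i u := by unfold spikePos; split_ifs <;> omega
  have e2 : i = spikePos j i j := by simp [spikePos]
  have key := h.runEastMinus (f := f) (r := 0) (u := u) (v := j) (i₀ := u + 1) (i₁ := i) hu hi
    (fun t hut hti => ?_) ?_
  · rwa [← e1, ← e2] at key
  · refine ⟨?_, by omega, by omega, by omega⟩
    unfold spikePos; split_ifs <;> omega
  · have e1 : spikePos j (u + 1) u = u := by unfold spikePos; split_ifs <;> omega
    have e2 : spikePos j (u + 1) j = u + 1 := by simp [spikePos]
    rw [e1, e2]
    exact pieceSum_of_isEmpty (isEmpty_cross_pair (h.eastMinus (by omega)))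

/-- An interval bounded above by the spike, which starts at the slice on which the spike has the
position `i`. -/
theorem HasSplash.east_top (h : HasSplash Γ m p j) {v i : ℕ} (hi : i ≤ j) (hv : v ≠ j)
    (hiv : i ≤ v) (H : ∀ u < i, PieceSum f Γ .east (p + 2 * j) u v 0)
    (H0 : PieceSum f Γ .east (p + (j - 0)) 0 (spikePos j 0 v) r) :
    PieceSum f Γ .east (p + (j - i)) i (spikePos j i v) r := by
  induction i with
  | zero => exact H0
  | succ i ih =>
    have ih := ih (by omega) (by omega) (fun u hu => H u (by omega))
    have e1 : spikePos j (i + 1) v = spikePos j i v := by unfold spikePos; split_ifs <;> omega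
    rw [e1]
    -- The branch with a corner: the upper boundary leaves the spike for strand `i`, and the
    -- interval then passes the rest of the splash to a place without pieces.
    have h1 : PieceSum f Γ .east (p + (j - i)) (i + 1) (spikePos j i v) 0 := by
      have e2 : i + 1 = spikePos j i i := by unfold spikePos; split_ifs <;> omega
      rw [e2]
      refine h.runEastMinus (i₀ := 0) (Nat.zero_le _) (by omega) (fun t hut hti => ?_)
        (h.east_half (by omega) hv (H i (by omega)))
      refine ⟨?_, by omega, by omega, by omega⟩
      unfold spikePos; split_ifs <;> omega
    refine (pieceSum_topCorner (h.eastMinus (by omega)) ?_ ih h1).of_eq (by simp)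
    unfold spikePos; split_ifs <;> omega

/-- The disks that leave the crossing `xm m i j` to the east. -/
theorem HasSplash.east_disk (h : HasSplash Γ m p j) {v : ℕ} (hv : v < j)
    (H : ∀ u < v, PieceSum f Γ .east (p + 2 * j) u v 0) :
    PieceSum f Γ .east (p + (j - v)) v (v + 1) (f (.xp m v j)) := by
  have e1 : v + 1 = spikePos j v v := by unfold spikePos; split_ifs <;> omega
  rw [e1]
  refine h.east_top hv.le hv.ne le_rfl H ?_
  have e2 : 0 = spikePos j 0 j := by simp [spikePos]
  nth_rw 2 [e2]
  refine h.runEastPlus (i₁ := v) (Nat.zero_le _) hv.le (fun i hi hij => ?_) ?_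
  · refine ⟨?_, by omega⟩
    unfold spikePos; split_ifs <;> omega
  · rw [← e1]
    have e2 : spikePos j v j = v := by simp [spikePos]
    rw [e2]
    exact pieceSum_tip (h.eastPlus hv)

/-- If there are no pieces behind the splash, then there are none in front of it. -/
theorem HasSplash.east_zero (h : HasSplash Γ m p j) {u v : ℕ} (huv : u < v)
    (H : v ≠ j → ∀ l ≤ u, PieceSum f Γ .east (p + 2 * j) l v 0) :
    PieceSum f Γ .east p u v 0 := by
  have hp : p = p + (j - j) := by omega
  by_cases hvj : v = j
  · subst hvj
    rw [hp]
    exact h.east_rise huv le_rfl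
  have H := H hvj
  by_cases huj : u = j
  · subst huj
    have := h.east_top (f := f) (r := 0) le_rfl hvj huv.le (fun l hl => H l hl.le) ?_
    · rwa [spikePos_self, Nat.sub_self, add_zero] at this
    · have e1 : spikePos u 0 u = 0 := by simp [spikePos]
      have := h.east_half huv hvj (H u le_rfl)
      rwa [e1] at this
  have h0 := h.east_half huv hvj (H u le_rfl)
  rw [hp, ← spikePos_self j u, ← spikePos_self j v]
  by_cases hlt : v < j
  · refine h.runEastMinus (i₀ := v + 1) hlt le_rfl (fun i hi hij => ?_) ?_
    · refine ⟨?_, by omega, by omega, by omega⟩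
      unfold spikePos; split_ifs <;> omega
    · have e1 : spikePos j (v + 1) u = u := by unfold spikePos; split_ifs <;> omega
      have e2 : spikePos j (v + 1) v = v := by unfold spikePos; split_ifs <;> omega
      rw [e1, e2]
      -- Here the lower boundary meets the spike. Turning onto it is a dead end by `east_rise`, and
      -- the straight branch vanishes by `h0`.
      refine (pieceSum_botCorner (r := 0) (h.eastMinus hlt) huv ?_
        (h.east_rise huv hlt.le)).of_eq (by simp)
      · have e1 : u = spikePos j v u := by unfold spikePos; split_ifs <;> omega
        have e2 : v + 1 = spikePos j v v := by unfold spikePos; split_ifs <;> omega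
        rw [e1, e2]
        refine h.runEastMinus (i₀ := 0) (Nat.zero_le _) hlt.le (fun i hi hij => ?_) h0
        refine ⟨?_, by omega, by omega, by omega⟩
        unfold spikePos; split_ifs <;> omega
  · refine h.runEastMinus (i₀ := 0) (Nat.zero_le _) le_rfl (fun i hi hij => ?_) h0
    refine ⟨?_, by omega, by omega, by omega⟩
    unfold spikePos; split_ifs <;> omega

/-- With all labels sent to `1 : ℕ` the sum counts the pieces; for this use the values of `PieceSum`
may lie in a semiring. -/
theorem isEmpty_of_pieceSum {S : Type} {Γ : List (Event S)} {σ : Dir} {q a b : ℕ}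
    (h : PieceSum (fun _ => (1 : ℕ)) Γ σ q a b 0) : IsEmpty (Piece Γ σ q a b) := by
  obtain ⟨hF, h⟩ := h
  rw [← Fintype.card_eq_zero_iff]
  simpa using h

end Splash

/-! ### The splashed diagram -/

/-! ### The number of points on a slice -/

section Width

variable {S : Type}

/-- The number of points on the slice behind an event, given their number before it (`none`, if the
event does not fit). -/
def Event.next (n : ℕ) : Event S → Option ℕ
  | .left k => if k ≤ n then some (n + 2) else none
  | .right k => if k + 1 < n then some (n - 2) else none
  | .cross k _ _ => if k + 1 < n then some n else none

/-- The number of points on the slice behind a list of events. -/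
def sliceWidth (n : ℕ) (l : List (Event S)) : Option ℕ := l.foldlM Event.next n

theorem width_append (n : ℕ) (l l' : List (Event S)) :
    sliceWidth n (l ++ l') = (sliceWidth n l).bind fun n' => sliceWidth n' l' := by
  simp only [sliceWidth, List.foldlM_append]
  rfl

theorem width_singleton (n : ℕ) (e : Event S) : sliceWidth n [e] = e.next n := by
  simp [sliceWidth]

theorem width_cross {n : ℕ} {l : List (Event S)}
    (h : ∀ e ∈ l, ∃ k c s, e = .cross k c s ∧ k + 1 < n) : sliceWidth n l = some n := by
  induction l with
  | nil => rfl
  | cons e l ih =>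
    obtain ⟨k, c, s, rfl, hk⟩ := h e (by simp)
    rw [← List.singleton_append, width_append, width_singleton, Event.next, if_pos hk]
    exact ih fun e he => h e (by simp [he])

variable {Γ : List (Event S)}

/-- If the whole list fits, then every prefix has a width, so widths can be compared across an event
in both directions. -/
theorem Across.next_width {σ : Dir} {q q' n : ℕ} {e : Event S} (hΓ : (sliceWidth 0 Γ).isSome)
    (h : Across Γ σ q e q') (hn : sliceWidth 0 (Γ.take q) = some n) :
    ∃ n', sliceWidth 0 (Γ.take q') = some n' ∧
      match σ with
      | .east => e.next n = some n'
      | .west => e.next n' = some n := by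
  have hsome : ∀ r, ∃ n', sliceWidth 0 (Γ.take r) = some n' := by
    intro r
    rw [← List.take_append_drop r Γ, width_append] at hΓ
    cases hr : sliceWidth 0 (Γ.take r) with
    | none => rw [hr] at hΓ; simp at hΓ
    | some n' => exact ⟨n', rfl⟩
  have hstep : ∀ r, Γ[r]? = some e → sliceWidth 0 (Γ.take (r + 1)) =
      (sliceWidth 0 (Γ.take r)).bind e.next := by
    intro r hr
    rw [List.take_add_one, hr, width_append]
    congr 1
    funext n'
    exact width_singleton _ _
  obtain ⟨n', hn'⟩ := hsome q'
  refine ⟨n', hn', ?_⟩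
  cases σ with
  | east =>
    obtain ⟨h1, rfl⟩ := h
    have := hstep q h1
    rw [hn', hn] at this
    exact this.symm
  | west =>
    obtain ⟨h1, rfl⟩ := h
    have := hstep q' h1
    rw [hn', hn] at this
    exact this.symm

theorem Across.width_cross {σ : Dir} {q q' n k : ℕ} {c : Bool} {s : S} (hΓ : (sliceWidth 0 Γ).isSome)
    (h : Across Γ σ q (.cross k c s) q') (hn : sliceWidth 0 (Γ.take q) = some n) :
    sliceWidth 0 (Γ.take q') = some n ∧ k + 1 < n := by
  obtain ⟨n', hn', h⟩ := h.next_width hΓ hn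
  cases σ <;> simp only [Event.next, Option.ite_none_right_eq_some, Option.some.injEq] at h <;>
    obtain ⟨h1, rfl⟩ := h <;> exact ⟨hn', h1⟩

theorem Across.width_closing {σ : Dir} {q q' n k : ℕ} (hΓ : (sliceWidth 0 Γ).isSome)
    (h : Across Γ σ q (closing S σ k) q') (hn : sliceWidth 0 (Γ.take q) = some n) :
    ∃ n', sliceWidth 0 (Γ.take q') = some n' ∧ n = n' + 2 ∧ k ≤ n' := by
  obtain ⟨n', hn', h⟩ := h.next_width hΓ hn
  cases σ <;>
    simp only [closing, Event.next, Option.ite_none_right_eq_some, Option.some.injEq] at h <;>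
    exact ⟨n', hn', by omega, by omega⟩

theorem Across.width_opening {σ : Dir} {q q' n k : ℕ} (hΓ : (sliceWidth 0 Γ).isSome)
    (h : Across Γ σ q (opening S σ k) q') (hn : sliceWidth 0 (Γ.take q) = some n) :
    sliceWidth 0 (Γ.take q') = some (n + 2) ∧ k ≤ n := by
  obtain ⟨n', hn', h⟩ := h.next_width hΓ hn
  cases σ <;>
    simp only [opening, Dir.opp, closing, Event.next, Option.ite_none_right_eq_some,
      Option.some.injEq] at h
  · obtain ⟨h1, h2⟩ := h
    have : n' = n + 2 := by omega
    exact ⟨this ▸ hn', by omega⟩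
  · obtain ⟨h1, rfl⟩ := h
    exact ⟨hn', h1⟩

/-- The ends of a piece exist. -/
theorem Piece.lt_width (hΓ : (sliceWidth 0 Γ).isSome) {σ : Dir} {q a b : ℕ} (P : Piece Γ σ q a b) :
    ∀ n, sliceWidth 0 (Γ.take q) = some n → b < n := by
  induction P with
  | @pass _ _ _ _ _ _ _ k c s h hab t u P ih =>
    intro n hn
    obtain ⟨h1, h2⟩ := h.width_cross hΓ hn
    have h3 := ih n h1
    cases u with
    | corner _ h4 => omega
    | straight h4 =>
      rw [Equiv.swap_apply_def] at h4
      split_ifs at h4 <;> omega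
  | tip h ha hb =>
    intro n hn
    obtain ⟨h1, h2⟩ := h.width_cross hΓ hn
    omega
  | cap h ha hb =>
    intro n hn
    obtain ⟨n', h1, h2, h3⟩ := h.width_closing hΓ hn
    omega
  | passClosing h hab ha hb P ih =>
    intro n hn
    obtain ⟨n', h1, h2, h3⟩ := h.width_closing hΓ hn
    have := ih n' h1
    rw [hb, h2]; exact skip_lt this
  | passOpening h hab P ih =>
    intro n hn
    obtain ⟨h1, h2⟩ := h.width_opening hΓ hn
    have h3 := ih _ h1
    unfold skip at h3
    split_ifs at h3 <;> omega
  | turnBelow h ha hb hb' Q P ihQ ihP =>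
    intro n hn
    obtain ⟨n', h1, h2, h3⟩ := h.width_closing hΓ hn
    omega
  | turnAbove h ha hb hb' ha' Q P ihQ ihP =>
    intro n hn
    obtain ⟨n', h1, h2, h3⟩ := h.width_closing hΓ hn
    have := ihP n' h1
    omega
  | split h ha hb P Q ihP ihQ =>
    intro n hn
    obtain ⟨h1, h2⟩ := h.width_opening hΓ hn
    have := ihQ _ h1
    omega

end Width

/-! ### Uniqueness of the labels of crossings -/

section Labels

variable {S : Type}

/-- The events are not crossings with the same label. -/
def DistinctLabels (e e' : Event S) : Prop :=
  ∀ k c s k' c', e = .cross k c s → e' = .cross k' c' s → False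

/-- Needed because a `Disk` refers to its initial crossing by the label only. -/
theorem index_unique {Γ : List (Event S)} (h : Γ.Pairwise DistinctLabels) {p p' k k' : ℕ}
    {c c' : Bool} {s : S} (hp : Γ[p]? = some (.cross k c s)) (hp' : Γ[p']? = some (.cross k' c' s)) :
    p' = p := by
  rw [List.getElem?_eq_some_iff] at hp hp'
  obtain ⟨h1, h2⟩ := hp
  obtain ⟨h3, h4⟩ := hp'
  rw [List.pairwise_iff_getElem] at h
  rcases lt_trichotomy p p' with hl | hl | hl
  · exact (h p p' h1 h3 hl _ _ _ _ _ h2 h4).elim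
  · exact hl.symm
  · exact (h p' p h3 h1 hl _ _ _ _ _ h4 h2).elim

theorem mem_splash {m j : ℕ} {e : Event Gen} :
    e ∈ splash m j ↔ ∃ i < j, e = .cross i true (.xm m i j) ∨ e = .cross i false (.xp m i j) := by
  simp only [splash, List.mem_append, List.mem_map, List.mem_reverse, List.mem_range]
  constructor
  · rintro (⟨i, hi, rfl⟩ | ⟨i, hi, rfl⟩)
    · exact ⟨i, hi, Or.inl rfl⟩
    · exact ⟨i, hi, Or.inr rfl⟩
  · rintro ⟨i, hi, rfl | rfl⟩
    · exact Or.inl ⟨i, hi, rfl⟩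
    · exact Or.inr ⟨i, hi, rfl⟩

theorem mem_splashes {m n : ℕ} {e : Event Gen} :
    e ∈ splashes m n ↔ ∃ j < n, ∃ i < j,
      e = .cross i true (.xm m i j) ∨ e = .cross i false (.xp m i j) := by
  simp only [splashes, List.mem_flatMap, List.mem_range, mem_splash]

theorem pairwise_splash (m j : ℕ) : (splash m j).Pairwise DistinctLabels := by
  rw [splash, List.pairwise_append]
  refine ⟨?_, ?_, ?_⟩
  · rw [List.pairwise_map, List.pairwise_reverse]
    refine List.pairwise_lt_range.imp fun hab => ?_
    rintro k c s k' c' h h'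
    cases h; cases h'
    exact hab.ne rfl
  · rw [List.pairwise_map]
    refine List.pairwise_lt_range.imp fun hab => ?_
    rintro k c s k' c' h h'
    cases h; cases h'
    exact hab.ne rfl
  · simp only [List.mem_map]
    rintro _ ⟨i, -, rfl⟩ _ ⟨i', -, rfl⟩ k c s k' c' h h'
    cases h; cases h'

theorem pairwise_splashes (m n : ℕ) : (splashes m n).Pairwise DistinctLabels := by
  rw [splashes, List.pairwise_flatMap]
  refine ⟨fun j _ => pairwise_splash m j, List.pairwise_lt_range.imp fun hab => ?_⟩
  rintro e he e' he' k c s k' c' rfl rfl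
  rw [mem_splash] at he he'
  obtain ⟨i, hi, he | he⟩ := he <;> obtain ⟨i', hi', he' | he'⟩ := he' <;> cases he <;> cases he' <;>
    exact hab.ne rfl

/-- The number of the insert with which a label appears. -/
def Gen.insertIndex : Gen → ℕ
  | .xm m _ _ => m - 1
  | .xp m _ _ => m - 1
  | .y q _ => q
  | .z q => q

/-- The part of the splashed diagram which consists of insert `q` and the splashes behind it. -/
def block (F : List FrontInsert) (x : FrontInsert × ℕ) : List (Event Gen) :=
  resolve x.2 x.1 ++ splashes (x.2 + 1) (strands F (x.2 + 1))

variable {F : List FrontInsert}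

theorem splashed_eq (F : List FrontInsert) : splashed F = F.zipIdx.flatMap (block F) := rfl

theorem block_mk (F : List FrontInsert) (e : FrontInsert) (q : ℕ) :
    block F (e, q) = resolve q e ++ splashes (q + 1) (strands F (q + 1)) := rfl

theorem insertIndex_of_mem_block {x : FrontInsert × ℕ} {k : ℕ} {c : Bool} {s : Gen}
    (h : .cross k c s ∈ block F x) : s.insertIndex = x.2 := by
  rw [block, List.mem_append, mem_splashes] at h
  rcases h with h | ⟨j, -, i, -, h | h⟩
  · obtain ⟨e, q⟩ := x
    cases e <;> simp [resolve] at h <;> rw [h.2.2] <;> rfl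
  · cases h; rfl
  · cases h; rfl

theorem pairwise_block (x : FrontInsert × ℕ) : (block F x).Pairwise DistinctLabels := by
  rw [block, List.pairwise_append]
  refine ⟨?_, pairwise_splashes _ _, ?_⟩
  · obtain ⟨e, q⟩ := x
    cases e <;> simp [resolve, DistinctLabels]
  · rintro e he e' he' k c s k' c' rfl rfl
    rw [mem_splashes] at he'
    obtain ⟨e, q⟩ := x
    obtain ⟨j, -, i, -, h' | h'⟩ := he' <;> cases h' <;> cases e <;> simp [resolve] at he

theorem pairwise_splashed (F : List FrontInsert) : (splashed F).Pairwise DistinctLabels := by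
  rw [splashed_eq, List.pairwise_flatMap]
  refine ⟨fun x _ => pairwise_block x, ?_⟩
  have : F.zipIdx.Pairwise fun x y => x.2 < y.2 := by
    rw [List.pairwise_iff_getElem]
    intro i j hi hj hij
    simpa using hij
  refine this.imp fun hxy => ?_
  rintro e he e' he' k c s k' c' rfl rfl
  have h1 := insertIndex_of_mem_block he
  have h2 := insertIndex_of_mem_block he'
  omega

theorem lt_of_xp_mem {m i j k : ℕ} {c : Bool} (h : .cross k c (.xp m i j) ∈ splashed F) : i < j := by
  rw [splashed_eq, List.mem_flatMap] at h
  obtain ⟨⟨e, q⟩, -, h⟩ := h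
  rw [block, List.mem_append, mem_splashes] at h
  rcases h with h | ⟨j, -, i, hi, h | h⟩
  · cases e <;> simp [resolve] at h
  · cases h
  · cases h; exact hi

end Labels

/-! ### The place of inserts and splashes in the list of events -/

section Position

variable {F : List FrontInsert}

/-- The part of the splashed diagram before insert number `q`. -/
def beforeInsert (F : List FrontInsert) (q : ℕ) : List (Event Gen) :=
  (F.zipIdx.take q).flatMap (block F)

/-- The slice before insert number `q`. -/
def insertPos (F : List FrontInsert) (q : ℕ) : ℕ := (beforeInsert F q).length

theorem beforeInsert_succ {q : ℕ} {e : FrontInsert} (h : F[q]? = some e) :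
    beforeInsert F (q + 1) = beforeInsert F q ++ block F (e, q) := by
  unfold beforeInsert
  rw [List.take_add_one, List.flatMap_append, List.getElem?_zipIdx, h]
  simp

theorem splashed_decomp {q : ℕ} {e : FrontInsert} (h : F[q]? = some e) :
    ∃ C, splashed F = beforeInsert F q ++ (block F (e, q) ++ C) := by
  refine ⟨(F.zipIdx.drop (q + 1)).flatMap (block F), ?_⟩
  rw [← List.append_assoc, ← beforeInsert_succ h, beforeInsert, ← List.flatMap_append,
    List.take_append_drop, splashed_eq]

theorem beforeInsert_length (F : List FrontInsert) : beforeInsert F F.length = splashed F := by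
  unfold beforeInsert
  rw [List.take_of_length_le (by simp), splashed_eq]

/-- The slice before the splashes behind insert number `q`. -/
def zonePos (F : List FrontInsert) (q : ℕ) (e : FrontInsert) : ℕ :=
  insertPos F q + (resolve q e).length

theorem getElem?_resolve {q : ℕ} {e : FrontInsert} (h : F[q]? = some e) {i : ℕ} {x : Event Gen}
    (hx : (resolve q e)[i]? = some x) : (splashed F)[insertPos F q + i]? = some x := by
  obtain ⟨C, hC⟩ := splashed_decomp h
  rw [hC, insertPos, List.getElem?_append_right (by omega), Nat.add_sub_cancel_left, block_mk,
    List.append_assoc]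
  have := (List.getElem?_eq_some_iff.1 hx).1
  rw [List.getElem?_append_left (by simpa using this)]
  exact hx

theorem getElem?_splashes {q : ℕ} {e : FrontInsert} (h : F[q]? = some e) {i : ℕ} {x : Event Gen}
    (hx : (splashes (q + 1) (strands F (q + 1)))[i]? = some x) :
    (splashed F)[zonePos F q e + i]? = some x := by
  obtain ⟨C, hC⟩ := splashed_decomp h
  rw [hC, zonePos, insertPos, List.getElem?_append_right (by omega), block_mk, List.append_assoc,
    List.getElem?_append_right (by omega)]
  have := (List.getElem?_eq_some_iff.1 hx).1
  rw [List.getElem?_append_left (by omega)]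
  rw [← hx]
  congr 1
  omega

/-- The number of events in the first `j` splashes of a zone. -/
def splashPos : ℕ → ℕ
  | 0 => 0
  | j + 1 => splashPos j + 2 * j

theorem length_splash (m j : ℕ) : (splash m j).length = 2 * j := by
  simp [splash]; omega

theorem splashes_succ (m n : ℕ) : splashes m (n + 1) = splashes m n ++ splash m n := by
  simp [splashes, List.range_succ]

theorem length_splashes (m n : ℕ) : (splashes m n).length = splashPos n := by
  induction n with
  | zero => rfl
  | succ n ih => rw [splashes_succ, List.length_append, ih, length_splash, splashPos]

theorem getElem?_splash {m n j : ℕ} (hj : j < n) {i : ℕ} {x : Event Gen}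
    (hx : (splash m j)[i]? = some x) : (splashes m n)[splashPos j + i]? = some x := by
  induction n with
  | zero => omega
  | succ n ih =>
    rw [splashes_succ]
    rcases Nat.lt_succ_iff_lt_or_eq.1 hj with h | rfl
    · have := ih h
      rw [List.getElem?_append_left (List.getElem?_eq_some_iff.1 this).1]
      exact this
    · rw [List.getElem?_append_right (by rw [length_splashes]; omega), length_splashes,
        Nat.add_sub_cancel_left]
      exact hx

theorem hasSplash {q : ℕ} {e : FrontInsert} (h : F[q]? = some e) {j : ℕ}
    (hj : j < strands F (q + 1)) :
    HasSplash (splashed F) (q + 1) (zonePos F q e + splashPos j) j := by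
  constructor
  · intro i hi
    rw [add_assoc]
    refine getElem?_splashes h (getElem?_splash hj ?_)
    rw [splash, List.getElem?_append_left (by simp; omega), List.getElem?_map,
      List.getElem?_reverse (by simp; omega)]
    have : (List.range j).length - 1 - (j - (i + 1)) = i := by simp; omega
    rw [this, List.getElem?_range hi]
    rfl
  · intro i hi
    rw [add_assoc, add_assoc]
    refine getElem?_splashes h (getElem?_splash hj ?_)
    rw [splash, List.getElem?_append_right (by simp), List.getElem?_map]
    have : j + i - (List.map (fun i => Event.cross i true (Gen.xm (q + 1) i j))
        (List.range j).reverse).length = i := by simp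
    rw [this, List.getElem?_range hi]
    rfl

theorem insertPos_succ {q : ℕ} {e : FrontInsert} (h : F[q]? = some e) :
    insertPos F (q + 1) = zonePos F q e + splashPos (strands F (q + 1)) := by
  rw [insertPos, beforeInsert_succ h, List.length_append, block_mk, List.length_append,
    length_splashes, zonePos, insertPos, add_assoc]

theorem strands_succ {q : ℕ} {e : FrontInsert} (h : F[q]? = some e) :
    strands F (q + 1) = e.next (strands F q) := by
  rw [strands, List.take_add_one, h]
  simp [strands]

theorem strands_of_length_le {m : ℕ} (h : F.length ≤ m) : strands F m = strands F F.length := by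
  rw [strands, strands, List.take_of_length_le h, List.take_length]

theorem width_resolve {q n : ℕ} {e : FrontInsert} (h : e.Fits n) :
    sliceWidth n (resolve q e) = some (e.next n) := by
  cases e with
  | leftCusp k =>
    have h : k ≤ n := h
    rw [resolve, width_singleton, Event.next, if_pos h]; rfl
  | rightCusp k =>
    have h : k + 1 < n := h
    rw [resolve, ← List.singleton_append, width_append, width_singleton, Event.next, if_pos h,
      Option.bind_some, width_singleton, Event.next, if_pos h]
    rfl
  | cross k =>
    have h : k + 1 < n := h
    rw [resolve, width_singleton, Event.next, if_pos h]; rfl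
  | parallel => rfl

theorem width_splashes (m n : ℕ) : sliceWidth n (splashes m n) = some n := by
  apply width_cross
  intro e he
  rw [mem_splashes] at he
  obtain ⟨j, hj, i, hi, rfl | rfl⟩ := he
  · exact ⟨i, _, _, rfl, by omega⟩
  · exact ⟨i, _, _, rfl, by omega⟩

theorem width_beforeInsert (hF : IsFront F) {q : ℕ} (hq : q ≤ F.length) :
    sliceWidth 0 (beforeInsert F q) = some (strands F q) := by
  induction q with
  | zero => rfl
  | succ q ih =>
    have h : F[q]? = some F[q] := List.getElem?_eq_getElem (by omega)
    rw [beforeInsert_succ h, width_append, ih (by omega), Option.bind_some, block_mk, width_append,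
      width_resolve (hF.1 _ _ h), Option.bind_some, ← strands_succ h]
    exact width_splashes _ _

theorem width_splashed (hF : IsFront F) : (sliceWidth 0 (splashed F)).isSome := by
  rw [← beforeInsert_length, width_beforeInsert hF le_rfl]; rfl

theorem width_zonePos (hF : IsFront F) {q : ℕ} {e : FrontInsert} (h : F[q]? = some e) :
    sliceWidth 0 ((splashed F).take (zonePos F q e)) = some (strands F (q + 1)) := by
  obtain ⟨C, hC⟩ := splashed_decomp h
  have : (splashed F).take (zonePos F q e) = beforeInsert F q ++ resolve q e := by
    rw [hC, block_mk, List.append_assoc, ← List.append_assoc, List.take_append_of_le_length,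
      List.take_of_length_le]
    · simp [zonePos, insertPos]
    · simp [zonePos, insertPos]
  have hq : q < F.length := (List.getElem?_eq_some_iff.1 h).1
  rw [this, width_append, width_beforeInsert hF hq.le, Option.bind_some,
    width_resolve (hF.1 _ _ h), ← strands_succ h]

end Position

/-! ### Pieces in the splashed diagram -/

section Zone

variable {F : List FrontInsert} {q : ℕ} {e : FrontInsert}

theorem zonePos_add_splashPos_succ (j : ℕ) :
    zonePos F q e + splashPos (j + 1) = zonePos F q e + splashPos j + 2 * j := by
  rw [splashPos, add_assoc]

/-- There are no pieces to the east of the left end of a zone. -/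
theorem isEmpty_zonePos (hF : IsFront F) (h : F[q]? = some e) (a b : ℕ) :
    IsEmpty (Piece (splashed F) .east (zonePos F q e) a b) := by
  by_cases hb : b < strands F (q + 1)
  swap
  · exact ⟨fun P => hb (P.lt_width (width_splashed hF) _ (width_zonePos hF h))⟩
  rcases Nat.lt_or_ge a b with hab | hab
  swap
  · exact isEmpty_piece_of_le hab
  -- Backward induction from the splash of strand `b`, where the lower boundary climbs its own spike
  -- and gets stuck. The splashes of the strands above `b` can change the upper boundary only.
  have key : ∀ r j, j + r = b → ∀ l < b, PieceSum (fun _ => (1 : ℕ)) (splashed F) .east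
      (zonePos F q e + splashPos j) l b 0 := by
    intro r
    induction r with
    | zero =>
      intro j hj l hl
      exact (hasSplash h (by omega)).east_zero hl fun hne => absurd hj.symm hne
    | succ r ih =>
      intro j hj l hl
      refine (hasSplash h (by omega)).east_zero hl fun _ l' hl' => ?_
      rw [← zonePos_add_splashPos_succ]
      exact ih (j + 1) (by omega) l' (by omega)
  exact isEmpty_of_pieceSum (key b 0 (by omega) a hab)

theorem getElem?_rightCusp {k : ℕ} (h : F[q]? = some (.rightCusp k)) :
    (splashed F)[insertPos F q]? = some (.cross k true (.z q)) ∧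
      (splashed F)[insertPos F q + 1]? = some (.right k) :=
  ⟨getElem?_resolve h (i := 0) rfl, getElem?_resolve h (i := 1) rfl⟩

theorem getElem?_leftCusp {k : ℕ} (h : F[q]? = some (.leftCusp k)) :
    (splashed F)[insertPos F q]? = some (.left k) :=
  getElem?_resolve h (i := 0) rfl

theorem getElem?_cross {k : ℕ} (h : F[q]? = some (.cross k)) :
    (splashed F)[insertPos F q]? = some (.cross k true (.y q k)) :=
  getElem?_resolve h (i := 0) rfl

/-- There are no pieces to the east of the right end of a zone. -/
theorem isEmpty_insertPos (hF : IsFront F) (hq : q ≤ F.length) (a b : ℕ) :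
    IsEmpty (Piece (splashed F) .east (insertPos F q) a b) := by
  rcases Nat.lt_or_eq_of_le hq with hlt | rfl
  swap
  · apply isEmpty_end
    rw [insertPos, beforeInsert_length]
    exact List.getElem?_eq_none le_rfl
  obtain ⟨e, h⟩ : ∃ e, F[q]? = some e := ⟨_, List.getElem?_eq_getElem hlt⟩
  have hz := isEmpty_zonePos hF h
  cases e with
  | leftCusp k => exact isEmpty_opening (σ := .east) ⟨getElem?_leftCusp h, rfl⟩ hz
  | rightCusp k =>
    obtain ⟨h1, h2⟩ := getElem?_rightCusp h
    -- The only end could be the cap at the rounding, but the pair `k, k + 1` behind the crossing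
    -- `z` would come from an inverted interval in front of it.
    refine isEmpty_cross (σ := .east) ⟨h1, rfl⟩ (Or.inl rfl) fun a' b' t u hab => ?_
    refine isEmpty_closing (σ := .east) ⟨h2, rfl⟩ ?_ hz
    rintro ⟨rfl, rfl⟩
    cases t with
    | corner _ _ h => omega
    | straight h3 =>
      cases u with
      | corner _ _ h => omega
      | straight h4 =>
        rw [Equiv.swap_apply_def] at h3 h4
        split_ifs at h3 h4 <;> omega
  | cross k =>
    exact isEmpty_cross (σ := .east) ⟨getElem?_cross h, rfl⟩ (Or.inl rfl) fun a' b' _ _ _ => hz _ _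
  | parallel => exact hz a b

variable {R : Type*} [CommSemiring R] {f : Gen → R}

/-- No piece leaves the zone to the east, and `east_zero` carries this back over the remaining
splashes. -/
theorem pieceSum_east_splash (hF : IsFront F) (h : F[q]? = some e) {j : ℕ}
    (hj : j ≤ strands F (q + 1)) {u v : ℕ} (huv : u < v) :
    PieceSum f (splashed F) .east (zonePos F q e + splashPos j) u v 0 := by
  have hq : q < F.length := (List.getElem?_eq_some_iff.1 h).1
  obtain ⟨r, hr⟩ := Nat.exists_eq_add_of_le hj
  induction r generalizing j u with
  | zero =>
    rw [show j = strands F (q + 1) by omega, ← insertPos_succ h]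
    exact pieceSum_of_isEmpty (isEmpty_insertPos hF hq _ _)
  | succ r ih =>
    refine (hasSplash h (by omega)).east_zero huv fun _ l hl => ?_
    rw [← zonePos_add_splashPos_succ]
    exact ih (by omega) (by omega) (by omega)

/-- The pieces to the west of slices between the splashes of a zone, bounded by strands whose
lower one has no splash to the west of the slice. -/
theorem pieceSum_west_splash (h : F[q]? = some e) {Z : ℕ → ℕ → R}
    (hZ : ∀ a b, a < b → b < strands F (q + 1) →
      PieceSum f (splashed F) .west (zonePos F q e) a b (Z a b))
    {t a b : ℕ} (hab : a < b) (hb : b < strands F (q + 1)) (ht : t ≤ b) :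
    PieceSum f (splashed F) .west (zonePos F q e + splashPos t) a b
      (Z a b + ∑ l ∈ Finset.Ioo a t, f (.xm (q + 1) a l) * Z l b) := by
  induction t generalizing a with
  | zero => simpa [splashPos] using hZ a b hab hb
  | succ t ih =>
    rw [zonePos_add_splashPos_succ]
    have hs := hasSplash h (show t < strands F (q + 1) by omega)
    by_cases hta : t ≤ a
    · refine (hs.west_above hta hab (ih hab (by omega))).of_eq ?_
      have hI : Finset.Ioo a (t + 1) = ∅ := by ext l; simp; omega
      rw [hI, Finset.Ioo_eq_empty (by omega)]
    · refine (hs.west_inside (by omega) (by omega) (ih hab (by omega))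
        (ih (a := t) (by omega) (by omega))).of_eq ?_
      have hI : Finset.Ioo a (t + 1) = insert t (Finset.Ioo a t) := by
        ext l; simp only [Finset.mem_Ioo, Finset.mem_insert]; omega
      rw [hI, Finset.sum_insert (by simp), Finset.Ioo_self, Finset.sum_empty]
      ring

/-- The pieces to the west of slices between the splashes of a zone, bounded by strands which have
splashes to the west of the slice. -/
theorem pieceSum_west_splash' (h : F[q]? = some e) {t a b : ℕ} (hab : a < b) (hb : b < t)
    (ht : t ≤ strands F (q + 1)) :
    PieceSum f (splashed F) .west (zonePos F q e + splashPos t) a b (f (.xp (q + 1) a b)) := by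
  induction t, hb using Nat.le_induction with
  | base =>
    rw [Nat.succ_eq_add_one, zonePos_add_splashPos_succ]
    exact (hasSplash h (by omega)).west_tip hab
  | succ t hbt ih =>
    rw [zonePos_add_splashPos_succ]
    exact (hasSplash h (by omega)).west_below hab hbt (ih (by omega))

/-- This decouples the zones: everything further west is hidden behind the `xp` of the zone. -/
theorem pieceSum_west_insertPos (h : F[q]? = some e) {a b : ℕ} (hab : a < b)
    (hb : b < strands F (q + 1)) :
    PieceSum f (splashed F) .west (insertPos F (q + 1)) a b (f (.xp (q + 1) a b)) := by
  rw [insertPos_succ h]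
  exact pieceSum_west_splash' h hab hb le_rfl

end Zone

/-! ### The equations for an augmentation -/

section Augmentation

variable {F : List FrontInsert} {ε : Alg (splashed F) →+* ZMod 2}

/-- The values of an augmentation on the matrix `X⁺`. -/
noncomputable def plusMatrix (F : List FrontInsert) (ε : Alg (splashed F) →+* ZMod 2) (m i j : ℕ) :
    ZMod 2 := ε (gen (splashed F) (.xp m i j))

theorem plusMatrix_eq_zero {m i j : ℕ} (h : j ≤ i) : plusMatrix F ε m i j = 0 := by
  rw [plusMatrix, gen, dif_neg, map_zero]
  rintro ⟨k, c, hm⟩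
  exact absurd (lt_of_xp_mem hm) (not_lt.2 h)

/-- The augmentation condition for one crossing, split into the disks that leave it to the east and
to the west. -/
theorem augmentation_diskSum (hε : IsAugmentation (splashed F) ε) {s : Gen} {p k : ℕ}
    (hp : (splashed F)[p]? = some (.cross k true s)) {r r' : ZMod 2}
    (H : PieceSum (fun s => ε (gen (splashed F) s)) (splashed F) .east (p + 1) k (k + 1) r)
    (H' : PieceSum (fun s => ε (gen (splashed F) s)) (splashed F) .west p k (k + 1) r') :
    r + r' = 0 := by
  have hs : ∃ k c, Event.cross k c s ∈ splashed F := ⟨k, true, List.mem_of_getElem? hp⟩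
  have h0 : ε (diskSum (splashed F) ⟨s, hs⟩) = 0 :=
    (congrArg ε (differential_ι _ _)).symm.trans (hε _)
  exact (diskSum_eq hp (fun p' k' c h => index_unique (pairwise_splashed F) hp h) H H' ε
    (fun _ => rfl) hs).symm.trans h0

theorem pieceSum_plusMatrix {q : ℕ} (hq : q ≤ F.length) {a b : ℕ} (hab : a < b)
    (hb : b < strands F q) :
    PieceSum (fun s => ε (gen (splashed F) s)) (splashed F) .west (insertPos F q) a b
      (plusMatrix F ε q a b) := by
  cases q with
  | zero => exact absurd hb (by simp [strands])
  | succ q => exact pieceSum_west_insertPos (List.getElem?_eq_getElem (by omega)) hab hb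

/-- An entry of `X⁺ (1 + X⁻) = (1 + X⁻) Z`, read off from the disks at `xm (q + 1) i j`. The disk to
the east gives `X⁺ i j`. To the west, the lower boundary either follows the spike down to strand
`j`, which gives the right-hand side, or leaves it for strand `l`, which gives `X⁺ i l * X⁻ l j`. -/
theorem zone_equation (hF : IsFront F) (hε : IsAugmentation (splashed F) ε) {q : ℕ}
    {e : FrontInsert} (h : F[q]? = some e) {Z : ℕ → ℕ → ZMod 2}
    (hZ : ∀ a b, a < b → b < strands F (q + 1) →
      PieceSum (fun s => ε (gen (splashed F) s)) (splashed F) .west (zonePos F q e) a b (Z a b))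
    {i j : ℕ} (hij : i < j) (hj : j < strands F (q + 1)) :
    plusMatrix F ε (q + 1) i j +
      ∑ l ∈ Finset.Ioo i j, plusMatrix F ε (q + 1) i l * ε (gen (splashed F) (.xm (q + 1) l j)) =
    Z i j + ∑ l ∈ Finset.Ioo i j, ε (gen (splashed F) (.xm (q + 1) i l)) * Z l j := by
  have hs := hasSplash h hj
  have he := hs.east_disk (f := fun s => ε (gen (splashed F) s)) hij fun u hu => by
    rw [← zonePos_add_splashPos_succ]
    exact pieceSum_east_splash hF h hj hu
  have hw := hs.west_disk hij (pieceSum_west_splash h hZ hij hj le_rfl)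
    (g := plusMatrix F ε (q + 1) i)
    fun l hil hlj => pieceSum_west_splash' h hil hlj hj.le
  have hp := hs.minus i hij
  have e1 : zonePos F q e + splashPos j + (j - i) =
      zonePos F q e + splashPos j + (j - (i + 1)) + 1 := by omega
  rw [e1] at he
  have := augmentation_diskSum hε hp he hw
  rw [← CharTwo.add_eq_zero, ← this]
  simp only [mul_comm (plusMatrix F ε (q + 1) i _)]
  rw [plusMatrix]
  ring

/-- The canonical involution behind an insert is also that of the zone. -/
theorem canonicalInvolution_zone (hF : IsFront F) (hε : IsAugmentation (splashed F) ε) {q : ℕ}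
    {e : FrontInsert} (h : F[q]? = some e) {Z : ℕ → ℕ → ZMod 2}
    (hZ0 : ∀ a b, b ≤ a → Z a b = 0)
    (hZ : ∀ a b, a < b → b < strands F (q + 1) →
      PieceSum (fun s => ε (gen (splashed F) s)) (splashed F) .west (zonePos F q e) a b (Z a b))
    {τ : Fin (strands F (q + 1)) → Fin (strands F (q + 1))}
    (hτ : IsCanonicalInvolution (natDiff (strands F (q + 1)) Z) τ) :
    IsCanonicalInvolution (natDiff (strands F (q + 1)) (plusMatrix F ε (q + 1))) τ := by
  set n := strands F (q + 1)
  let X : ℕ → ℕ → ZMod 2 := fun i j =>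
    if i < j then ε (gen (splashed F) (.xm (q + 1) i j)) else 0
  have hX : ∀ i j, j ≤ i → X i j = 0 := fun i j hij => if_neg (not_lt.2 hij)
  have hsum : ∀ g : ℕ → ZMod 2, ∀ i j : Fin n, (∀ l : ℕ, l ≤ i ∨ j ≤ l → g l = 0) →
      ∑ l : Fin n, g l = ∑ l ∈ Finset.Ioo (i : ℕ) j, g l := by
    intro g i j hg
    rw [Fin.sum_univ_eq_sum_range g n]
    symm
    apply Finset.sum_subset
    · intro l hl
      rw [Finset.mem_Ioo] at hl
      rw [Finset.mem_range]
      omega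
    · intro l _ hl
      rw [Finset.mem_Ioo] at hl
      exact hg l (by omega)
  -- The unitriangular change `1 + X⁻`, which conjugates `X⁺` into `Z` by `zone_equation`.
  refine hτ.of_conj (ψ := LinearMap.id + natDiff n X) ?_ ?_
  · intro i x hx
    rw [LinearMap.add_apply, Pi.add_apply, LinearMap.id_apply,
      isTriangular_tail (isTriangular_natDiff hX) hx i (Nat.lt_succ_self _), add_zero]
  · have : (LinearMap.id + natDiff n X) ∘ₗ natDiff n (plusMatrix F ε (q + 1)) =
        natDiff n Z ∘ₗ (LinearMap.id + natDiff n X) := by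
      refine LinearMap.pi_ext' fun i => LinearMap.ext_ring ?_
      simp only [LinearMap.comp_apply, LinearMap.single_apply, LinearMap.add_apply,
        LinearMap.id_apply, map_add]
      ext j
      rw [Pi.add_apply, Pi.add_apply, natDiff_single, natDiff_single, natDiff_apply, natDiff_apply]
      simp only [natDiff_single]
      have e1 := hsum (fun l => plusMatrix F ε (q + 1) i l * X l j) i j fun l hl => by
        rcases hl with hl | hl
        · simp only [plusMatrix_eq_zero hl, zero_mul]
        · simp only [hX _ _ hl, mul_zero]
      have e2 := hsum (fun l => X i l * Z l j) i j fun l hl => by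
        rcases hl with hl | hl
        · simp only [hX _ _ hl, zero_mul]
        · simp only [hZ0 _ _ hl, mul_zero]
      rw [e1, e2]
      by_cases hij : (i : ℕ) < j
      · have := zone_equation hF hε h hZ hij j.2
        convert this using 2
        · refine Finset.sum_congr rfl fun l hl => ?_
          rw [Finset.mem_Ioo] at hl
          simp only [X, if_pos hl.2]
        · refine Finset.sum_congr rfl fun l hl => ?_
          rw [Finset.mem_Ioo] at hl
          simp only [X, if_pos hl.1]
      · rw [plusMatrix_eq_zero (not_lt.1 hij), hZ0 _ _ (not_lt.1 hij), Finset.Ioo_eq_empty hij]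
        simp
    exact LinearMap.congr_fun this

/-! #### Inserts -/

/-- The interval between the two new strands is capped by the rounding, with value one. Any other
interval with an end on a new strand would turn around there and need a piece to the east, where
there are none. The remaining intervals pass. -/
theorem pieceSum_leftCusp (hF : IsFront F) {q k : ℕ} (h : F[q]? = some (.leftCusp k)) {a b : ℕ}
    (hab : a < b) (hb : b < strands F (q + 1)) :
    PieceSum (fun s => ε (gen (splashed F) s)) (splashed F) .west (zonePos F q (.leftCusp k)) a b
      (cuspMatrix k (plusMatrix F ε q) a b) := by
  have hq : q < F.length := (List.getElem?_eq_some_iff.1 h).1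
  have hk : k ≤ strands F q := hF.1 _ _ h
  have hn : strands F (q + 1) = strands F q + 2 := strands_succ h
  have hA : Across (splashed F) .west (zonePos F q (.leftCusp k)) (closing Gen .west k)
    (insertPos F q) := ⟨getElem?_leftCusp h, rfl⟩
  by_cases h1 : a = k ∧ b = k + 1
  · obtain ⟨rfl, rfl⟩ := h1
    exact (pieceSum_cap hA).of_eq (by simp [cuspMatrix])
  by_cases h2 : a = k ∨ a = k + 1 ∨ b = k ∨ b = k + 1
  · refine (pieceSum_of_isEmpty (isEmpty_closing_of_opp hA h1 h2 (isEmpty_zonePos hF h))).of_eq ?_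
    unfold cuspMatrix
    split_ifs <;> first | rfl | omega
  · rw [not_or, not_or, not_or] at h2
    obtain ⟨h2, h3, h4, h5⟩ := h2
    obtain ⟨a, rfl⟩ : ∃ a', a = skip k a' := ⟨_, (skip_unskip h2 h3).symm⟩
    obtain ⟨b, rfl⟩ : ∃ b', b = skip k b' := ⟨_, (skip_unskip h4 h5).symm⟩
    rw [cuspMatrix_skip]
    have hab' := (skip_strictMono k).lt_iff_lt.1 hab
    refine pieceSum_closing hA hab' (pieceSum_plusMatrix hq.le hab' ?_)
    unfold skip at hb
    split_ifs at hb <;> omega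

/-- In `ε (dy) = 0` there is no contribution from the east. -/
theorem plusMatrix_cross (hF : IsFront F) (hε : IsAugmentation (splashed F) ε) {q k : ℕ}
    (h : F[q]? = some (.cross k)) : plusMatrix F ε q k (k + 1) = 0 := by
  have hq : q < F.length := (List.getElem?_eq_some_iff.1 h).1
  have := augmentation_diskSum hε (getElem?_cross h)
    (pieceSum_of_isEmpty (isEmpty_zonePos hF h _ _))
    (pieceSum_plusMatrix hq.le (Nat.lt_succ_self k) (hF.1 _ _ h))
  rwa [zero_add] at this

theorem crossMatrix_pair {E : ℕ → ℕ → ZMod 2} (hE : ∀ a b, b ≤ a → E a b = 0) (y : ZMod 2) (k : ℕ) :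
    crossMatrix y k E k (k + 1) = 0 := by
  simp [crossMatrix, hE]

/-- The one entry not controlled by triangularity of `E` is that at `(k + 1, k)`, which is `E k (k +
1)`. -/
theorem crossMatrix_eq_zero {E : ℕ → ℕ → ZMod 2} (hE : ∀ a b, b ≤ a → E a b = 0) (y : ZMod 2)
    {k : ℕ} (hk : E k (k + 1) = 0) {a b : ℕ} (hab : b ≤ a) : crossMatrix y k E a b = 0 := by
  have hE' : ∀ c d, (d ≤ c ∨ (c = k ∧ d = k + 1)) → E c d = 0 := by
    rintro c d (h | ⟨rfl, rfl⟩)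
    · exact hE c d h
    · exact hk
  unfold crossMatrix
  dsimp only
  split_ifs <;> simp (discharger := omega) only [hE', mul_zero, add_zero]

/-- The pieces to the west of the slice behind a crossing whose overcrossing strand descends. -/
theorem pieceSum_crossMatrix {S : Type} {Γ : List (Event S)} {f : S → ZMod 2} {q n k : ℕ} {s : S}
    (h : Γ[q]? = some (.cross k true s)) (hk : k + 1 < n) {E : ℕ → ℕ → ZMod 2}
    (hE0 : ∀ a b, b ≤ a → E a b = 0)
    (hE : ∀ a b, a < b → b < n → PieceSum f Γ .west q a b (E a b)) {a b : ℕ} (hab : a < b)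
    (hb : b < n) : PieceSum f Γ .west (q + 1) a b (crossMatrix (f s) k E a b) := by
  have hA : Across Γ .west (q + 1) (.cross k true s) q := ⟨h, rfl⟩
  by_cases h1 : a = k ∧ b = k + 1
  · obtain ⟨rfl, rfl⟩ := h1
    rw [crossMatrix_pair hE0]
    exact pieceSum_of_isEmpty (isEmpty_cross_pair hA)
  by_cases h2 : a = k + 1
  · subst h2
    refine (pieceSum_topCorner hA hab (hE k b (by omega) hb) (hE _ b hab hb)).of_eq ?_
    simp [crossMatrix, show b ≠ k by omega, show b ≠ k + 1 by omega]
  by_cases h3 : b = k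
  · subst h3
    refine (pieceSum_botCorner hA hab (hE a _ (by omega) hk) (hE a _ hab hb)).of_eq ?_
    simp [crossMatrix, h2, show a ≠ b by omega]
  · have hs : Equiv.swap k (k + 1) a < Equiv.swap k (k + 1) b ∧ Equiv.swap k (k + 1) b < n := by
      rw [Equiv.swap_apply_def, Equiv.swap_apply_def]
      split_ifs <;> omega
    refine (pieceSum_straight hA hab h1 (fun _ => h2) (fun _ => h3) (hE _ _ hs.1 hs.2)).of_eq ?_
    rw [Equiv.swap_apply_def, Equiv.swap_apply_def]
    unfold crossMatrix
    dsimp only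
    split_ifs <;> rfl

/-- In `ε (dz) = 0` the disk that fills the rounding contributes one from the east. -/
theorem plusMatrix_rightCusp (hF : IsFront F) (hε : IsAugmentation (splashed F) ε) {q k : ℕ}
    (h : F[q]? = some (.rightCusp k)) : plusMatrix F ε q k (k + 1) = 1 := by
  have hq : q < F.length := (List.getElem?_eq_some_iff.1 h).1
  obtain ⟨h1, h2⟩ := getElem?_rightCusp h
  have := augmentation_diskSum hε h1 (pieceSum_cap (σ := .east) ⟨h2, rfl⟩)
    (pieceSum_plusMatrix hq.le (Nat.lt_succ_self k) (hF.1 _ _ h))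
  exact (CharTwo.add_eq_zero.1 this).symm

theorem rightCuspMatrix_eq_zero {E : ℕ → ℕ → ZMod 2} (hE : ∀ a b, b ≤ a → E a b = 0) (z : ZMod 2)
    {k a b : ℕ} (hab : b ≤ a) : rightCuspMatrix z k E a b = 0 := by
  have h1 : skip k b ≤ skip k a := (skip_strictMono k).monotone hab
  have h2 : k + 1 < skip k a ∨ skip k b < k := by
    unfold skip; split_ifs <;> omega
  unfold rightCuspMatrix
  rw [hE _ _ h1]
  rcases h2 with h2 | h2
  · rw [hE _ _ h2.le, hE (skip k a) k (by omega)]; simp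
  · rw [hE k (skip k b) h2.le, hE (k + 1) (skip k b) (by omega)]; simp

/-- Going west, one first meets the rounding and then the crossing `z`. If the rounding lies inside
the interval, the boundary may wrap around it; each half then passes the crossing with or without a
corner, which gives the product in `rightCuspMatrix`. If it lies outside, that product vanishes by
triangularity. -/
theorem pieceSum_rightCusp (hF : IsFront F) {q k : ℕ} (h : F[q]? = some (.rightCusp k)) {a b : ℕ}
    (hab : a < b) (hb : b < strands F (q + 1)) :
    PieceSum (fun s => ε (gen (splashed F) s)) (splashed F) .west (zonePos F q (.rightCusp k)) a b
      (rightCuspMatrix (ε (gen (splashed F) (.z q))) k (plusMatrix F ε q) a b) := by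
  have hq : q < F.length := (List.getElem?_eq_some_iff.1 h).1
  have hk : k + 1 < strands F q := hF.1 _ _ h
  have hn : strands F (q + 1) = strands F q - 2 := strands_succ h
  obtain ⟨h1, h2⟩ := getElem?_rightCusp h
  have hA : Across (splashed F) .west (zonePos F q (.rightCusp k)) (opening Gen .west k)
    (insertPos F q + 1) := ⟨h2, rfl⟩
  have hE0 : ∀ a b, b ≤ a → plusMatrix F ε q a b = 0 := fun a b => plusMatrix_eq_zero
  set f : Gen → ZMod 2 := fun s => ε (gen (splashed F) s)
  have hW : ∀ a b, a < b → b < strands F q → PieceSum f (splashed F) .west (insertPos F q + 1) a b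
      (crossMatrix (f (.z q)) k (plusMatrix F ε q) a b) := fun a b hab hb =>
    pieceSum_crossMatrix h1 hk hE0 (fun a b hab hb => pieceSum_plusMatrix hq.le hab hb) hab hb
  have hsk : skip k b < strands F q := by
    have := skip_lt (k := k) hb
    omega
  have hs : crossMatrix (f (.z q)) k (plusMatrix F ε q) (skip k a) (skip k b) =
      plusMatrix F ε q (skip k a) (skip k b) := by
    simp [crossMatrix, skip_ne]
  have hW0 := hW _ _ (skip_strictMono k hab) hsk
  rw [hs] at hW0
  by_cases hc : a < k ∧ k ≤ b
  · obtain ⟨ha, hkb⟩ := hc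
    have ea : skip k a = a := if_pos ha
    have eb : skip k b = b + 2 := if_neg (not_lt.2 hkb)
    refine (pieceSum_split hA ha hkb hW0 (hW a k ha (by omega))
      (hW (k + 1) (b + 2) (by omega) (by omega))).of_eq ?_
    rw [rightCuspMatrix, ea, eb]
    congr 2
    · simp [crossMatrix, f, show a ≠ k by omega, show a ≠ k + 1 by omega]
    · simp [crossMatrix, f, show b + 2 ≠ k by omega, show b + 1 ≠ k by omega]
  · refine (pieceSum_opening hA hab (by omega) hW0).of_eq ?_
    rw [rightCuspMatrix]
    rcases (show k ≤ a ∨ b < k by omega) with hc | hc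
    · have ea : skip k a = a + 2 := if_neg (not_lt.2 hc)
      rw [hE0 (skip k a) (k + 1) (by omega), hE0 (skip k a) k (by omega)]; simp
    · have eb : skip k b = b := if_pos hc
      rw [hE0 k (skip k b) (by omega), hE0 (k + 1) (skip k b) (by omega)]; simp

end Augmentation

/-! ### Involutions of the strands of all zones -/

/-- `t` restricts to the canonical involution of the differential with the matrix `E`. -/
def IsCanonNat (n : ℕ) (E : ℕ → ℕ → ZMod 2) (t : ℕ → ℕ) : Prop :=
  ∃ τ : Fin n → Fin n, IsCanonicalInvolution (natDiff n E) τ ∧ ∀ i, (τ i : ℕ) = t i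

theorem exists_isCanonNat {n : ℕ} {E : ℕ → ℕ → ZMod 2} {τ : Fin n → Fin n}
    (h : IsCanonicalInvolution (natDiff n E) τ) :
    ∃ t, IsCanonNat n E t ∧ ∀ i, (τ i : ℕ) = t i := by
  have : ∀ i : Fin n, (τ i : ℕ) = (fun i => if h : i < n then (τ ⟨i, h⟩ : ℕ) else 0) (i : ℕ) :=
    fun i => by simp
  exact ⟨fun i => if h : i < n then (τ ⟨i, h⟩ : ℕ) else 0, ⟨τ, h, this⟩, this⟩

theorem IsCanonNat.unique {n : ℕ} {E : ℕ → ℕ → ZMod 2} {t t' : ℕ → ℕ} (h : IsCanonNat n E t)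
    (h' : IsCanonNat n E t') {i : ℕ} (hi : i < n) : t i = t' i := by
  obtain ⟨τ, hτ, ht⟩ := h
  obtain ⟨τ', hτ', ht'⟩ := h'
  obtain rfl := hτ.unique hτ'
  exact (ht ⟨i, hi⟩).symm.trans (ht' ⟨i, hi⟩)

theorem IsCanonNat.spec {n : ℕ} {E : ℕ → ℕ → ZMod 2} {t : ℕ → ℕ} (h : IsCanonNat n E t) {i : ℕ}
    (hi : i < n) : t i < n ∧ t (t i) = i ∧ t i ≠ i := by
  obtain ⟨τ, hτ, ht⟩ := h
  have h1 := ht ⟨i, hi⟩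
  have h2 := ht (τ ⟨i, hi⟩)
  rw [hτ.1] at h2
  have h3 := hτ.2.1 ⟨i, hi⟩
  refine ⟨h1 ▸ (τ _).2, by rw [← h1]; exact h2.symm, fun h4 => h3 (Fin.ext (h1.trans h4))⟩

/-- Involutions of the strands of the zones of a front diagram such that at each insert the pairs
follow the strands, or the insert is a normal switch. -/
structure IsNormalSystem (F : List FrontInsert) (t : ℕ → ℕ → ℕ) : Prop where
  spec : ∀ m i, i < strands F m → t m i < strands F m ∧ t m (t m i) = i ∧ t m i ≠ i
  left : ∀ q k, F[q]? = some (.leftCusp k) → t (q + 1) k = k + 1 ∧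
    ∀ i < strands F q, t (q + 1) (skip k i) = skip k (t q i)
  right : ∀ q k, F[q]? = some (.rightCusp k) → t q k = k + 1 ∧
    ∀ i < strands F (q + 1), t q (skip k i) = skip k (t (q + 1) i)
  cross : ∀ q k, F[q]? = some (.cross k) → t q k ≠ k + 1 ∧
    ((∀ i < strands F q, t (q + 1) (Equiv.swap k (k + 1) i) = Equiv.swap k (k + 1) (t q i)) ∨
    ((∀ i < strands F q, t (q + 1) i = t q i) ∧
      ((t q k < k ∧ k + 1 < t q (k + 1)) ∨ (t q (k + 1) < t q k ∧ t q k < k) ∨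
        (k + 1 < t q (k + 1) ∧ t q (k + 1) < t q k))))
  parallel : ∀ q, F[q]? = some .parallel → ∀ i < strands F q, t (q + 1) i = t q i

/-! ### Canonical involutions of all zones, from left to right -/

section Existence

variable {F : List FrontInsert} {ε : Alg (splashed F) →+* ZMod 2}

theorem isCanonNat_zone (hF : IsFront F) (hε : IsAugmentation (splashed F) ε) {q n : ℕ}
    {e : FrontInsert} (h : F[q]? = some e) {Z : ℕ → ℕ → ZMod 2}
    (hZ0 : ∀ a b, b ≤ a → Z a b = 0)
    (hZ : ∀ a b, a < b → b < strands F (q + 1) →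
      PieceSum (fun s => ε (gen (splashed F) s)) (splashed F) .west (zonePos F q e) a b (Z a b))
    (hn : strands F (q + 1) = n) {t : ℕ → ℕ} (ht : IsCanonNat n Z t) :
    IsCanonNat (strands F (q + 1)) (plusMatrix F ε (q + 1)) t := by
  subst hn
  obtain ⟨τ, hτ, h'⟩ := ht
  exact ⟨τ, canonicalInvolution_zone hF hε h hZ0 hZ hτ, h'⟩

theorem cuspMatrix_eq_zero {E : ℕ → ℕ → ZMod 2} (hE : ∀ a b, b ≤ a → E a b = 0) (k : ℕ) {a b : ℕ}
    (hab : b ≤ a) : cuspMatrix k E a b = 0 := by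
  unfold cuspMatrix
  split_ifs with h1 h2 h3
  · omega
  · rfl
  · rfl
  · apply hE
    unfold unskip
    split_ifs <;> omega

theorem isCanonNat_leftCusp (hF : IsFront F) (hε : IsAugmentation (splashed F) ε) {q k : ℕ}
    (h : F[q]? = some (.leftCusp k)) {t : ℕ → ℕ}
    (ht : IsCanonNat (strands F q) (plusMatrix F ε q) t) :
    ∃ t', IsCanonNat (strands F (q + 1)) (plusMatrix F ε (q + 1)) t' ∧ t' k = k + 1 ∧
      ∀ i < strands F q, t' (skip k i) = skip k (t i) := by
  obtain ⟨τ, hτ, hτt⟩ := ht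
  obtain ⟨τ', hτ', h1, h2⟩ := canonicalInvolution_leftCusp (hF.1 _ _ h) hτ
  obtain ⟨t', ht', hτt'⟩ := exists_isCanonNat hτ'
  refine ⟨t', isCanonNat_zone hF hε h (fun a b => cuspMatrix_eq_zero (fun _ _ => plusMatrix_eq_zero) k)
    (fun a b => pieceSum_leftCusp hF h) (strands_succ h) ht', ?_, fun i hi => ?_⟩
  · have := hτt' ⟨k, by have : k ≤ strands F q := hF.1 _ _ h; omega⟩
    rw [h2] at this
    exact this.symm
  · have := hτt' (skipFin k _ ⟨i, hi⟩)
    rw [h1] at this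
    rw [← hτt ⟨i, hi⟩]
    exact this.symm

theorem isCanonNat_rightCusp (hF : IsFront F) (hε : IsAugmentation (splashed F) ε) {q k : ℕ}
    (h : F[q]? = some (.rightCusp k)) {t : ℕ → ℕ}
    (ht : IsCanonNat (strands F q) (plusMatrix F ε q) t) :
    ∃ t', IsCanonNat (strands F (q + 1)) (plusMatrix F ε (q + 1)) t' ∧ t k = k + 1 ∧
      ∀ i < strands F (q + 1), t (skip k i) = skip k (t' i) := by
  have hk : k + 1 < strands F q := hF.1 _ _ h
  have hn : strands F (q + 1) = strands F q - 2 := strands_succ h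
  have hn' : strands F q = strands F (q + 1) + 2 := by omega
  rw [hn'] at ht
  obtain ⟨τ, hτ, hτt⟩ := ht
  obtain ⟨τ', hτ', h1, h2⟩ := canonicalInvolution_rightCusp (fun _ _ => plusMatrix_eq_zero)
    (ε (gen (splashed F) (.z q))) (by omega) (plusMatrix_rightCusp hF hε h) hτ
  obtain ⟨t', ht', hτt'⟩ := exists_isCanonNat hτ'
  refine ⟨t', isCanonNat_zone hF hε h
    (fun a b => rightCuspMatrix_eq_zero (fun _ _ => plusMatrix_eq_zero) _)
    (fun a b => pieceSum_rightCusp hF h) rfl ht', ?_, fun i hi => ?_⟩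
  · have := hτt ⟨k, by omega⟩
    rw [h2] at this
    exact this.symm
  · have := hτt (skipFin k _ ⟨i, hi⟩)
    rw [h1] at this
    rw [← hτt' ⟨i, hi⟩]
    exact this.symm

theorem swap_val {n : ℕ} (κ κ' i : Fin n) :
    ((Equiv.swap κ κ' i : Fin n) : ℕ) = Equiv.swap (κ : ℕ) κ' i := by
  rw [Equiv.swap_apply_def, Equiv.swap_apply_def]
  simp only [Fin.ext_iff]
  split_ifs <;> rfl

/-- The change at a crossing is not triangular, so the involution behind it is obtained anew from
exactness and then compared with the one in front. -/
theorem isCanonNat_cross (hF : IsFront F) (hε : IsAugmentation (splashed F) ε) {q k : ℕ}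
    (h : F[q]? = some (.cross k)) {t : ℕ → ℕ}
    (ht : IsCanonNat (strands F q) (plusMatrix F ε q) t) :
    ∃ t', IsCanonNat (strands F (q + 1)) (plusMatrix F ε (q + 1)) t' ∧ t k ≠ k + 1 ∧
    ((∀ i < strands F q, t' (Equiv.swap k (k + 1) i) = Equiv.swap k (k + 1) (t i)) ∨
    ((∀ i < strands F q, t' i = t i) ∧
      ((t k < k ∧ k + 1 < t (k + 1)) ∨ (t (k + 1) < t k ∧ t k < k) ∨
        (k + 1 < t (k + 1) ∧ t (k + 1) < t k)))) := by
  have hq : q < F.length := (List.getElem?_eq_some_iff.1 h).1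
  have hk : k + 1 < strands F q := hF.1 _ _ h
  have hn : strands F (q + 1) = strands F q := strands_succ h
  have hE0 : ∀ a b, b ≤ a → plusMatrix F ε q a b = 0 := fun _ _ => plusMatrix_eq_zero
  have hEk := plusMatrix_cross hF hε h
  set n := strands F q
  set E := plusMatrix F ε q
  set y := ε (gen (splashed F) (.y q k))
  obtain ⟨τ, hτ, hτt⟩ := ht
  let κ : Fin n := ⟨k, by omega⟩
  let κ' : Fin n := ⟨k + 1, hk⟩
  have hne : κ ≠ κ' := by simp [κ, κ', Fin.ext_iff]
  have hc := crossEquiv_natDiff (E := E) y (κ := κ) (κ' := κ') rfl hne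
  have hZ0 : ∀ a b, b ≤ a → crossMatrix y k E a b = 0 := fun a b => crossMatrix_eq_zero hE0 y hEk
  have hex : IsExact (natDiff n (crossMatrix y k E)) :=
    IsExact.of_conj (crossEquiv y κ κ' hne) hc hτ.isExact
  obtain ⟨τ', hτ'⟩ := exists_canonicalInvolution (isTriangular_natDiff hZ0) hex
  -- If `κ` and `κ'` were paired, then `d (e κ)` would have the coordinate one at `κ'`; by
  -- triangularity and the vanishing entry it is zero. This is used on both sides of the crossing.
  have hpair : ∀ {E : ℕ → ℕ → ZMod 2} {τ : Fin n → Fin n}, (∀ a b, b ≤ a → E a b = 0) →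
      E k (k + 1) = 0 → IsCanonicalInvolution (natDiff n E) τ → τ κ ≠ κ' := by
    intro E τ hE0 hEk hτ h0
    obtain ⟨h1, h2, e, hu, he⟩ := (isCanonicalInvolution_iff _ τ).1 hτ
    have hlt : κ < τ κ := by rw [h0]; exact Nat.lt_succ_self k
    have h3 := (he κ).1 hlt
    have h4 : natDiff n E (e κ) κ' = 0 := by
      rw [natDiff_apply]
      refine Finset.sum_eq_zero fun i _ => ?_
      rcases lt_trichotomy i κ with hi | hi | hi
      · rw [(hu κ).2 i hi, zero_mul]
      · rw [hi]; exact mul_eq_zero_of_right _ hEk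
      · rw [hE0 i κ' hi, mul_zero]
    rw [h3, h0, (hu κ').1] at h4
    exact one_ne_zero h4
  obtain ⟨t', ht', hτt'⟩ := exists_isCanonNat hτ'
  refine ⟨t', isCanonNat_zone hF hε h hZ0 (fun a b hab hb => ?_) hn ht', ?_, ?_⟩
  · exact pieceSum_crossMatrix (f := fun s => ε (gen (splashed F) s)) (getElem?_cross h) hk hE0
      (fun a b hab hb => pieceSum_plusMatrix hq.le hab hb) hab (hn ▸ hb)
  · have h1 := hpair hE0 hEk hτ
    intro h2
    exact h1 (Fin.ext ((hτt κ).trans h2))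
  · have h0 : (τ κ : ℕ) = t k := hτt κ
    have h1 : (τ κ' : ℕ) = t (k + 1) := hτt κ'
    rcases canonicalInvolution_cross hτ hτ' rfl hne y hc (hpair hE0 hEk hτ)
      (hpair hZ0 (crossMatrix_pair hE0 y k) hτ') with hs | ⟨hs, hnorm⟩
    · left
      intro i hi
      have h2 := congrArg Fin.val (hs ⟨i, hi⟩)
      rw [swap_val, hτt', swap_val, hτt] at h2
      exact h2
    · right
      refine ⟨fun i hi => ?_, ?_⟩
      · have h2 := hτt' ⟨i, hi⟩
        rw [hs, hτt] at h2
        exact h2.symm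
      · rw [← h0, ← h1]
        exact hnorm

theorem isCanonNat_parallel (hF : IsFront F) (hε : IsAugmentation (splashed F) ε) {q : ℕ}
    (h : F[q]? = some .parallel) {t : ℕ → ℕ}
    (ht : IsCanonNat (strands F q) (plusMatrix F ε q) t) :
    IsCanonNat (strands F (q + 1)) (plusMatrix F ε (q + 1)) t := by
  have hq : q < F.length := (List.getElem?_eq_some_iff.1 h).1
  have hn : strands F (q + 1) = strands F q := strands_succ h
  exact isCanonNat_zone hF hε h (fun _ _ => plusMatrix_eq_zero)
    (fun a b hab hb => pieceSum_plusMatrix hq.le hab (hn ▸ hb)) hn ht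

theorem exists_isCanonNat_of_strands {m : ℕ} (h : strands F m = 0) :
    ∃ t, IsCanonNat (strands F m) (plusMatrix F ε m) t := by
  rw [h]
  exact ⟨id, id, (isCanonicalInvolution_iff _ _).2 ⟨fun i => i.elim0, fun i => i.elim0,
    fun i => i.elim0, fun i => i.elim0, fun i => i.elim0⟩, fun i => i.elim0⟩

/-- Every zone has a canonical involution. -/
theorem exists_isCanonNat_zone (hF : IsFront F) (hε : IsAugmentation (splashed F) ε) (m : ℕ) :
    ∃ t, IsCanonNat (strands F m) (plusMatrix F ε m) t := by
  induction m with
  | zero => exact exists_isCanonNat_of_strands (by simp [strands])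
  | succ q ih =>
    obtain ⟨t, ht⟩ := ih
    rcases Nat.lt_or_ge q F.length with hq | hq
    · obtain ⟨e, h⟩ : ∃ e, F[q]? = some e := ⟨_, List.getElem?_eq_getElem hq⟩
      cases e with
      | leftCusp k => exact (isCanonNat_leftCusp hF hε h ht).imp fun _ h => h.1
      | rightCusp k => exact (isCanonNat_rightCusp hF hε h ht).imp fun _ h => h.1
      | cross k => exact (isCanonNat_cross hF hε h ht).imp fun _ h => h.1
      | parallel => exact ⟨t, isCanonNat_parallel hF hε h ht⟩
    · exact exists_isCanonNat_of_strands ((strands_of_length_le (by omega)).trans hF.2)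

/-- The involutions of the zones are chosen independently; uniqueness identifies each with the one
constructed across the insert. -/
theorem isNormalSystem (hF : IsFront F) (hε : IsAugmentation (splashed F) ε) {t : ℕ → ℕ → ℕ}
    (ht : ∀ m, IsCanonNat (strands F m) (plusMatrix F ε m) (t m)) : IsNormalSystem F t where
  spec m i hi := (ht m).spec hi
  left q k h := by
    obtain ⟨t', ht', h1, h2⟩ := isCanonNat_leftCusp hF hε h (ht q)
    have hn : strands F (q + 1) = strands F q + 2 := strands_succ h
    have hk : k ≤ strands F q := hF.1 _ _ h
    refine ⟨?_, fun i hi => ?_⟩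
    · rw [(ht _).unique ht' (by omega), h1]
    · rw [(ht _).unique ht' (hn ▸ skip_lt hi), h2 i hi]
  right q k h := by
    obtain ⟨t', ht', h1, h2⟩ := isCanonNat_rightCusp hF hε h (ht q)
    refine ⟨h1, fun i hi => ?_⟩
    rw [(ht _).unique ht' hi, h2 i hi]
  cross q k h := by
    obtain ⟨t', ht', h1, h2⟩ := isCanonNat_cross hF hε h (ht q)
    have hn : strands F (q + 1) = strands F q := strands_succ h
    have hk : k + 1 < strands F q := hF.1 _ _ h
    refine ⟨h1, h2.imp (fun h2 i hi => ?_) fun h2 => ⟨fun i hi => ?_, h2.2⟩⟩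
    · rw [(ht _).unique ht', h2 i hi]
      rw [hn, Equiv.swap_apply_def]
      split_ifs <;> omega
    · rw [(ht _).unique ht' (hn ▸ hi), h2.1 i hi]
  parallel q h i hi := by
    have hn : strands F (q + 1) = strands F q := strands_succ h
    exact (ht _).unique (isCanonNat_parallel hF hε h (ht q)) (hn ▸ hi)

end Existence

/-! ### The ruling -/

section Ruling

variable (F : List FrontInsert) (t : ℕ → ℕ → ℕ)

open Classical in
/-- The strand behind insert `q` which continues the path in strand `i` before it. -/
noncomputable def transport (q i : ℕ) : ℕ :=
  match F[q]? with
  | some (.leftCusp k) => skip k i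
  | some (.rightCusp k) => unskip k i
  | some (.cross k) =>
      if ∀ j < strands F q, t (q + 1) j = t q j then i else Equiv.swap k (k + 1) i
  | _ => i

/-- The strand in zone `m` of a path which starts at the left cusp in insert `l`. -/
noncomputable def rulingPath (l : ℕ) (b : Bool) : ℕ → ℕ
  | 0 => 0
  | m + 1 =>
    if m = l then
      match F[l]? with
      | some (.leftCusp k) => if b then k + 1 else k
      | _ => 0
    else transport F t m (rulingPath l b m)

/-- The paths which start at the left cusp in insert `l` end in insert `q`. -/
def EndsAt (l q : ℕ) : Prop :=
  ∃ k, F[q]? = some (.rightCusp k) ∧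
    (rulingPath F t l false q = k ∨ rulingPath F t l false q = k + 1)

/-- The paths which start at the left cusp in insert `l` exist in zone `m`. -/
def Alive (l m : ℕ) : Prop :=
  l ∈ leftCusps F ∧ l < m ∧ ∀ q, l < q → q < m → ¬ EndsAt F t l q

variable {F t}

theorem rulingPath_start {l k : ℕ} (h : F[l]? = some (.leftCusp k)) (b : Bool) :
    rulingPath F t l b (l + 1) = if b then k + 1 else k := by
  simp [rulingPath, h]

theorem rulingPath_succ {l m : ℕ} (h : l < m) (b : Bool) :
    rulingPath F t l b (m + 1) = transport F t m (rulingPath F t l b m) := by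
  simp [rulingPath, h.ne']

/-- Transport intertwines the involutions of adjacent zones, so companions remain companions. `hc`
excludes the strands that end at a right cusp. -/
theorem transport_spec (ht : IsNormalSystem F t) (hF : IsFront F) {q i : ℕ} (hq : q < F.length)
    (hi : i < strands F q) (hc : ∀ k, F[q]? = some (.rightCusp k) → i ≠ k ∧ i ≠ k + 1) :
    transport F t q i < strands F (q + 1) ∧
      t (q + 1) (transport F t q i) = transport F t q (t q i) := by
  obtain ⟨e, h⟩ : ∃ e, F[q]? = some e := ⟨_, List.getElem?_eq_getElem hq⟩
  have hn := strands_succ h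
  have hfit := hF.1 _ _ h
  unfold transport
  rw [h]
  cases e with
  | leftCusp k =>
    refine ⟨?_, (ht.left q k h).2 i hi⟩
    rw [hn]
    exact skip_lt hi
  | rightCusp k =>
    obtain ⟨h1, h2⟩ := hc k h
    have hn : strands F (q + 1) = strands F q - 2 := hn
    have hfit : k + 1 < strands F q := hfit
    have h3 : unskip k i < strands F (q + 1) := by
      rw [hn]; exact unskip_lt h1 h2 (by omega) (by omega)
    refine ⟨h3, ?_⟩
    have := (ht.right q k h).2 _ h3
    rw [skip_unskip h1 h2] at this
    simp only [this, unskip_skip]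
  | cross k =>
    have hn : strands F (q + 1) = strands F q := hn
    have hfit : k + 1 < strands F q := hfit
    dsimp only
    split_ifs with hs
    · exact ⟨hn ▸ hi, hs i hi⟩
    · refine ⟨?_, ?_⟩
      · rw [hn, Equiv.swap_apply_def]
        split_ifs <;> omega
      · rcases (ht.cross q k h).2 with h1 | h1
        · exact h1 i hi
        · exact absurd h1.1 hs
  | parallel =>
    have hn : strands F (q + 1) = strands F q := hn
    exact ⟨hn ▸ hi, ht.parallel q h i hi⟩

theorem transport_inj {q i j : ℕ} (hi : ∀ k, F[q]? = some (.rightCusp k) → i ≠ k ∧ i ≠ k + 1)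
    (hj : ∀ k, F[q]? = some (.rightCusp k) → j ≠ k ∧ j ≠ k + 1)
    (h : transport F t q i = transport F t q j) : i = j := by
  unfold transport at h
  split at h
  · exact (skip_strictMono _).injective h
  · rename_i k hk
    obtain ⟨h1, h2⟩ := hi k hk
    obtain ⟨h3, h4⟩ := hj k hk
    rw [← skip_unskip h1 h2, h, skip_unskip h3 h4]
  · split_ifs at h
    · exact h
    · exact (Equiv.swap _ _).injective h
  · exact h

theorem Alive.of_succ {l m : ℕ} (h : Alive F t l (m + 1)) (hl : l < m) : Alive F t l m :=
  ⟨h.1, hl, fun q h1 h2 => h.2.2 q h1 (by omega)⟩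

/-- The two paths are paired behind their left cusp, and transport preserves this. -/
theorem rulingPath_spec (ht : IsNormalSystem F t) (hF : IsFront F) {l m : ℕ} (hm : m ≤ F.length)
    (h : Alive F t l m) (b : Bool) : rulingPath F t l b m < strands F m ∧
      t m (rulingPath F t l b m) = rulingPath F t l (!b) m := by
  suffices H : rulingPath F t l false m < strands F m ∧
      t m (rulingPath F t l false m) = rulingPath F t l true m by
    cases b
    · exact H
    · have := ht.spec m _ H.1
      rw [H.2] at this
      exact ⟨this.1, this.2.1⟩
  induction m with
  | zero => exact absurd h.2.1 (Nat.not_lt_zero _)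
  | succ m ih =>
    rcases Nat.lt_succ_iff_lt_or_eq.1 h.2.1 with hl | rfl
    · have hm' := h.of_succ hl
      obtain ⟨h1, h2⟩ := ih (by omega) hm'
      rw [rulingPath_succ hl, rulingPath_succ hl, ← h2]
      refine transport_spec ht hF (by omega) h1 fun k hk => ?_
      have := h.2.2 m hl (Nat.lt_succ_self m)
      exact ⟨fun e => this ⟨k, hk, Or.inl e⟩, fun e => this ⟨k, hk, Or.inr e⟩⟩
    · obtain ⟨k, hk⟩ := h.1
      have h1 : strands F (l + 1) = strands F l + 2 := strands_succ hk
      have h2 : k ≤ strands F l := hF.1 _ _ hk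
      rw [rulingPath_start hk, rulingPath_start hk]
      refine ⟨?_, (ht.left l k hk).1⟩
      simp only [Bool.false_eq_true, if_false]
      omega

/-- `EndsAt` looks at one path only. As the involution pairs `k` with `k + 1` at a right cusp, both
paths arrive there together. -/
theorem endsAt_iff (ht : IsNormalSystem F t) (hF : IsFront F) {l m k : ℕ}
    (h : Alive F t l m) (hk : F[m]? = some (.rightCusp k)) (b : Bool) :
    EndsAt F t l m ↔ rulingPath F t l b m = k ∨ rulingPath F t l b m = k + 1 := by
  have hm : m < F.length := (List.getElem?_eq_some_iff.1 hk).1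
  have h1 := rulingPath_spec ht hF hm.le h false
  have h2 := rulingPath_spec ht hF hm.le h true
  have h3 := (ht.right m k hk).1
  have h4 : k + 1 < strands F m := hF.1 _ _ hk
  have h5 := (ht.spec m k (by omega)).2.1
  rw [h3] at h5
  have h0 : EndsAt F t l m ↔ rulingPath F t l false m = k ∨ rulingPath F t l false m = k + 1 := by
    constructor
    · rintro ⟨k', hk', h⟩
      cases hk.symm.trans hk'
      exact h
    · exact fun h => ⟨k, hk, h⟩
  rw [h0]
  cases b
  · exact Iff.rfl
  · rw [Bool.not_true] at h2
    rw [Bool.not_false] at h1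
    constructor
    · rintro (e | e)
      · right; rw [← h1.2, e, h3]
      · left; rw [← h1.2, e, h5]
    · rintro (e | e)
      · right; rw [← h2.2, e, h3]
      · left; rw [← h2.2, e, h5]

/-- A path that does not end in an insert does not go to a right cusp there. -/
theorem rulingPath_ne (ht : IsNormalSystem F t) (hF : IsFront F) {l m : ℕ}
    (h : Alive F t l m) (he : ¬ EndsAt F t l m) (b : Bool) (k : ℕ)
    (hk : F[m]? = some (.rightCusp k)) :
    rulingPath F t l b m ≠ k ∧ rulingPath F t l b m ≠ k + 1 := by
  rwa [endsAt_iff ht hF h hk b, not_or] at he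

/-- Transport is injective on paths that go on, and the strands of a new left cusp are outside the
image of `skip k`. -/
theorem rulingPath_inj (ht : IsNormalSystem F t) (hF : IsFront F) {l l' m : ℕ} (hm : m ≤ F.length)
    (h : Alive F t l m) (h' : Alive F t l' m) {b b' : Bool}
    (hp : rulingPath F t l b m = rulingPath F t l' b' m) : l = l' := by
  induction m with
  | zero => exact absurd h.2.1 (Nat.not_lt_zero _)
  | succ m ih =>
    have key : ∀ l b l' b', Alive F t l (m + 1) → Alive F t l' (m + 1) → l < m → l' = m →
        rulingPath F t l b (m + 1) ≠ rulingPath F t l' b' (m + 1) := by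
      rintro l b l' b' h h' hl rfl hp
      obtain ⟨k, hk⟩ := h'.1
      rw [rulingPath_succ hl, rulingPath_start hk, transport, hk] at hp
      have := skip_ne k (rulingPath F t l b l')
      dsimp only at hp
      split_ifs at hp
      · exact this.2 hp
      · exact this.1 hp
    rcases Nat.lt_succ_iff_lt_or_eq.1 h.2.1 with hl | hl <;>
      rcases Nat.lt_succ_iff_lt_or_eq.1 h'.2.1 with hl' | hl'
    · rw [rulingPath_succ hl, rulingPath_succ hl'] at hp
      have h1 := h.2.2 m hl (Nat.lt_succ_self m)
      have h2 := h'.2.2 m hl' (Nat.lt_succ_self m)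
      exact ih (by omega) (h.of_succ hl) (h'.of_succ hl') (transport_inj
        (rulingPath_ne ht hF (h.of_succ hl) h1 b)
        (rulingPath_ne ht hF (h'.of_succ hl') h2 b') hp)
    · exact absurd hp (key _ _ _ _ h h' hl hl')
    · exact absurd hp.symm (key _ _ _ _ h' h hl' hl)
    · exact hl.trans hl'.symm

theorem exists_transport_eq (hF : IsFront F) {q i : ℕ} (hq : q < F.length)
    (hi : i < strands F (q + 1)) (hc : ∀ k, F[q]? = some (.leftCusp k) → i ≠ k ∧ i ≠ k + 1) :
    ∃ j < strands F q, transport F t q j = i ∧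
      ∀ k, F[q]? = some (.rightCusp k) → j ≠ k ∧ j ≠ k + 1 := by
  obtain ⟨e, h⟩ : ∃ e, F[q]? = some e := ⟨_, List.getElem?_eq_getElem hq⟩
  have hn := strands_succ h
  have hfit := hF.1 _ _ h
  unfold transport
  rw [h]
  cases e with
  | leftCusp k =>
    obtain ⟨h1, h2⟩ := hc k h
    have hn : strands F (q + 1) = strands F q + 2 := hn
    exact ⟨unskip k i, unskip_lt h1 h2 hfit (hn ▸ hi), skip_unskip h1 h2, by simp⟩
  | rightCusp k =>
    have hn : strands F (q + 1) = strands F q - 2 := hn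
    have hfit : k + 1 < strands F q := hfit
    refine ⟨skip k i, ?_, unskip_skip k i, ?_⟩
    · have := skip_lt (k := k) hi
      omega
    · intro k' hk'
      cases hk'
      exact skip_ne k i
  | cross k =>
    have hn : strands F (q + 1) = strands F q := hn
    have hfit : k + 1 < strands F q := hfit
    dsimp only
    by_cases hs : ∀ j < strands F q, t (q + 1) j = t q j
    · exact ⟨i, hn ▸ hi, if_pos hs, by simp⟩
    · refine ⟨Equiv.swap k (k + 1) i, ?_, ?_, by simp⟩
      · rw [Equiv.swap_apply_def]
        split_ifs <;> omega
      · rw [if_neg hs, Equiv.swap_apply_self]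
  | parallel =>
    have hn : strands F (q + 1) = strands F q := hn
    exact ⟨i, hn ▸ hi, rfl, by simp⟩

/-- The paths cover all strands. -/
theorem exists_rulingPath_eq (ht : IsNormalSystem F t) (hF : IsFront F) {m i : ℕ}
    (hm : m ≤ F.length) (hi : i < strands F m) :
    ∃ l, Alive F t l m ∧ ∃ b, rulingPath F t l b m = i := by
  induction m generalizing i with
  | zero => simp [strands] at hi
  | succ m ih =>
    by_cases hc : ∀ k, F[m]? = some (.leftCusp k) → i ≠ k ∧ i ≠ k + 1
    · obtain ⟨j, hj, hji, hjc⟩ := exists_transport_eq (t := t) hF (by omega) hi hc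
      obtain ⟨l, hl, b, hb⟩ := ih (by omega) hj
      refine ⟨l, ⟨hl.1, by have := hl.2.1; omega, fun q h1 h2 => ?_⟩, b, ?_⟩
      · rcases Nat.lt_succ_iff_lt_or_eq.1 h2 with h3 | rfl
        · exact hl.2.2 q h1 h3
        · intro he
          obtain ⟨k, hk, -⟩ := id he
          rw [endsAt_iff ht hF hl hk b, hb] at he
          have := hjc k hk
          omega
      · rw [rulingPath_succ hl.2.1, hb, hji]
    · push Not at hc
      obtain ⟨k, hk, hik⟩ := hc
      refine ⟨m, ⟨⟨k, hk⟩, Nat.lt_succ_self m, fun q h1 h2 => by omega⟩, ?_⟩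
      by_cases h1 : i = k
      · exact ⟨false, by rw [rulingPath_start hk, h1]; simp⟩
      · exact ⟨true, by rw [rulingPath_start hk, hik h1]; simp⟩

/-- A path that never ended would be in a strand behind the last insert, where there is none. -/
theorem exists_endsAt (ht : IsNormalSystem F t) (hF : IsFront F) {l : ℕ} (hl : l ∈ leftCusps F) :
    ∃ q, l < q ∧ EndsAt F t l q := by
  by_contra! hcon
  obtain ⟨k, hk⟩ := id hl
  have hlt : l < F.length := (List.getElem?_eq_some_iff.1 hk).1
  have := (rulingPath_spec ht hF le_rfl ⟨hl, hlt, fun q h1 _ => hcon q h1⟩ false).1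
  rw [hF.2] at this
  omega

open Classical in
/-- The right cusp that belongs to a left cusp. -/
noncomputable def endCusp (F : List FrontInsert) (t : ℕ → ℕ → ℕ) (l : ℕ) : ℕ :=
  if h : ∃ q, l < q ∧ EndsAt F t l q then Nat.find h else 0

theorem endCusp_spec (ht : IsNormalSystem F t) (hF : IsFront F) {l : ℕ} (hl : l ∈ leftCusps F) :
    l < endCusp F t l ∧ EndsAt F t l (endCusp F t l) ∧
      ∀ m, l < m → m ≤ endCusp F t l → Alive F t l m := by
  classical
  have h := exists_endsAt ht hF hl
  have he : endCusp F t l = Nat.find h := dif_pos h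
  rw [he]
  refine ⟨(Nat.find_spec h).1, (Nat.find_spec h).2, fun m h1 h2 => ⟨hl, h1, fun q h3 h4 h5 => ?_⟩⟩
  exact Nat.find_min h (lt_of_lt_of_le h4 h2) ⟨h3, h5⟩

theorem endCusp_lt_length (ht : IsNormalSystem F t) (hF : IsFront F) {l : ℕ}
    (hl : l ∈ leftCusps F) : endCusp F t l < F.length := by
  obtain ⟨k, hk, -⟩ := (endCusp_spec ht hF hl).2.1
  exact (List.getElem?_eq_some_iff.1 hk).1

theorem Alive.le_endCusp (ht : IsNormalSystem F t) (hF : IsFront F) {l m : ℕ}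
    (h : Alive F t l m) : m ≤ endCusp F t l := by
  by_contra hlt
  have hs := endCusp_spec ht hF h.1
  exact h.2.2 _ hs.1 (not_le.1 hlt) hs.2.1

theorem transport_step (ht : IsNormalSystem F t) (hF : IsFront F) {l q : ℕ} {e : FrontInsert}
    (h : Alive F t l q) (he : ¬ EndsAt F t l q) (hq : F[q]? = some e) (b : Bool) :
    e.Step (rulingPath F t l b q) (rulingPath F t l b (q + 1)) := by
  rw [rulingPath_succ h.2.1, transport, hq]
  cases e with
  | leftCusp k => exact rfl
  | rightCusp k =>
    obtain ⟨h1, h2⟩ := rulingPath_ne ht hF h he b k hq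
    exact (skip_unskip h1 h2).symm
  | cross k =>
    simp only [FrontInsert.Step]
    by_cases hs : ∀ j < strands F q, t (q + 1) j = t q j
    · rw [if_pos hs]
      split_ifs with h1
      · exact h1
      · rfl
    · rw [if_neg hs, Equiv.swap_apply_def]
      split_ifs <;> omega
  | parallel => exact rfl

/-- The ruling that belongs to a system of involutions. -/
noncomputable def rulingOf (ht : IsNormalSystem F t) (hF : IsFront F) : Ruling F where
  rc := endCusp F t
  path := rulingPath F t
  bijOn := by
    refine ⟨fun l hl => ?_, fun l hl l' hl' hrc => ?_, ?_⟩
    · obtain ⟨k, hk, -⟩ := (endCusp_spec ht hF hl).2.1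
      exact ⟨k, hk⟩
    · have hs := endCusp_spec ht hF hl
      have hs' := endCusp_spec ht hF hl'
      have hlt := endCusp_lt_length ht hF hl
      obtain ⟨k, hk, hp⟩ := hs.2.1
      have hA := hs.2.2 _ hs.1 le_rfl
      have hA' := hs'.2.2 _ hs'.1 le_rfl
      have he' := hs'.2.1
      have hrc' : endCusp F t l = endCusp F t l' := hrc
      rw [← hrc'] at hA' he'
      have e0 := (endsAt_iff ht hF hA' hk false).1 he'
      have e1 := (endsAt_iff ht hF hA' hk true).1 he'
      have hne := (ht.spec _ _ (rulingPath_spec ht hF hlt.le hA' false).1).2.2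
      rw [(rulingPath_spec ht hF hlt.le hA' false).2, Bool.not_false] at hne
      -- The two paths from `l'` occupy both strands of the cusp, so a path from `l` shares a strand
      -- with one of them.
      have : rulingPath F t l false (endCusp F t l) = rulingPath F t l' false (endCusp F t l) ∨
          rulingPath F t l false (endCusp F t l) = rulingPath F t l' true (endCusp F t l) := by
        omega
      rcases this with h | h
      · exact rulingPath_inj ht hF hlt.le hA hA' h
      · exact rulingPath_inj ht hF hlt.le hA hA' h
    · rintro q ⟨k, hk⟩
      have hq : q < F.length := (List.getElem?_eq_some_iff.1 hk).1
      have hkn : k + 1 < strands F q := hF.1 _ _ hk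
      obtain ⟨l, hl, b, hb⟩ := exists_rulingPath_eq ht hF hq.le (i := k) (by omega)
      refine ⟨l, hl.1, le_antisymm ?_ (hl.le_endCusp ht hF)⟩
      -- Otherwise the paths would still be alive behind the insert in which they end.
      by_contra hlt
      exact ((endCusp_spec ht hF hl.1).2.2 _ (Nat.lt_succ_of_lt hl.2.1) (not_le.1 hlt)).2.2 q
        hl.2.1 (Nat.lt_succ_self q) ((endsAt_iff ht hF hl hk b).2 (Or.inl hb))
  lt_rc l hl := (endCusp_spec ht hF hl).1
  start l k hk := by
    rw [rulingPath_start hk, rulingPath_start hk]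
    simp
  finish l hl k hk := by
    have hs := endCusp_spec ht hF hl
    have hA := hs.2.2 _ hs.1 le_rfl
    have hlt := endCusp_lt_length ht hF hl
    have e0 := (endsAt_iff ht hF hA hk false).1 hs.2.1
    have e1 := (endsAt_iff ht hF hA hk true).1 hs.2.1
    have hne := (ht.spec _ _ (rulingPath_spec ht hF hlt.le hA false).1).2.2
    rw [(rulingPath_spec ht hF hlt.le hA false).2, Bool.not_false] at hne
    rcases e0 with e0 | e0 <;> rcases e1 with e1 | e1 <;> rw [e0, e1] at hne ⊢
    · exact absurd rfl hne
    · exact Set.pair_comm _ _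
    · exact absurd rfl hne
  step l hl b q e h1 h2 hq := by
    have hs := endCusp_spec ht hF hl
    refine transport_step ht hF (hs.2.2 q h1 h2.le) ?_ hq b
    exact (hs.2.2 _ hs.1 le_rfl).2.2 q h1 h2
  disjoint l hl m h1 h2 := by
    have hs := endCusp_spec ht hF hl
    have hlt := endCusp_lt_length ht hF hl
    have h := rulingPath_spec ht hF (h2.trans hlt.le) (hs.2.2 m h1 h2) false
    have := (ht.spec _ _ h.1).2.2
    rw [h.2] at this
    exact this.symm
  disjoint_cross l hl q k h1 h2 hk := by
    have hs := endCusp_spec ht hF hl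
    have hlt := endCusp_lt_length ht hF hl
    have h := rulingPath_spec ht hF (h2.trans hlt).le (hs.2.2 q h1 h2.le)
    have hc := (ht.cross q k hk).1
    intro heq
    have m0 : k ∈ ({k, k + 1} : Set ℕ) := Or.inl rfl
    have m1 : k + 1 ∈ ({k, k + 1} : Set ℕ) := Or.inr rfl
    rw [← heq] at m0 m1
    have h0 := (h false).2
    have h1 := (h true).2
    rcases m0 with m0 | m0 <;> rcases m1 with m1 | m1
    · omega
    · rw [← m0, Bool.not_false, ← m1] at h0
      exact hc h0
    · have m0' : k = rulingPath F t l true q := m0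
      rw [← m0', Bool.not_true, ← m1] at h1
      exact hc h1
    · have m0' : k = rulingPath F t l true q := m0
      have m1' : k + 1 = rulingPath F t l true q := m1
      omega
  disjoint_other l hl l' hl' hne b b' m h1 h2 h3 h4 hp := by
    have hs := endCusp_spec ht hF hl
    have hs' := endCusp_spec ht hF hl'
    have hlt := endCusp_lt_length ht hF hl
    exact hne (rulingPath_inj ht hF (h2.trans hlt.le) (hs.2.2 m h1 h2) (hs'.2.2 m h3 h4) hp)

theorem rulingOf_paired (ht : IsNormalSystem F t) (hF : IsFront F) (m i j : ℕ) :
    (rulingOf ht hF).Paired m i j ↔ i < strands F m ∧ t m i = j := by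
  constructor
  · rintro ⟨l, hl, h1, h2, b, rfl, rfl⟩
    have hs := endCusp_spec ht hF hl
    have hlt := endCusp_lt_length ht hF hl
    exact rulingPath_spec ht hF (le_trans h2 hlt.le) (hs.2.2 m h1 h2) b
  · rintro ⟨hi, rfl⟩
    have hm : m ≤ F.length := by
      by_contra hm
      rw [strands_of_length_le (not_le.1 hm).le, hF.2] at hi
      omega
    obtain ⟨l, hl, b, rfl⟩ := exists_rulingPath_eq ht hF hm hi
    exact ⟨l, hl.1, hl.2.1, hl.le_endCusp ht hF, b, rfl, (rulingPath_spec ht hF hm hl b).2.symm⟩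

/-- Transport leaves the position `k` unchanged at a crossing only where the involutions on both
sides coincide. -/
theorem rulingOf_isSwitch (ht : IsNormalSystem F t) (hF : IsFront F) {q k : ℕ}
    (h : (rulingOf ht hF).IsSwitch q k) :
    F[q]? = some (.cross k) ∧ ∀ j < strands F q, t (q + 1) j = t q j := by
  obtain ⟨hk, l, hl, h1, h2, b, hb, hb'⟩ := h
  refine ⟨hk, ?_⟩
  have hb : rulingPath F t l b q = k := hb
  have hb' : rulingPath F t l b (q + 1) = k := hb'
  rw [rulingPath_succ h1, transport, hk, hb] at hb'
  dsimp only at hb'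
  by_contra hs
  rw [if_neg hs, Equiv.swap_apply_left] at hb'
  omega

theorem rulingOf_isNormal (ht : IsNormalSystem F t) (hF : IsFront F) :
    (rulingOf ht hF).IsNormal := by
  intro q k hsw u v hu hv
  obtain ⟨hk, hs⟩ := rulingOf_isSwitch ht hF hsw
  rw [rulingOf_paired] at hu hv
  obtain ⟨hkn, rfl⟩ := hu
  obtain ⟨hkn', rfl⟩ := hv
  obtain ⟨hc, h | h⟩ := ht.cross q k hk
  -- If the pairs followed the strands and yet did not change, then `k` and `k + 1` would have the
  -- same companion.
  · exfalso
    have h1 := h (k + 1) hkn'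
    have h2 := ht.spec q k hkn
    have h3 := ht.spec q (k + 1) hkn'
    have hc' : t q (k + 1) ≠ k := fun e => hc (by
      have := h3.2.1
      rwa [e] at this)
    rw [Equiv.swap_apply_right, hs k hkn, Equiv.swap_apply_of_ne_of_ne hc' h3.2.2] at h1
    have h4 := h2.2.1
    rw [h1, h3.2.1] at h4
    omega
  · exact h.2

end Ruling

/-! ### Degrees of the switches -/

section Grading

variable {F : List FrontInsert} {ε : Alg (splashed F) →+* ZMod 2}

theorem plusMatrix_degree {ρ : ℕ} {μ : ℕ → ℕ → ZMod ρ} (hg : IsGradedAugmentation F μ ε)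
    {m i j : ℕ} (h : plusMatrix F ε m i j ≠ 0) : μ m i = μ m j + 1 := by
  unfold plusMatrix gen at h
  split_ifs at h with hs
  · have := hg ⟨_, hs⟩ h
    have h' : μ m i - μ m j - 1 = 0 := this
    rw [sub_sub, sub_eq_zero] at h'
    exact h'
  · exact absurd (map_zero ε) h

theorem IsCanonNat.degree {m : ℕ} {t : ℕ → ℕ}
    (ht : IsCanonNat (strands F m) (plusMatrix F ε m) t) {ρ : ℕ} {μ : ℕ → ℕ → ZMod ρ}
    (hg : IsGradedAugmentation F μ ε) {i : ℕ} (hi : i < strands F m) (hlt : i < t i) :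
    μ m i = μ m (t i) + 1 := by
  obtain ⟨τ, hτ, hτt⟩ := ht
  have h := hτt ⟨i, hi⟩
  have := hτ.degree (μ m) (fun _ _ _ _ => plusMatrix_degree hg) ⟨i, hi⟩
    (by rw [Fin.lt_def, h]; exact hlt)
  rw [h] at this
  exact this

/-- The companion of the upper path stays away from the crossing and keeps its position and index.
Its arrow with strand `k` has the same direction and degree one on both sides, so strand `k` has the
same index in front and behind; but behind the crossing it is the former strand `k + 1`. -/
theorem rulingOf_isGraded (hF : IsFront F) {t : ℕ → ℕ → ℕ}
    (hc : ∀ m, IsCanonNat (strands F m) (plusMatrix F ε m) (t m)) (ht : IsNormalSystem F t)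
    {ρ : ℕ} {μ : ℕ → ℕ → ZMod ρ} (hμ : IsIndex F μ) (hg : IsGradedAugmentation F μ ε) :
    (rulingOf ht hF).IsGraded μ := by
  intro q k hsw
  obtain ⟨hk, hs⟩ := rulingOf_isSwitch ht hF hsw
  have hkn : k + 1 < strands F q := hF.1 _ _ hk
  have hn : strands F (q + 1) = strands F q := strands_succ hk
  have hsp := ht.spec q k (by omega)
  have hne := (ht.cross q k hk).1
  have hidx : ∀ i < strands F q, μ (q + 1) (Equiv.swap k (k + 1) i) = μ q i := hμ q _ hk
  have hi1 := hidx (k + 1) hkn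
  have hi2 := hidx (t q k) hsp.1
  rw [Equiv.swap_apply_right] at hi1
  rw [Equiv.swap_apply_of_ne_of_ne hsp.2.2 hne] at hi2
  rw [crossDegree, sub_eq_zero, ← hi1]
  rcases lt_or_gt_of_ne hsp.2.2 with hlt | hlt
  · have h1 := (hc q).degree hg hsp.1 (by rw [hsp.2.1]; exact hlt)
    have hs' := hs _ hsp.1
    have h2 := (hc (q + 1)).degree hg (i := t q k) (by rw [hn]; exact hsp.1)
      (by rw [hs', hsp.2.1]; exact hlt)
    rw [hsp.2.1] at h1
    rw [hs', hsp.2.1, hi2, h1] at h2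
    exact add_right_cancel h2
  · have h1 := (hc q).degree hg (i := k) (by omega) hlt
    have hs' := hs k (by omega)
    have h2 := (hc (q + 1)).degree hg (i := k) (by omega) (by rw [hs']; exact hlt)
    rw [hs', hi2, ← h1] at h2
    exact h2.symm

end Grading
end LegendrianFront

theorem proposition4p5 (F : List FrontInsert) (hF : IsFront F)
    (ε : Alg (splashed F) →+* ZMod 2) (hε : IsAugmentation (splashed F) ε) :
    (∀ m, IsTriangular (zoneDifferential F ε m) ∧ IsExact (zoneDifferential F ε m)) ∧
    ∃ τ : (m : ℕ) → Fin (strands F m) → Fin (strands F m),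
      (∀ m, IsCanonicalInvolution (zoneDifferential F ε m) (τ m) ∧
        ∀ τ', IsCanonicalInvolution (zoneDifferential F ε m) τ' → τ' = τ m) ∧
      ∃ R : Ruling F,
        (∀ m i j, R.Paired m i j ↔ ∃ h : i < strands F m, (τ m ⟨i, h⟩ : ℕ) = j) ∧
        R.IsNormal ∧
        ∀ (ρ : ℕ) (μ : ℕ → ℕ → ZMod ρ), IsIndex F μ → IsGradedAugmentation F μ ε →
          R.IsGraded μ := by
  choose t ht using exists_isCanonNat_zone hF hε
  have hsys := isNormalSystem hF hε ht
  choose τ hτ hτt using ht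
  refine ⟨fun m => ⟨isTriangular_natDiff fun _ _ => plusMatrix_eq_zero, (hτ m).isExact⟩, τ,
    fun m => ⟨hτ m, fun τ' h' => (hτ m).unique h'⟩, rulingOf hsys hF, fun m i j => ?_,
    rulingOf_isNormal hsys hF, fun ρ μ hμ hg =>
      rulingOf_isGraded hF (fun m => ⟨τ m, hτ m, hτt m⟩) hsys hμ hg⟩
  rw [rulingOf_paired]
  constructor
  · rintro ⟨h, rfl⟩
    exact ⟨h, hτt m ⟨i, h⟩⟩
  · rintro ⟨h, rfl⟩
    exact ⟨h, (hτt m ⟨i, h⟩).symm⟩
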